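/- Let $K\in\{-1,0,1\}$ and $a>0$, with $a<\pi/2$ if $K=1$. Put $J_1=(-\pi,\pi)$, $J_2=(-a,a)$, $\Omega_0=J_1\times J_2$, and let $f=f_{(K)}$ be the function of $x_2$ given by $f=\cosh x_2$ for $K=-1$, $f=1$ for $K=0$, $f=\cos x_2$ for $K=1$. Consider on functions $\psi$ one of the following boundary conditions at $x_2=\pm a$: (I) $\ \partial_2\psi(\cdot,\pm a)+(\mathrm i\alpha\pm\beta)\,\psi(\cdot,\pm a)=0$ with constants $\alpha,\beta\in\mathbb R$; (II) $\ \begin{pmatrix}\psi\\ \partial_2\psi\end{pmatrix}(\cdot,a)=\begin{pmatrix}\sqrt{1+bc}\,e^{\mathrm i\phi}&b\\ c&\sqrt{1+bc}\,e^{-\mathrm i\phi}\end{pmatrix}\begin{pmatrix}\psi\\ \partial_2\psi\end{pmatrix}(\cdot,-a)$ with real constants $b>0$, $c\ge -1/b$, $\phi\in[-\pi,\pi)$. For $\iota\in\{\mathrm I,\mathrm{II}\}$ let $H_{\iota(K)}$ be the operator in $L^2(\Omega_0,f\,dx_1dx_2)$ $$H_{\iota(K)}\psi=-f^{-2}\,\partial_1^2\psi-\partial_2^2\psi-\frac{f'}{f}\,\partial_2\psi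 ,$$ whose domain consists of all $\psi\in W^{2,2}(\Omega_0)$ which satisfy, in the sense of traces, the periodic conditions $\psi(-\pi,\cdot)=\psi(\pi,\cdot)$, $\partial_1\psi(-\pi,\cdot)=\partial_1\psi(\pi,\cdot)$ a.e. on $J_2$ and the condition ($\iota$) a.e. on $J_1$. For $m\in\mathbb Z$ let $H^m_{\iota(K)}$ be the operator in $L^2(J_2,f\,dx_2)$ $$H^m_{\iota(K)}\psi=-\psi''-\frac{f'}{f}\,\psi'+\frac{m^2}{f^2}\,\psi ,$$ whose domain consists of all $\psi\in W^{2,2}(J_2)$ satisfying the (one-dimensional) condition ($\iota$). Then $$\sigma\big(H_{\iota(K)}\big)=\bigcup_{m\in\mathbb Z}\sigma\big(H^m_{\iota(K)}\big).$$ -/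

import Mathlib

open MeasureTheory Set
open scoped ContDiff Real

noncomputable section

namespace PTStrip

/-! ### Unbounded operators -/

/-- The resolvent set of an unbounded operator `A` in a complex normed space: those `z` for which
`A - z : Dom A → X` is a bijection with a bounded inverse `R`. -/
def resolventSet {X : Type*} [NormedAddCommGroup X] [NormedSpace ℂ X] (A : X →ₗ.[ℂ] X) : Set ℂ :=
  {z | ∃ R : X →L[ℂ] X,
    (∀ y : X, ∃ h : R y ∈ A.domain, A ⟨R y, h⟩ - z • R y = y) ∧
    (∀ x : A.domain, R (A x - z • (x : X)) = x)}

/-- The spectrum of an unbounded operator: the complement of its resolvent set. -/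
def spectrum {X : Type*} [NormedAddCommGroup X] [NormedSpace ℂ X] (A : X →ₗ.[ℂ] X) : Set ℂ :=
  (resolventSet A)ᶜ

/-! ### The geometry

The curvature `K ∈ {-1, 0, 1}` is an element of `SignType`. The strip is
`Ω₀ = (-π, π) × (-a, a)` with the metric `diag (f², 1)`, `f = warp K`. -/

/-- The longitudinal interval `J₁ = (-π, π)`. -/
def J₁ : Set ℝ := Ioo (-π) π

/-- The transverse interval `J₂ = (-a, a)`. -/
def J₂ (a : ℝ) : Set ℝ := Ioo (-a) a

/-- The rectangle `Ω₀ = J₁ × J₂`. -/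
def Ω₀ (a : ℝ) : Set (ℝ × ℝ) := J₁ ×ˢ J₂ a

/-- The Jacobian `f` of the Fermi coordinates: the solution of `f'' + K f = 0`, `f 0 = 1`,
`f' 0 = 0`. -/
def warp (K : SignType) (x₂ : ℝ) : ℝ :=
  match K with
  | .neg => Real.cosh x₂
  | .zero => 1
  | .pos => Real.cos x₂

/-- The logarithmic derivative `f' / f`. -/
def drift (K : SignType) (x₂ : ℝ) : ℝ :=
  match K with
  | .neg => Real.tanh x₂
  | .zero => 0
  | .pos => -Real.tan x₂

theorem drift_eq_logDeriv_warp (K : SignType) (x₂ : ℝ) :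
    drift K x₂ = deriv (warp K) x₂ / warp K x₂ := by
  cases K
  · change (0 : ℝ) = deriv (fun _ => (1 : ℝ)) x₂ / 1
    simp
  · change Real.tanh x₂ = deriv (fun x => Real.cosh x) x₂ / Real.cosh x₂
    simp [Real.tanh_eq_sinh_div_cosh]
  · change -Real.tan x₂ = deriv (fun x => Real.cos x) x₂ / Real.cos x₂
    simp [Real.tan_eq_sin_div_cos, neg_div]

/-- The Riemannian measure `|G|^{1/2} dx = f dx` on `Ω₀`. -/
def measΩ (K : SignType) (a : ℝ) : Measure (ℝ × ℝ) :=
  (volume.restrict (Ω₀ a)).withDensity fun x => ENNReal.ofReal (warp K x.2)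

/-- The measure `dν = f dx₂` on `J₂`. -/
def measJ (K : SignType) (a : ℝ) : Measure ℝ :=
  (volume.restrict (J₂ a)).withDensity fun x => ENNReal.ofReal (warp K x)

/-- The Hilbert space `L²(Ω₀, G)`. -/
abbrev L2Ω (K : SignType) (a : ℝ) := Lp ℂ 2 (measΩ K a)

/-- The Hilbert space `L²(J₂, dν)`. -/
abbrev L2J (K : SignType) (a : ℝ) := Lp ℂ 2 (measJ K a)

/-! ### Weak derivatives and traces -/

/-- `u ∈ L²(U)` has the weak derivative `g ∈ L²(U)` in the direction `v` in the open set `U`. -/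
structure HasWeakDeriv {E : Type*} [NormedAddCommGroup E] [NormedSpace ℝ E] [MeasureSpace E]
    (U : Set E) (v : E) (u g : E → ℂ) : Prop where
  memLp : MemLp u 2 (volume.restrict U)
  memLp_deriv : MemLp g 2 (volume.restrict U)
  integral_eq : ∀ φ : E → ℂ, ContDiff ℝ ∞ φ → HasCompactSupport φ → tsupport φ ⊆ U →
    ∫ x in U, u x * fderiv ℝ φ x v = -∫ x in U, g x * φ x

/-- For `u ∈ L²(Ω₀)` with weak derivative `g = ∂₁u ∈ L²(Ω₀)`: the functions `t`, `t'` on `J₂` are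
the traces of `u` on the sides `{-π} × J₂` and `{π} × J₂`. Traces are characterized by the
Gauss-Green formula, tested with all smooth functions on the closed rectangle. -/
structure HasTraces₁ (a : ℝ) (u g : ℝ × ℝ → ℂ) (t t' : ℝ → ℂ) : Prop where
  memLp_left : MemLp t 2 (volume.restrict (J₂ a))
  memLp_right : MemLp t' 2 (volume.restrict (J₂ a))
  green : ∀ φ : ℝ × ℝ → ℂ, ContDiff ℝ ∞ φ → HasCompactSupport φ →
    ∫ x in Ω₀ a, (u x * fderiv ℝ φ x (1, 0) + g x * φ x) =
      ∫ x₂ in J₂ a, (t' x₂ * φ (π, x₂) - t x₂ * φ (-π, x₂))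

/-- For `u ∈ L²(Ω₀)` with weak derivative `g = ∂₂u ∈ L²(Ω₀)`: the functions `t`, `t'` on `J₁` are
the traces of `u` on the sides `J₁ × {-a}` and `J₁ × {a}`. -/
structure HasTraces₂ (a : ℝ) (u g : ℝ × ℝ → ℂ) (t t' : ℝ → ℂ) : Prop where
  memLp_left : MemLp t 2 (volume.restrict J₁)
  memLp_right : MemLp t' 2 (volume.restrict J₁)
  green : ∀ φ : ℝ × ℝ → ℂ, ContDiff ℝ ∞ φ → HasCompactSupport φ →
    ∫ x in Ω₀ a, (u x * fderiv ℝ φ x (0, 1) + g x * φ x) =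
      ∫ x₁ in J₁, (t' x₁ * φ (x₁, a) - t x₁ * φ (x₁, -a))

/-- `u ∈ W^{2,2}(Ω₀)`, with the weak derivatives `∂₁u = d₁`, `∂₂u = d₂`, `∂₁²u = d₁₁`,
`∂₁∂₂u = ∂₂∂₁u = d₁₂`, `∂₂²u = d₂₂`, all in `L²(Ω₀)`. -/
structure IsW22 (a : ℝ) (u d₁ d₂ d₁₁ d₁₂ d₂₂ : ℝ × ℝ → ℂ) : Prop where
  h₁ : HasWeakDeriv (Ω₀ a) (1, 0) u d₁
  h₂ : HasWeakDeriv (Ω₀ a) (0, 1) u d₂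
  h₁₁ : HasWeakDeriv (Ω₀ a) (1, 0) d₁ d₁₁
  h₁₂ : HasWeakDeriv (Ω₀ a) (1, 0) d₂ d₁₂
  h₂₁ : HasWeakDeriv (Ω₀ a) (0, 1) d₁ d₁₂
  h₂₂ : HasWeakDeriv (Ω₀ a) (0, 1) d₂ d₂₂

/-! ### Boundary conditions -/

/-- The two types of PT-symmetric boundary conditions on the sides `x₂ = ±a`, with constant
coefficients. -/
inductive BC where
  | separated (α β : ℝ)
  | connected (b c φ : ℝ)

/-- The standing restrictions on the coefficients. -/
def BC.Admissible : BC → Prop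
  | .separated _ _ => True
  | .connected b c φ => 0 < b ∧ -1 / b ≤ c ∧ φ ∈ Ico (-π) π

/-- The boundary condition, for the boundary values `u = ψ(-a)`, `d = ψ'(-a)`, `u' = ψ(a)`,
`d' = ψ'(a)`:
separated: `ψ'(±a) + (±β + iα) ψ(±a) = 0`;
connected: `(ψ(a), ψ'(a))ᵀ = B (ψ(-a), ψ'(-a))ᵀ` with
`B = !![√(1+bc) e^{iφ}, b; c, √(1+bc) e^{-iφ}]`. -/
def BC.Holds : BC → ℂ → ℂ → ℂ → ℂ → Prop
  | .separated α β, u, d, u', d' =>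
      d' + (β + Complex.I * α) * u' = 0 ∧ d + (-β + Complex.I * α) * u = 0
  | .connected b c φ, u, d, u', d' =>
      u' = (Real.sqrt (1 + b * c) : ℂ) * Complex.exp (Complex.I * φ) * u + b * d ∧
      d' = c * u + (Real.sqrt (1 + b * c) : ℂ) * Complex.exp (-(Complex.I * φ)) * d

/-- Periodic boundary conditions `ψ(-π, ·) = ψ(π, ·)`, `∂₁ψ(-π, ·) = ∂₁ψ(π, ·)` a.e. on `J₂`, in
the sense of traces. -/
def IsPeriodic (a : ℝ) (u d₁ d₁₁ : ℝ × ℝ → ℂ) : Prop :=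
  ∃ t t' s s' : ℝ → ℂ, HasTraces₁ a u d₁ t t' ∧ HasTraces₁ a d₁ d₁₁ s s' ∧
    (∀ᵐ x₂ ∂volume.restrict (J₂ a), t x₂ = t' x₂ ∧ s x₂ = s' x₂)

/-- The boundary conditions `B` on `x₂ = ±a`, a.e. on `J₁`, in the sense of traces. -/
def SatisfiesBC (a : ℝ) (B : BC) (u d₂ d₂₂ : ℝ × ℝ → ℂ) : Prop :=
  ∃ t t' s s' : ℝ → ℂ, HasTraces₂ a u d₂ t t' ∧ HasTraces₂ a d₂ d₂₂ s s' ∧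
    (∀ᵐ x₁ ∂volume.restrict J₁, B.Holds (t x₁) (s x₁) (t' x₁) (s' x₁))

/-! ### Linearity of these notions -/

section Linearity

theorem integrableOn_mul_test {E : Type*} [NormedAddCommGroup E] [MeasureSpace E]
    [OpensMeasurableSpace E] [IsFiniteMeasureOnCompacts (volume : Measure E)]
    {U : Set E} {u w : E → ℂ} (hu : MemLp u 2 (volume.restrict U))
    (hw : Continuous w) (hc : HasCompactSupport w) :
    IntegrableOn (fun x => u x * w x) U := by
  have h : MemLp w 2 (volume.restrict U) := (hw.memLp_of_hasCompactSupport hc).restrict U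
  exact hu.integrable_mul h

theorem test_fderiv {E : Type*} [NormedAddCommGroup E] [NormedSpace ℝ E] {φ : E → ℂ}
    (h : ContDiff ℝ ∞ φ) (hc : HasCompactSupport φ) (v : E) :
    Continuous (fun x => fderiv ℝ φ x v) ∧ HasCompactSupport (fun x => fderiv ℝ φ x v) :=
  ⟨(h.continuous_fderiv (by simp)).clm_apply continuous_const,
    hc.fderiv_apply (𝕜 := ℝ) v⟩

theorem HasWeakDeriv.zero {E : Type*} [NormedAddCommGroup E] [NormedSpace ℝ E] [MeasureSpace E]
    (U : Set E) (v : E) : HasWeakDeriv U v (fun _ => 0) (fun _ => 0) :=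
  ⟨MemLp.zero', MemLp.zero', by simp⟩

theorem HasWeakDeriv.comb {E : Type*} [NormedAddCommGroup E] [NormedSpace ℝ E] [MeasureSpace E]
    [OpensMeasurableSpace E] [IsFiniteMeasureOnCompacts (volume : Measure E)]
    {U : Set E} {v : E} {u g u' g' : E → ℂ} (c : ℂ)
    (h : HasWeakDeriv U v u g) (h' : HasWeakDeriv U v u' g') :
    HasWeakDeriv U v (fun x => c * u x + u' x) (fun x => c * g x + g' x) := by
  refine ⟨(h.memLp.const_mul c).add h'.memLp, (h.memLp_deriv.const_mul c).add h'.memLp_deriv,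
    fun φ hφ hc hU => ?_⟩
  obtain ⟨h1, h2⟩ := test_fderiv hφ hc v
  simp only [add_mul, mul_assoc]
  rw [integral_add ((integrableOn_mul_test h.memLp h1 h2).const_mul c)
      (integrableOn_mul_test h'.memLp h1 h2),
    integral_add ((integrableOn_mul_test h.memLp_deriv hφ.continuous hc).const_mul c)
      (integrableOn_mul_test h'.memLp_deriv hφ.continuous hc),
    integral_const_mul, integral_const_mul, h.integral_eq φ hφ hc hU, h'.integral_eq φ hφ hc hU]
  ring

theorem integrableOn_trace {I : Set ℝ} (hI : volume I ≠ ⊤) {t : ℝ → ℂ}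
    (ht : MemLp t 2 (volume.restrict I)) {w : ℝ → ℂ} (hw : Continuous w) {C : ℝ}
    (hC : ∀ x, ‖w x‖ ≤ C) : IntegrableOn (fun x => t x * w x) I := by
  have : IsFiniteMeasure (volume.restrict I) := ⟨by simpa using hI.lt_top⟩
  have h1 : Integrable t (volume.restrict I) := ht.integrable (by norm_num)
  exact h1.mul_bdd (c := C) hw.aestronglyMeasurable (Filter.Eventually.of_forall hC)

theorem exists_bound {φ : ℝ × ℝ → ℂ} (h : Continuous φ) (hc : HasCompactSupport φ) :
    ∃ C, ∀ x, ‖φ x‖ ≤ C :=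
  hc.exists_bound_of_continuous h

theorem HasTraces₁.zero (a : ℝ) :
    HasTraces₁ a (fun _ => 0) (fun _ => 0) (fun _ => 0) (fun _ => 0) :=
  ⟨MemLp.zero', MemLp.zero', by simp⟩

theorem HasTraces₂.zero (a : ℝ) :
    HasTraces₂ a (fun _ => 0) (fun _ => 0) (fun _ => 0) (fun _ => 0) :=
  ⟨MemLp.zero', MemLp.zero', by simp⟩

theorem HasTraces₁.comb {a : ℝ} {u g v h : ℝ × ℝ → ℂ} {t t' s s' : ℝ → ℂ} (c : ℂ)
    (hu : HasWeakDeriv (Ω₀ a) (1, 0) u g) (hv : HasWeakDeriv (Ω₀ a) (1, 0) v h)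
    (ht : HasTraces₁ a u g t t') (hs : HasTraces₁ a v h s s') :
    HasTraces₁ a (fun x => c * u x + v x) (fun x => c * g x + h x)
      (fun x => c * t x + s x) (fun x => c * t' x + s' x) := by
  refine ⟨(ht.memLp_left.const_mul c).add hs.memLp_left,
    (ht.memLp_right.const_mul c).add hs.memLp_right, fun φ hφ hc => ?_⟩
  obtain ⟨h1, h2⟩ := test_fderiv hφ hc (1, 0)
  obtain ⟨C, hC⟩ := exists_bound hφ.continuous hc
  have hJ : volume (J₂ a) ≠ ⊤ := by simp [J₂]
  have e : ∀ y : ℝ, Continuous fun x₂ => φ (y, x₂) := fun y => hφ.continuous.comp (by fun_prop)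
  have iu := (integrableOn_mul_test hu.memLp h1 h2).add
    (integrableOn_mul_test hu.memLp_deriv hφ.continuous hc)
  have iv := (integrableOn_mul_test hv.memLp h1 h2).add
    (integrableOn_mul_test hv.memLp_deriv hφ.continuous hc)
  have it := (integrableOn_trace hJ ht.memLp_right (e π) (fun x => hC (π, x))).sub
    (integrableOn_trace hJ ht.memLp_left (e (-π)) (fun x => hC (-π, x)))
  have is := (integrableOn_trace hJ hs.memLp_right (e π) (fun x => hC (π, x))).sub
    (integrableOn_trace hJ hs.memLp_left (e (-π)) (fun x => hC (-π, x)))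
  have := congrArg₂ (fun p q => c * p + q) (ht.green φ hφ hc) (hs.green φ hφ hc)
  simp only [← integral_const_mul] at this
  erw [← integral_add (iu.const_mul c) iv, ← integral_add (it.const_mul c) is] at this
  convert this using 2 <;> funext x <;> simp only [Pi.add_apply, Pi.sub_apply] <;> ring

theorem HasTraces₂.comb {a : ℝ} {u g v h : ℝ × ℝ → ℂ} {t t' s s' : ℝ → ℂ} (c : ℂ)
    (hu : HasWeakDeriv (Ω₀ a) (0, 1) u g) (hv : HasWeakDeriv (Ω₀ a) (0, 1) v h)
    (ht : HasTraces₂ a u g t t') (hs : HasTraces₂ a v h s s') :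
    HasTraces₂ a (fun x => c * u x + v x) (fun x => c * g x + h x)
      (fun x => c * t x + s x) (fun x => c * t' x + s' x) := by
  refine ⟨(ht.memLp_left.const_mul c).add hs.memLp_left,
    (ht.memLp_right.const_mul c).add hs.memLp_right, fun φ hφ hc => ?_⟩
  obtain ⟨h1, h2⟩ := test_fderiv hφ hc (0, 1)
  obtain ⟨C, hC⟩ := exists_bound hφ.continuous hc
  have hJ : volume J₁ ≠ ⊤ := by simp [J₁]
  have e : ∀ y : ℝ, Continuous fun x₁ => φ (x₁, y) := fun y => hφ.continuous.comp (by fun_prop)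
  have iu := (integrableOn_mul_test hu.memLp h1 h2).add
    (integrableOn_mul_test hu.memLp_deriv hφ.continuous hc)
  have iv := (integrableOn_mul_test hv.memLp h1 h2).add
    (integrableOn_mul_test hv.memLp_deriv hφ.continuous hc)
  have it := (integrableOn_trace hJ ht.memLp_right (e a) (fun x => hC (x, a))).sub
    (integrableOn_trace hJ ht.memLp_left (e (-a)) (fun x => hC (x, -a)))
  have is := (integrableOn_trace hJ hs.memLp_right (e a) (fun x => hC (x, a))).sub
    (integrableOn_trace hJ hs.memLp_left (e (-a)) (fun x => hC (x, -a)))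
  have := congrArg₂ (fun p q => c * p + q) (ht.green φ hφ hc) (hs.green φ hφ hc)
  simp only [← integral_const_mul] at this
  erw [← integral_add (iu.const_mul c) iv, ← integral_add (it.const_mul c) is] at this
  convert this using 2 <;> funext x <;> simp only [Pi.add_apply, Pi.sub_apply] <;> ring

theorem BC.Holds.zero (B : BC) : B.Holds 0 0 0 0 := by
  cases B <;> simp [BC.Holds]

theorem BC.Holds.comb {B : BC} {u d u' d' v e v' e' : ℂ} (c : ℂ)
    (h : B.Holds u d u' d') (k : B.Holds v e v' e') :
    B.Holds (c * u + v) (c * d + e) (c * u' + v') (c * d' + e') := by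
  cases B with
  | separated α β =>
    obtain ⟨h1, h2⟩ := h
    obtain ⟨k1, k2⟩ := k
    exact ⟨by linear_combination c * h1 + k1, by linear_combination c * h2 + k2⟩
  | connected b γ φ =>
    obtain ⟨h1, h2⟩ := h
    obtain ⟨k1, k2⟩ := k
    exact ⟨by linear_combination c * h1 + k1, by linear_combination c * h2 + k2⟩

end Linearity

/-! ### The two-dimensional Hamiltonian -/

/-- `-Δ_G ψ = -f⁻² ∂₁²ψ - ∂₂²ψ - (f'/f) ∂₂ψ`, in terms of the derivatives of `ψ`. -/
def laplaceBeltrami (K : SignType) (d₂ d₁₁ d₂₂ : ℝ × ℝ → ℂ) (x : ℝ × ℝ) : ℂ :=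
  -(((warp K x.2 : ℝ) : ℂ) ^ 2)⁻¹ * d₁₁ x - d₂₂ x - (drift K x.2 : ℂ) * d₂ x

/-- `ψ ∈ Dom H` and `H ψ = F`: `ψ ∈ W^{2,2}(Ω₀)` satisfies the periodic boundary conditions at
`x₁ = ±π` and the conditions `B` at `x₂ = ±a`, and `F = -Δ_G ψ`. -/
def IsHamiltonianPair (K : SignType) (a : ℝ) (B : BC) (ψ F : L2Ω K a) : Prop :=
  ∃ u d₁ d₂ d₁₁ d₁₂ d₂₂ : ℝ × ℝ → ℂ, ψ =ᵐ[measΩ K a] u ∧ IsW22 a u d₁ d₂ d₁₁ d₁₂ d₂₂ ∧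
    IsPeriodic a u d₁ d₁₁ ∧ SatisfiesBC a B u d₂ d₂₂ ∧
    F =ᵐ[measΩ K a] laplaceBeltrami K d₂ d₁₁ d₂₂

theorem IsHamiltonianPair.zero (K : SignType) (a : ℝ) (B : BC) : IsHamiltonianPair K a B 0 0 := by
  refine ⟨fun _ => 0, fun _ => 0, fun _ => 0, fun _ => 0, fun _ => 0, fun _ => 0,
    Lp.coeFn_zero ℂ 2 (measΩ K a), ⟨.zero _ _, .zero _ _, .zero _ _, .zero _ _, .zero _ _, .zero _ _⟩,
    ⟨_, _, _, _, .zero a, .zero a, by simp⟩,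
    ⟨_, _, _, _, .zero a, .zero a, Filter.Eventually.of_forall fun _ => BC.Holds.zero B⟩, ?_⟩
  filter_upwards [Lp.coeFn_zero ℂ 2 (measΩ K a)] with x hx
  rw [hx]; simp [laplaceBeltrami]

theorem IsHamiltonianPair.comb {K : SignType} {a : ℝ} {B : BC} {ψ F ψ' F' : L2Ω K a} (c : ℂ)
    (h : IsHamiltonianPair K a B ψ F) (h' : IsHamiltonianPair K a B ψ' F') :
    IsHamiltonianPair K a B (c • ψ + ψ') (c • F + F') := by
  obtain ⟨u, d₁, d₂, d₁₁, d₁₂, d₂₂, hψ, W, ⟨p, p', q, q', hp, hq, hpq⟩,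
    ⟨t, t', s, s', ht, hs, hts⟩, hF⟩ := h
  obtain ⟨v, e₁, e₂, e₁₁, e₁₂, e₂₂, kψ, V, ⟨P, P', Q, Q', kp, kq, kpq⟩,
    ⟨T, T', S, S', kt, ks, kts⟩, kF⟩ := h'
  refine ⟨_, _, _, _, _, _, ?_, ⟨W.h₁.comb c V.h₁, W.h₂.comb c V.h₂, W.h₁₁.comb c V.h₁₁,
    W.h₁₂.comb c V.h₁₂, W.h₂₁.comb c V.h₂₁, W.h₂₂.comb c V.h₂₂⟩,
    ⟨_, _, _, _, hp.comb c W.h₁ V.h₁ kp, hq.comb c W.h₁₁ V.h₁₁ kq, ?_⟩,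
    ⟨_, _, _, _, ht.comb c W.h₂ V.h₂ kt, hs.comb c W.h₂₂ V.h₂₂ ks, ?_⟩, ?_⟩
  · filter_upwards [Lp.coeFn_add (c • ψ) ψ', Lp.coeFn_smul c ψ, hψ, kψ] with x h1 h2 h3 h4
    simp only [h1, h2, h3, h4, Pi.add_apply, Pi.smul_apply, smul_eq_mul]
  · filter_upwards [hpq, kpq] with x h1 h2
    simp [h1.1, h1.2, h2.1, h2.2]
  · filter_upwards [hts, kts] with x h1 h2
    exact h1.comb c h2
  · filter_upwards [Lp.coeFn_add (c • F) F', Lp.coeFn_smul c F, hF, kF] with x h1 h2 h3 h4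
    simp only [h1, h2, h3, h4, Pi.add_apply, Pi.smul_apply, smul_eq_mul, laplaceBeltrami]
    ring

/-- The graph of `H`. -/
def hamiltonianGraph (K : SignType) (a : ℝ) (B : BC) : Submodule ℂ (L2Ω K a × L2Ω K a) where
  carrier := {p | IsHamiltonianPair K a B p.1 p.2}
  zero_mem' := IsHamiltonianPair.zero K a B
  add_mem' {p q} hp hq := by
    simpa using IsHamiltonianPair.comb 1 hp hq
  smul_mem' c p hp := by
    simpa using IsHamiltonianPair.comb c hp (IsHamiltonianPair.zero K a B)

/-- The Hamiltonian `H` in `L²(Ω₀, G)` as an unbounded operator. -/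
def hamiltonian (K : SignType) (a : ℝ) (B : BC) : L2Ω K a →ₗ.[ℂ] L2Ω K a :=
  (hamiltonianGraph K a B).toLinearPMap

/-! ### The transverse operators -/

/-- `-ψ'' - (f'/f) ψ' + m² f⁻² ψ`, in terms of `ψ` and its derivatives. -/
def transverseAction (K : SignType) (m : ℤ) (u₀ u₁ u₂ : ℝ → ℂ) (x : ℝ) : ℂ :=
  -u₂ x - (drift K x : ℂ) * u₁ x + (m : ℂ) ^ 2 * (((warp K x : ℝ) : ℂ) ^ 2)⁻¹ * u₀ x

/-- `ψ ∈ Dom H^m` and `H^m ψ = F`: `ψ ∈ W^{2,2}(J₂)`, the continuous representatives `u₀`, `u₁` of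
`ψ` and `ψ'` on `[-a, a]` satisfy the boundary conditions `B`, and
`F = -ψ'' - (f'/f) ψ' + m² f⁻² ψ`. -/
def IsTransversePair (K : SignType) (a : ℝ) (B : BC) (m : ℤ) (ψ F : L2J K a) : Prop :=
  ∃ u₀ u₁ u₂ : ℝ → ℂ, ψ =ᵐ[measJ K a] u₀ ∧
    HasWeakDeriv (J₂ a) 1 u₀ u₁ ∧ HasWeakDeriv (J₂ a) 1 u₁ u₂ ∧
    ContinuousOn u₀ (Icc (-a) a) ∧ ContinuousOn u₁ (Icc (-a) a) ∧
    B.Holds (u₀ (-a)) (u₁ (-a)) (u₀ a) (u₁ a) ∧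
    F =ᵐ[measJ K a] transverseAction K m u₀ u₁ u₂

theorem IsTransversePair.zero (K : SignType) (a : ℝ) (B : BC) (m : ℤ) :
    IsTransversePair K a B m 0 0 := by
  refine ⟨fun _ => 0, fun _ => 0, fun _ => 0, Lp.coeFn_zero ℂ 2 (measJ K a), .zero _ _, .zero _ _,
    continuousOn_const, continuousOn_const, BC.Holds.zero B, ?_⟩
  filter_upwards [Lp.coeFn_zero ℂ 2 (measJ K a)] with x hx
  rw [hx]; simp [transverseAction]

theorem IsTransversePair.comb {K : SignType} {a : ℝ} {B : BC} {m : ℤ} {ψ F ψ' F' : L2J K a} (c : ℂ)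
    (h : IsTransversePair K a B m ψ F) (h' : IsTransversePair K a B m ψ' F') :
    IsTransversePair K a B m (c • ψ + ψ') (c • F + F') := by
  obtain ⟨u₀, u₁, u₂, hψ, h1, h2, c0, c1, hB, hF⟩ := h
  obtain ⟨v₀, v₁, v₂, kψ, k1, k2, e0, e1, kB, kF⟩ := h'
  refine ⟨_, _, _, ?_, h1.comb c k1, h2.comb c k2, (c0.const_mul c).add e0,
    (c1.const_mul c).add e1, hB.comb c kB, ?_⟩
  · filter_upwards [Lp.coeFn_add (c • ψ) ψ', Lp.coeFn_smul c ψ, hψ, kψ] with x h1 h2 h3 h4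
    simp only [h1, h2, h3, h4, Pi.add_apply, Pi.smul_apply, smul_eq_mul]
  · filter_upwards [Lp.coeFn_add (c • F) F', Lp.coeFn_smul c F, hF, kF] with x h1 h2 h3 h4
    simp only [h1, h2, h3, h4, Pi.add_apply, Pi.smul_apply, smul_eq_mul, transverseAction]
    ring

/-- The graph of `H^m`. -/
def transverseGraph (K : SignType) (a : ℝ) (B : BC) (m : ℤ) :
    Submodule ℂ (L2J K a × L2J K a) where
  carrier := {p | IsTransversePair K a B m p.1 p.2}
  zero_mem' := IsTransversePair.zero K a B m
  add_mem' {p q} hp hq := by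
    simpa using IsTransversePair.comb 1 hp hq
  smul_mem' c p hp := by
    simpa using IsTransversePair.comb c hp (IsTransversePair.zero K a B m)

/-- The transverse operator `H^m` in `L²(J₂, dν)` as an unbounded operator. -/
def transverse (K : SignType) (a : ℝ) (B : BC) (m : ℤ) : L2J K a →ₗ.[ℂ] L2J K a :=
  (transverseGraph K a B m).toLinearPMap

/-! ### Single-valuedness

The two graphs above are graphs of operators, so that `toLinearPMap` returns these operators. -/

theorem warp_pos {K : SignType} {a : ℝ} (hK : K = 1 → a < π / 2) {x : ℝ} (hx : x ∈ J₂ a) :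
    0 < warp K x := by
  cases K
  · exact one_pos
  · exact Real.cosh_pos x
  · have := hK rfl
    exact Real.cos_pos_of_mem_Ioo ⟨by linarith [hx.1], by linarith [hx.2]⟩

theorem continuous_warp (K : SignType) : Continuous (warp K) := by
  cases K
  · exact continuous_const
  · exact Real.continuous_cosh
  · exact Real.continuous_cos

theorem measΩ_ae_iff {K : SignType} {a : ℝ} (hK : K = 1 → a < π / 2) (p : ℝ × ℝ → Prop) :
    (∀ᵐ x ∂measΩ K a, p x) ↔ ∀ᵐ x ∂volume.restrict (Ω₀ a), p x := by
  have hm : Measurable fun x : ℝ × ℝ => ENNReal.ofReal (warp K x.2) :=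
    ((continuous_warp K).comp continuous_snd).measurable.ennreal_ofReal
  have hΩ : MeasurableSet (Ω₀ a) := measurableSet_Ioo.prod measurableSet_Ioo
  rw [measΩ, ae_withDensity_iff hm]
  refine Filter.eventually_congr ?_
  filter_upwards [ae_restrict_mem hΩ] with x hx
  simp [warp_pos hK hx.2]

theorem measJ_ae_iff {K : SignType} {a : ℝ} (hK : K = 1 → a < π / 2) (p : ℝ → Prop) :
    (∀ᵐ x ∂measJ K a, p x) ↔ ∀ᵐ x ∂volume.restrict (J₂ a), p x := by
  have hm : Measurable fun x : ℝ => ENNReal.ofReal (warp K x) :=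
    (continuous_warp K).measurable.ennreal_ofReal
  rw [measJ, ae_withDensity_iff hm]
  refine Filter.eventually_congr ?_
  filter_upwards [ae_restrict_mem measurableSet_Ioo] with x hx
  simp [warp_pos hK hx]

theorem HasWeakDeriv.ae_zero {E : Type*} [NormedAddCommGroup E] [NormedSpace ℝ E] [MeasureSpace E]
    [BorelSpace E] [FiniteDimensional ℝ E] [IsFiniteMeasureOnCompacts (volume : Measure E)]
    {U : Set E} (hU : IsOpen U) {v : E} {u g : E → ℂ} (h : HasWeakDeriv U v u g)
    (h0 : ∀ᵐ x ∂volume.restrict U, u x = 0) : ∀ᵐ x ∂volume.restrict U, g x = 0 := by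
  have : IsLocallyFiniteMeasure (volume : Measure E) := inferInstance
  rw [ae_restrict_iff' hU.measurableSet]
  refine hU.ae_eq_zero_of_integral_contDiff_smul_eq_zero
    (LocallyIntegrableOn.mono_set (t := U) ?_ subset_rfl) fun φ hφ hc hs => ?_
  · exact (locallyIntegrableOn_of_locallyIntegrable_restrict
      (h.memLp_deriv.locallyIntegrable (by norm_num)))
  · have hφ' : ContDiff ℝ ∞ fun x => (φ x : ℂ) := Complex.ofRealCLM.contDiff.comp hφ
    have hts : tsupport (fun x => (φ x : ℂ)) ⊆ tsupport φ :=
      closure_mono fun x hx => by simpa using hx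
    have hc' : HasCompactSupport fun x => (φ x : ℂ) := hc.comp_left (g := ((↑) : ℝ → ℂ)) rfl
    have key := h.integral_eq _ hφ' hc' (hts.trans hs)
    rw [integral_eq_zero_of_ae (by filter_upwards [h0] with x hx; simp [hx])] at key
    have e : ∫ x in U, φ x • g x = ∫ x, φ x • g x := by
      refine setIntegral_eq_integral_of_forall_compl_eq_zero fun x hx => ?_
      rw [image_eq_zero_of_notMem_tsupport fun h' => hx (hs h'), zero_smul]
    rw [← e]
    have : ∫ x in U, g x * (φ x : ℂ) = 0 := by linear_combination key
    rw [← this]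
    exact integral_congr_ae (Filter.Eventually.of_forall fun x => by simp [mul_comm])

theorem hamiltonianGraph_single_valued {K : SignType} {a : ℝ} (hK : K = 1 → a < π / 2) (B : BC) :
    ∀ p ∈ hamiltonianGraph K a B, p.1 = 0 → p.2 = 0 := by
  rintro ⟨ψ, F⟩ ⟨u, d₁, d₂, d₁₁, d₁₂, d₂₂, hψ, W, -, -, hF⟩ (rfl : ψ = 0)
  have hΩ : IsOpen (Ω₀ a) := isOpen_Ioo.prod isOpen_Ioo
  have h0 : ∀ᵐ x ∂volume.restrict (Ω₀ a), u x = 0 := by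
    rw [← measΩ_ae_iff hK]
    filter_upwards [hψ, Lp.coeFn_zero ℂ 2 (measΩ K a)] with x h1 h2
    rw [← h1, h2]; rfl
  have h2 := W.h₂.ae_zero hΩ h0
  have h11 := W.h₁₁.ae_zero hΩ (W.h₁.ae_zero hΩ h0)
  have h22 := W.h₂₂.ae_zero hΩ h2
  refine Lp.ext ?_
  have : ∀ᵐ x ∂measΩ K a, laplaceBeltrami K d₂ d₁₁ d₂₂ x = 0 := by
    rw [measΩ_ae_iff hK]
    filter_upwards [h2, h11, h22] with x k1 k2 k3
    simp [laplaceBeltrami, k1, k2, k3]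
  filter_upwards [hF, this, Lp.coeFn_zero ℂ 2 (measΩ K a)] with x k1 k2 k3
  rw [k3]; exact k1.trans k2

theorem transverseGraph_single_valued {K : SignType} {a : ℝ} (hK : K = 1 → a < π / 2) (B : BC)
    (m : ℤ) : ∀ p ∈ transverseGraph K a B m, p.1 = 0 → p.2 = 0 := by
  rintro ⟨ψ, F⟩ ⟨u₀, u₁, u₂, hψ, w1, w2, -, -, -, hF⟩ (rfl : ψ = 0)
  have h0 : ∀ᵐ x ∂volume.restrict (J₂ a), u₀ x = 0 := by
    rw [← measJ_ae_iff hK]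
    filter_upwards [hψ, Lp.coeFn_zero ℂ 2 (measJ K a)] with x h1 h2
    rw [← h1, h2]; rfl
  have h1 := w1.ae_zero isOpen_Ioo h0
  have h2 := w2.ae_zero isOpen_Ioo h1
  refine Lp.ext ?_
  have : ∀ᵐ x ∂measJ K a, transverseAction K m u₀ u₁ u₂ x = 0 := by
    rw [measJ_ae_iff hK]
    filter_upwards [h0, h1, h2] with x k1 k2 k3
    simp [transverseAction, k1, k2, k3]
  filter_upwards [hF, this, Lp.coeFn_zero ℂ 2 (measJ K a)] with x k1 k2 k3
  rw [k3]; exact k1.trans k2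

end PTStrip

end

/-! The variables separate. The metric and the boundary coefficients do not depend on `x₁`, so the
periodic Fourier modes `e^{imx₁}` split `L²(Ω₀)` into an orthogonal sum of copies of `L²(J₂)`, on
the `m`-th of which the Hamiltonian acts as the transverse operator `H^m`. The theorem amounts to:
`z` is a resolvent point of `H` if and only if it is one of every `H^m`.

On `[-a, a]` the function `f` is bounded and bounded away from zero. The weighted `L²` spaces are
therefore the unweighted ones with equivalent norms, and resolvent points are invariant under such
an isomorphism, so all the analysis is done without the weight.

From `H` to `H^m`: the embedding `modeEmb` of the `m`-th mode and its adjoint `modeProj` intertwine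
the graphs, so compressing the resolvent of `H` gives a resolvent of `H^m`
(`IsResolventPoint.of_retract`). That `modeProj` respects domains and boundary conditions is read
off from the Gauss-Green formula tested with `e^{-imx₁} φ(x₂)` (`modeProj_mem_graph`).

From all `H^m` to `H`: the resolvents `R m` must be bounded uniformly in `m`, and their direct sum
must take values in `W^{2,2}` with the right traces. The operators need not be self-adjoint, so
distance to the spectrum is of no help; an energy estimate replaces it (`exists_coercive`). The
boundary terms and the drift are of lower order, whereas `m² f⁻²` is coercive. Hence for large `|m|`
the resolvent bound comes from the equation itself, and the finitely many other `m` are covered by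
the given bounds (`exists_uniform_bound`). The resulting decay of the components (weight `1 + m²` on
`u`, `1 + |m|` on `u'`, none on `u''`) is exactly what makes all second derivatives of the sum
square summable; it also makes the trace series converge (`exists_mem_hamiltonianGraph'`). The
resolvent equation for the sum is then checked mode by mode, since Fourier coefficients determine a
function (`eq_zero_of_modeProj`). -/

noncomputable section
namespace PTStrip

/-! ### Resolvents of graphs -/

/-- `z` lies in the resolvent set of the operator with graph `G`. -/
def IsResolventPoint {X : Type*} [NormedAddCommGroup X] [NormedSpace ℂ X]
    (G : Submodule ℂ (X × X)) (z : ℂ) : Prop :=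
  ∃ R : X →L[ℂ] X, (∀ y, (R y, y + z • R y) ∈ G) ∧ ∀ p ∈ G, R (p.2 - z • p.1) = p.1

/-- Single-valuedness is what makes `G` the graph of `G.toLinearPMap`. After this lemma partial maps
disappear and only graphs are handled. -/
theorem mem_resolventSet_toLinearPMap {X : Type*} [NormedAddCommGroup X] [NormedSpace ℂ X]
    {G : Submodule ℂ (X × X)} (hG : ∀ p ∈ G, p.1 = 0 → p.2 = 0) {z : ℂ} :
    z ∈ resolventSet G.toLinearPMap ↔ IsResolventPoint G z := by
  have hgr := Submodule.toLinearPMap_graph_eq G hG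
  refine exists_congr fun R => and_congr (forall_congr' fun y => ?_) ⟨fun h p hp => ?_, fun h x => ?_⟩
  · have key : (R y, y + z • R y) ∈ G ↔ (R y, y + z • R y) ∈ G.toLinearPMap.graph := by rw [hgr]
    rw [key, LinearPMap.mem_graph_iff]
    constructor
    · rintro ⟨h, e⟩
      exact ⟨⟨R y, h⟩, rfl, by rw [← sub_eq_iff_eq_add]; exact e⟩
    · rintro ⟨x, hx, e⟩
      simp only at hx e
      have h : R y ∈ G.toLinearPMap.domain := hx ▸ x.2
      refine ⟨h, ?_⟩
      have : (⟨R y, h⟩ : G.toLinearPMap.domain) = x := Subtype.ext hx.symm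
      rw [this, e, add_sub_cancel_right]
  · rw [← hgr, LinearPMap.mem_graph_iff] at hp
    obtain ⟨x, h1, h2⟩ := hp
    rw [← h1, ← h2]
    exact h x
  · have := h _ (hgr ▸ LinearPMap.mem_graph _ x)
    exact this

theorem IsResolventPoint.of_equiv {X Y : Type*} [NormedAddCommGroup X] [NormedSpace ℂ X]
    [NormedAddCommGroup Y] [NormedSpace ℂ Y] {G : Submodule ℂ (X × X)} {G' : Submodule ℂ (Y × Y)}
    (e : X ≃L[ℂ] Y) (h : ∀ x y, (x, y) ∈ G ↔ (e x, e y) ∈ G') {z : ℂ}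
    (hz : IsResolventPoint G z) : IsResolventPoint G' z := by
  obtain ⟨R, h1, h2⟩ := hz
  refine ⟨(e : X →L[ℂ] Y) ∘L R ∘L (e.symm : Y →L[ℂ] X), fun y => ?_, ?_⟩
  · simpa using (h _ _).1 (h1 (e.symm y))
  · rintro ⟨x, y⟩ hp
    have := h2 (e.symm x, e.symm y) ((h _ _).2 (by simpa using hp))
    simp only at this
    simp [this]

theorem isResolventPoint_congr_equiv {X Y : Type*} [NormedAddCommGroup X] [NormedSpace ℂ X]
    [NormedAddCommGroup Y] [NormedSpace ℂ Y] {G : Submodule ℂ (X × X)} {G' : Submodule ℂ (Y × Y)}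
    (e : X ≃L[ℂ] Y) (h : ∀ x y, (x, y) ∈ G ↔ (e x, e y) ∈ G') {z : ℂ} :
    IsResolventPoint G z ↔ IsResolventPoint G' z :=
  ⟨.of_equiv e h, .of_equiv e.symm fun x y => by rw [h]; simp⟩

/-- If `E` intertwines `G'` with `G`, `P` intertwines `G` with `G'` and `P` is a left inverse of
`E`, then resolvent points of `G` are resolvent points of `G'`. -/
theorem IsResolventPoint.of_retract {X Y : Type*} [NormedAddCommGroup X] [NormedSpace ℂ X]
    [NormedAddCommGroup Y] [NormedSpace ℂ Y] {G : Submodule ℂ (X × X)} {G' : Submodule ℂ (Y × Y)}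
    (E : Y →L[ℂ] X) (P : X →L[ℂ] Y) (hPE : ∀ y, P (E y) = y)
    (hE : ∀ x y, (x, y) ∈ G' → (E x, E y) ∈ G) (hP : ∀ x y, (x, y) ∈ G → (P x, P y) ∈ G') {z : ℂ}
    (hz : IsResolventPoint G z) : IsResolventPoint G' z := by
  obtain ⟨R, h1, h2⟩ := hz
  -- The compression `P R E` is the resolvent: `P` carries the resolvent relation of `G` at `E y` to
  -- `G'`, and `P E = 1` cleans up both identities.
  refine ⟨P ∘L R ∘L E, fun y => ?_, ?_⟩
  · simpa [hPE] using hP _ _ (h1 (E y))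
  · rintro ⟨x, y⟩ hp
    have := h2 _ (hE x y hp)
    simp only [← map_smul, ← map_sub] at this
    change P (R (E (y - z • x))) = x
    rw [this, hPE]

/-! ### Equivalent measures -/

/-- The identity on functions; domination of the measures bounds the norm by the factor `c ^ (1 /
2)`. -/
theorem lp_exists_continuousLinearMap_of_le_smul {α : Type*} [MeasurableSpace α] {μ ν : Measure α}
    {c : ENNReal} (hc : c ≠ ⊤) (h : ν ≤ c • μ) :
    ∃ e : Lp ℂ 2 μ →L[ℂ] Lp ℂ 2 ν, ∀ f, e f =ᵐ[ν] f := by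
  have hac : ν ≪ μ := (Measure.absolutelyContinuous_of_le h).trans
    (Measure.smul_absolutelyContinuous)
  have hm : ∀ f : Lp ℂ 2 μ, MemLp f 2 ν := fun f => (Lp.memLp f).of_measure_le_smul hc h
  let L : Lp ℂ 2 μ →ₗ[ℂ] Lp ℂ 2 ν :=
    { toFun := fun f => (hm f).toLp f
      map_add' := fun f g => by
        ext1
        filter_upwards [(hm (f + g)).coeFn_toLp, (hm f).coeFn_toLp, (hm g).coeFn_toLp,
          Lp.coeFn_add ((hm f).toLp f) ((hm g).toLp g), hac (Lp.coeFn_add f g)] with x h1 h2 h3 h4 h5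
        rw [h1, h4, Pi.add_apply, h2, h3, h5, Pi.add_apply]
      map_smul' := fun r f => by
        ext1
        filter_upwards [(hm (r • f)).coeFn_toLp, (hm f).coeFn_toLp,
          Lp.coeFn_smul r ((hm f).toLp f), hac (Lp.coeFn_smul r f)] with x h1 h2 h4 h5
        rw [h1, RingHom.id_apply, h4, Pi.smul_apply, h2, h5, Pi.smul_apply] }
  refine ⟨L.mkContinuous (c ^ (1 / (2 : ENNReal)).toReal).toReal fun f => ?_,
    fun f => (hm f).coeFn_toLp⟩
  change ‖(hm f).toLp f‖ ≤ _
  rw [Lp.norm_toLp, Lp.norm_def, ← ENNReal.toReal_mul]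
  refine ENNReal.toReal_mono ?_ (eLpNorm_le_of_measure_le_smul h)
  exact ENNReal.mul_ne_top (ENNReal.rpow_ne_top_of_nonneg (by simp) hc) (Lp.memLp f).2.ne

theorem lp_exists_equiv {α : Type*} [MeasurableSpace α] {μ ν : Measure α}
    {c c' : ENNReal} (hc : c ≠ ⊤) (hc' : c' ≠ ⊤) (h : ν ≤ c • μ) (h' : μ ≤ c' • ν) :
    ∃ e : Lp ℂ 2 μ ≃L[ℂ] Lp ℂ 2 ν, ∀ f, e f =ᵐ[ν] f := by
  obtain ⟨e, he⟩ := lp_exists_continuousLinearMap_of_le_smul hc h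
  obtain ⟨e', he'⟩ := lp_exists_continuousLinearMap_of_le_smul hc' h'
  have hac : ν ≪ μ := (Measure.absolutelyContinuous_of_le h).trans
    (Measure.smul_absolutelyContinuous)
  have hac' : μ ≪ ν := (Measure.absolutelyContinuous_of_le h').trans
    (Measure.smul_absolutelyContinuous)
  refine ⟨ContinuousLinearEquiv.equivOfInverse e e' (fun f => ?_) (fun f => ?_), he⟩
  · exact Lp.ext ((he' _).trans (hac' (he f)))
  · exact Lp.ext ((he _).trans (hac (he' f)))

/-! ### Bounds for the metric coefficients -/

/-- Positivity up to the endpoints, which rests on the strict inequality `a < π / 2`; compactness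
then turns it into uniform bounds for the metric coefficients. -/
theorem warp_pos_of_mem_Icc {K : SignType} {a : ℝ} (hK : K = 1 → a < π / 2) {x : ℝ}
    (hx : x ∈ Icc (-a) a) : 0 < warp K x := by
  cases K
  · exact one_pos
  · exact Real.cosh_pos x
  · have := hK rfl
    exact Real.cos_pos_of_mem_Ioo ⟨by linarith [hx.1], by linarith [hx.2]⟩

theorem exists_warp_bounds {K : SignType} {a : ℝ} (hK : K = 1 → a < π / 2) :
    ∃ k C : ℝ, 0 < k ∧ 0 < C ∧ ∀ x ∈ Icc (-a) a, k ≤ warp K x ∧ warp K x ≤ C := by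
  rcases (Icc (-a) a).eq_empty_or_nonempty with h | h
  · exact ⟨1, 1, one_pos, one_pos, by simp [h]⟩
  obtain ⟨x, hx, h1⟩ := isCompact_Icc.exists_isMinOn h (continuous_warp K).continuousOn
  obtain ⟨y, hy, h2⟩ := isCompact_Icc.exists_isMaxOn h (continuous_warp K).continuousOn
  exact ⟨warp K x, warp K y, warp_pos_of_mem_Icc hK hx, warp_pos_of_mem_Icc hK hy,
    fun w hw => ⟨h1 hw, h2 hw⟩⟩

theorem measurable_drift (K : SignType) : Measurable (drift K) := by
  have h : drift K = fun x => deriv (warp K) x / warp K x :=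
    funext fun x => drift_eq_logDeriv_warp K x
  rw [h]
  exact (measurable_deriv _).div (continuous_warp K).measurable

theorem exists_drift_bound {K : SignType} {a : ℝ} (hK : K = 1 → a < π / 2) :
    ∃ C : ℝ, 0 ≤ C ∧ ∀ x ∈ Icc (-a) a, |drift K x| ≤ C := by
  have hd : Continuous (deriv (warp K)) := by
    cases K
    · change Continuous (deriv fun _ => (1 : ℝ))
      simpa using continuous_const
    · change Continuous (deriv fun x => Real.cosh x)
      simpa using Real.continuous_sinh
    · change Continuous (deriv fun x => Real.cos x)
      simp only [Real.deriv_cos']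
      exact Real.continuous_sin.neg
  have hc : ContinuousOn (drift K) (Icc (-a) a) := by
    have h : drift K = fun x => deriv (warp K) x / warp K x :=
      funext fun x => drift_eq_logDeriv_warp K x
    rw [h]
    exact hd.continuousOn.div (continuous_warp K).continuousOn
      fun x hx => (warp_pos_of_mem_Icc hK hx).ne'
  obtain ⟨C, hC⟩ := isCompact_Icc.exists_bound_of_continuousOn hc
  exact ⟨max C 0, le_max_right _ _, fun x hx => (hC x hx).trans (le_max_left _ _)⟩

/-- A density between two positive constants changes the `L²` norm only to an equivalent one. -/
theorem exists_equiv_of_withDensity {α : Type*} [MeasurableSpace α] {μ : Measure α} {w : α → ℝ}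
    {k C : ℝ} (hk : 0 < k) (h : ∀ᵐ x ∂μ, k ≤ w x ∧ w x ≤ C) :
    ∃ e : Lp ℂ 2 (μ.withDensity fun x => ENNReal.ofReal (w x)) ≃L[ℂ] Lp ℂ 2 μ,
      ∀ f, e f =ᵐ[μ] f := by
  have hk' : ENNReal.ofReal k ≠ 0 := by simpa using hk
  refine lp_exists_equiv (c := (ENNReal.ofReal k)⁻¹) (c' := ENNReal.ofReal C)
    (by simpa using hk) (by simp) ?_ ?_
  · have : ENNReal.ofReal k • μ ≤ μ.withDensity fun x => ENNReal.ofReal (w x) := by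
      rw [← withDensity_const]
      exact withDensity_mono (h.mono fun x hx => ENNReal.ofReal_le_ofReal hx.1)
    calc μ = (ENNReal.ofReal k)⁻¹ • ENNReal.ofReal k • μ := by
          rw [smul_smul, ENNReal.inv_mul_cancel hk' (by simp), one_smul]
      _ ≤ _ := by gcongr
  · rw [← withDensity_const]
    exact withDensity_mono (h.mono fun x hx => ENNReal.ofReal_le_ofReal hx.2)

theorem exists_equiv_L2J {K : SignType} {a : ℝ} (hK : K = 1 → a < π / 2) :
    ∃ e : L2J K a ≃L[ℂ] Lp ℂ 2 (volume.restrict (J₂ a)),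
      ∀ f, e f =ᵐ[volume.restrict (J₂ a)] f := by
  obtain ⟨k, C, hk, -, h⟩ := exists_warp_bounds hK
  refine exists_equiv_of_withDensity hk (C := C) ?_
  filter_upwards [ae_restrict_mem measurableSet_Ioo] with x hx
  exact h x (Ioo_subset_Icc_self hx)

theorem exists_equiv_L2Ω {K : SignType} {a : ℝ} (hK : K = 1 → a < π / 2) :
    ∃ e : L2Ω K a ≃L[ℂ] Lp ℂ 2 (volume.restrict (Ω₀ a)),
      ∀ f, e f =ᵐ[volume.restrict (Ω₀ a)] f := by
  obtain ⟨k, C, hk, -, h⟩ := exists_warp_bounds hK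
  refine exists_equiv_of_withDensity hk (C := C) ?_
  filter_upwards [ae_restrict_mem (measurableSet_Ioo.prod measurableSet_Ioo)] with x hx
  exact h x.2 (Ioo_subset_Icc_self hx.2)

/-! ### Primitives of integrable functions -/

/-- On `[-a, a]`, the function `u` is a primitive of the integrable function `g`. -/
structure IsPrimitiveOn (a : ℝ) (u g : ℝ → ℂ) : Prop where
  intervalIntegrable : IntervalIntegrable g volume (-a) a
  eq : ∀ x ∈ Icc (-a) a, u x = u (-a) + ∫ t in (-a)..x, g t

theorem _root_.AbsolutelyContinuousOnInterval.congr {X : Type*} [PseudoMetricSpace X]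
    {f g : ℝ → X} {a b : ℝ}
    (hf : AbsolutelyContinuousOnInterval f a b) (h : EqOn f g (uIcc a b)) :
    AbsolutelyContinuousOnInterval g a b := by
  rw [absolutelyContinuousOnInterval_iff] at hf ⊢
  intro ε hε
  obtain ⟨δ, hδ, H⟩ := hf ε hε
  refine ⟨δ, hδ, fun E hE hs => ?_⟩
  have := H E hE hs
  refine lt_of_eq_of_lt (Finset.sum_congr rfl fun i hi => ?_) this
  rw [h (hE.1 i hi).1, h (hE.1 i hi).2]

namespace IsPrimitiveOn

variable {a : ℝ} {u g v h : ℝ → ℂ}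

theorem continuousOn (ha : 0 < a) (hu : IsPrimitiveOn a u g) : ContinuousOn u (Icc (-a) a) := by
  have h1 : IntegrableOn g (uIcc (-a) a) := by
    rw [uIcc_of_le (by linarith), integrableOn_Icc_iff_integrableOn_Ioc,
      ← intervalIntegrable_iff_integrableOn_Ioc_of_le (by linarith)]
    exact hu.intervalIntegrable
  have h2 := intervalIntegral.continuousOn_primitive_interval h1
  rw [uIcc_of_le (by linarith)] at h2
  exact (continuousOn_const.add h2).congr hu.eq

theorem of_contDiff (hu : ContDiff ℝ 1 u) : IsPrimitiveOn a u (deriv u) := by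
  have hc : Continuous (deriv u) := hu.continuous_deriv le_rfl
  refine ⟨hc.intervalIntegrable _ _, fun x hx => ?_⟩
  rw [intervalIntegral.integral_deriv_eq_sub
    (fun y _ => (hu.differentiable one_ne_zero).differentiableAt) (hc.intervalIntegrable _ _)]
  ring

theorem conj (hu : IsPrimitiveOn a u g) :
    IsPrimitiveOn a (fun x => starRingEnd ℂ (u x)) (fun x => starRingEnd ℂ (g x)) := by
  refine ⟨?_, fun x hx => ?_⟩
  · have := hu.intervalIntegrable
    exact ⟨Complex.conjCLE.toContinuousLinearMap.integrable_comp this.1,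
      Complex.conjCLE.toContinuousLinearMap.integrable_comp this.2⟩
  · rw [hu.eq x hx, map_add]
    congr 1
    exact (Complex.conjCLE.toContinuousLinearMap.intervalIntegral_comp_comm
      (hu.intervalIntegrable.mono_set (uIcc_subset_uIcc (by simp)
        (by rw [uIcc_of_le (by linarith [hx.1, hx.2])]; exact hx)))).symm

/-- Real functionals reduce complex-valued primitives to real-valued absolutely continuous
functions; real and imaginary parts are the cases of interest. -/
theorem absolutelyContinuousOnInterval_clm (ha : 0 < a) (hu : IsPrimitiveOn a u g)
    (L : ℂ →L[ℝ] ℝ) : AbsolutelyContinuousOnInterval (fun x => L (u x)) (-a) a := by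
  have hi : IntervalIntegrable (fun x => L (g x)) volume (-a) a :=
    ⟨L.integrable_comp hu.intervalIntegrable.1, L.integrable_comp hu.intervalIntegrable.2⟩
  have h1 := hi.absolutelyContinuousOnInterval_intervalIntegral (c := -a) (by simp)
  have h2 : AbsolutelyContinuousOnInterval (fun _ : ℝ => L (u (-a))) (-a) a :=
    (LipschitzWith.const (L (u (-a)))).lipschitzOnWith.absolutelyContinuousOnInterval
  refine (h2.add h1).congr fun x hx => ?_
  have hx' : x ∈ Icc (-a) a := by rwa [uIcc_of_le (by linarith)] at hx
  rw [hu.eq x hx', map_add, Pi.add_apply]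
  congr 1
  exact L.intervalIntegral_comp_comm
      (hu.intervalIntegrable.mono_set (uIcc_subset_uIcc (by simp) hx))

theorem ae_hasDerivAt (ha : 0 < a) (hu : IsPrimitiveOn a u g) :
    ∀ᵐ x, x ∈ Ioo (-a) a → HasDerivAt u (g x) x := by
  filter_upwards [hu.intervalIntegrable.ae_hasDerivAt_integral] with x hx hx'
  have h1 := hx (by rw [uIcc_of_le (by linarith)]; exact Ioo_subset_Icc_self hx') (-a) (by simp)
  refine (h1.const_add (u (-a))).congr_of_eventuallyEq ?_
  filter_upwards [isOpen_Ioo.mem_nhds hx'] with y hy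
  exact hu.eq y (Ioo_subset_Icc_self hy)

/-- The fundamental theorem of calculus for a function whose real and imaginary parts are
absolutely continuous. -/
theorem of_absolutelyContinuous (ha : 0 < a)
    (hre : AbsolutelyContinuousOnInterval (fun x => (u x).re) (-a) a)
    (him : AbsolutelyContinuousOnInterval (fun x => (u x).im) (-a) a)
    (hg : IntervalIntegrable g volume (-a) a)
    (hd : ∀ᵐ x, x ∈ Ioo (-a) a → HasDerivAt u (g x) x) : IsPrimitiveOn a u g := by
  have hends : ∀ᵐ x : ℝ, x ≠ -a ∧ x ≠ a := by
    have h1 : ∀ᵐ x : ℝ, x ≠ -a := by simp [ae_iff]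
    have h2 : ∀ᵐ x : ℝ, x ≠ a := by simp [ae_iff]
    filter_upwards [h1, h2] with x h1 h2 using ⟨h1, h2⟩
  have key : ∀ L : ℂ →L[ℝ] ℝ, AbsolutelyContinuousOnInterval (fun x => L (u x)) (-a) a →
      ∀ x ∈ Icc (-a) a, L (u x) = L (u (-a) + ∫ t in (-a)..x, g t) := by
    intro L hL x hx
    have hprim : IsPrimitiveOn a (fun x => ∫ t in (-a)..x, g t) g := ⟨hg, by simp⟩
    have hac := hL.sub (hprim.absolutelyContinuousOnInterval_clm ha L)
    -- The difference between `u` and the integral of `g`, seen through `L`, is absolutely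
    -- continuous with derivative zero almost everywhere, hence constant.
    obtain ⟨C, hC⟩ := hac.const_of_ae_hasDerivAt_zero (by
      filter_upwards [hd, hprim.ae_hasDerivAt ha, hends] with x h1 h2 h3 hx
      rw [uIcc_of_le (by linarith)] at hx
      have hx' : x ∈ Ioo (-a) a := ⟨lt_of_le_of_ne hx.1 h3.1.symm, lt_of_le_of_ne hx.2 h3.2⟩
      have := (L.hasFDerivAt.comp_hasDerivAt x (h1 hx')).sub
        (L.hasFDerivAt.comp_hasDerivAt x (h2 hx'))
      simp only [sub_self] at this
      exact this)
    have e1 := hC x (by rwa [uIcc_of_le (by linarith)])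
    have e2 := hC (-a) (by simp)
    simp only [Pi.sub_apply, intervalIntegral.integral_same, map_zero, sub_zero] at e1 e2
    rw [map_add, e2, ← e1]
    ring
  refine ⟨hg, fun x hx => Complex.ext ?_ ?_⟩
  · exact key Complex.reCLM hre x hx
  · exact key Complex.imCLM him x hx

/-- Products of absolutely continuous functions are absolutely continuous and the product rule holds
almost everywhere. This is integration by parts, the source of the Green formula, the energy
identity and the pointwise bounds. -/
theorem mul (ha : 0 < a) (hu : IsPrimitiveOn a u g) (hv : IsPrimitiveOn a v h) :
    IsPrimitiveOn a (fun x => u x * v x) (fun x => g x * v x + u x * h x) := by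
  have ur := hu.absolutelyContinuousOnInterval_clm ha Complex.reCLM
  have ui := hu.absolutelyContinuousOnInterval_clm ha Complex.imCLM
  have vr := hv.absolutelyContinuousOnInterval_clm ha Complex.reCLM
  have vi := hv.absolutelyContinuousOnInterval_clm ha Complex.imCLM
  have cu := hu.continuousOn ha
  have cv := hv.continuousOn ha
  rw [← uIcc_of_le (by linarith)] at cu cv
  refine of_absolutelyContinuous ha ?_ ?_ ?_ ?_
  · exact ((ur.mul vr).sub (ui.mul vi)).congr fun x _ => by simp
  · exact ((ur.mul vi).add (ui.mul vr)).congr fun x _ => by simp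
  · exact (hu.intervalIntegrable.mul_continuousOn cv).add
      (hv.intervalIntegrable.continuousOn_mul cu)
  · filter_upwards [hu.ae_hasDerivAt ha, hv.ae_hasDerivAt ha] with x h1 h2 hx
    exact (h1 hx).mul (h2 hx)

theorem sub_eq (hu : IsPrimitiveOn a u g) {x y : ℝ} (hx : x ∈ Icc (-a) a) (hy : y ∈ Icc (-a) a) :
    u y - u x = ∫ t in x..y, g t := by
  have hi : ∀ z ∈ Icc (-a) a, IntervalIntegrable g volume (-a) z := fun z hz =>
    hu.intervalIntegrable.mono_set (uIcc_subset_uIcc (by simp)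
      (by rw [uIcc_of_le (by linarith [hz.1, hz.2])]; exact hz))
  rw [hu.eq x hx, hu.eq y hy, add_sub_add_left_eq_sub,
    intervalIntegral.integral_interval_sub_left (hi y hy) (hi x hx)]

theorem integral_J₂ (ha : 0 < a) (hu : IsPrimitiveOn a u g) :
    ∫ x in J₂ a, g x = u a - u (-a) := by
  rw [hu.sub_eq ⟨le_rfl, by linarith⟩ ⟨by linarith, le_rfl⟩,
    intervalIntegral.integral_of_le (by linarith), J₂, integral_Ioc_eq_integral_Ioo]

/-- The Gauss-Green formula on `[-a, a]`. -/
theorem green (ha : 0 < a) (hu : IsPrimitiveOn a u g) {φ : ℝ → ℂ} (hφ : ContDiff ℝ ∞ φ) :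
    ∫ x in J₂ a, (u x * fderiv ℝ φ x 1 + g x * φ x) = u a * φ a - u (-a) * φ (-a) := by
  rw [← (hu.mul ha (of_contDiff (hφ.of_le (by simp)))).integral_J₂ ha]
  congr 1
  funext x
  rw [fderiv_apply_one_eq_deriv]
  ring

theorem memLp (ha : 0 < a) (hu : IsPrimitiveOn a u g) : MemLp u 2 (volume.restrict (J₂ a)) := by
  have hc := hu.continuousOn ha
  obtain ⟨C, hC⟩ := isCompact_Icc.exists_bound_of_continuousOn hc
  have : IsFiniteMeasure (volume.restrict (J₂ a)) := ⟨by simp [J₂]⟩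
  refine MemLp.of_bound ((hc.mono Ioo_subset_Icc_self).aestronglyMeasurable measurableSet_Ioo) C ?_
  filter_upwards [ae_restrict_mem measurableSet_Ioo] with x hx
  exact hC x (Ioo_subset_Icc_self hx)

theorem hasWeakDeriv (ha : 0 < a) (hu : IsPrimitiveOn a u g)
    (hg : MemLp g 2 (volume.restrict (J₂ a))) : HasWeakDeriv (J₂ a) 1 u g := by
  refine ⟨hu.memLp ha, hg, fun φ hφ hc hs => ?_⟩
  have key := hu.green ha hφ
  have h0 : ∀ y, y ∉ J₂ a → φ y = 0 := fun y hy =>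
    image_eq_zero_of_notMem_tsupport fun h => hy (hs h)
  obtain ⟨h1, h2⟩ := test_fderiv hφ hc 1
  rw [h0 a (by simp [J₂]), h0 (-a) (by simp [J₂]),
    integral_add (integrableOn_mul_test (hu.memLp ha) h1 h2)
      (integrableOn_mul_test hg hφ.continuous hc)] at key
  linear_combination key

end IsPrimitiveOn

/-! ### The du Bois-Reymond lemma and continuous representatives -/

theorem contDiff_primitive {w : ℝ → ℂ} (hw : ContDiff ℝ ∞ w) (c : ℝ) :
    ContDiff ℝ ∞ (fun x => ∫ t in c..x, w t) ∧ ∀ x, deriv (fun x => ∫ t in c..x, w t) x = w x := by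
  have hd : ∀ x, HasDerivAt (fun x => ∫ t in c..x, w t) (w x) x := fun x =>
    intervalIntegral.integral_hasDerivAt_right (hw.continuous.intervalIntegrable _ _)
      (hw.continuous.stronglyMeasurableAtFilter _ _) hw.continuous.continuousAt
  refine ⟨?_, fun x => (hd x).deriv⟩
  rw [contDiff_infty_iff_deriv]
  refine ⟨fun x => (hd x).differentiableAt, ?_⟩
  rwa [funext fun x => (hd x).deriv]

/-- A test function with vanishing integral on `(-a, a)` is the derivative of a test function. -/
theorem exists_test_primitive {a : ℝ} {w : ℝ → ℂ} (hw : ContDiff ℝ ∞ w)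
    (hc : HasCompactSupport w) (hs : tsupport w ⊆ J₂ a) (h0 : ∫ x in J₂ a, w x = 0) (ha : 0 < a) :
    ∃ φ : ℝ → ℂ, ContDiff ℝ ∞ φ ∧ HasCompactSupport φ ∧ tsupport φ ⊆ J₂ a ∧
      ∀ x, fderiv ℝ φ x 1 = w x := by
  obtain ⟨h1, h2⟩ := contDiff_primitive hw (-a)
  -- The primitive of `w` vanishes to the left of `-b` because `w` does, and to the right of `b`
  -- because moreover the total integral of `w` is zero.
  have hb : ∃ b < a, 0 ≤ b ∧ ∀ x ∈ tsupport w, |x| ≤ b := by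
    rcases (tsupport w).eq_empty_or_nonempty with h | h
    · exact ⟨0, ha, le_rfl, by simp [h]⟩
    · obtain ⟨y, hy, hm⟩ := hc.isCompact.exists_isMaxOn h continuous_abs.continuousOn
      exact ⟨|y|, abs_lt.2 (hs hy), abs_nonneg _, fun x hx => hm hx⟩
  obtain ⟨b, hba, hb0, hb⟩ := hb
  have hw0 : ∀ x, b < |x| → w x = 0 := fun x hx =>
    image_eq_zero_of_notMem_tsupport fun h => (hb x h).not_gt hx
  have hsupp : Function.support (fun x => ∫ t in (-a)..x, w t) ⊆ Icc (-b) b := by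
    intro x hx
    by_contra hx'
    refine hx ?_
    have hii : ∀ p q : ℝ, IntervalIntegrable w volume p q := fun p q =>
      hw.continuous.intervalIntegrable _ _
    rcases lt_or_ge x (-b) with h | h
    · refine intervalIntegral.integral_zero_ae (Filter.Eventually.of_forall fun t ht => ?_)
      apply hw0
      have : t ≤ max (-a) x := ht.2
      have : t < -b := this.trans_lt (max_lt (by linarith) h)
      rw [abs_of_neg (by linarith)]; linarith
    · have h' : b < x := by
        by_contra h''
        exact hx' ⟨h, not_lt.1 h''⟩
      have e : ∫ t in (-a)..a, w t = 0 := by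
        rw [intervalIntegral.integral_of_le (by linarith), integral_Ioc_eq_integral_Ioo]
        exact h0
      have e' : ∫ t in a..x, w t = 0 := by
        refine intervalIntegral.integral_zero_ae (Filter.Eventually.of_forall fun t ht => ?_)
        apply hw0
        have : min a x < t := ht.1
        have : b < t := (lt_min hba h').trans this
        exact this.trans_le (le_abs_self t)
      change ∫ t in (-a)..x, w t = 0
      rw [← intervalIntegral.integral_add_adjacent_intervals (hii (-a) a) (hii a x), e, e', add_zero]
  have ht : tsupport (fun x => ∫ t in (-a)..x, w t) ⊆ Icc (-b) b :=
    closure_minimal hsupp isClosed_Icc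
  refine ⟨_, h1, HasCompactSupport.of_support_subset_isCompact isCompact_Icc hsupp,
    ht.trans fun x hx => ⟨by linarith [hx.1], by linarith [hx.2]⟩, fun x => ?_⟩
  rw [fderiv_apply_one_eq_deriv, h2]

/-- A square integrable function is determined by its integrals against test functions. -/
theorem ae_zero_of_integral_test {E : Type*} [NormedAddCommGroup E] [NormedSpace ℝ E]
    [MeasureSpace E] [BorelSpace E] [FiniteDimensional ℝ E]
    [IsLocallyFiniteMeasure (volume : Measure E)]
    {U : Set E} (hU : IsOpen U) {g : E → ℂ} (hg : MemLp g 2 (volume.restrict U))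
    (h : ∀ φ : E → ℂ, ContDiff ℝ ∞ φ → HasCompactSupport φ → tsupport φ ⊆ U →
      ∫ x in U, g x * φ x = 0) : ∀ᵐ x ∂volume.restrict U, g x = 0 := by
  rw [ae_restrict_iff' hU.measurableSet]
  refine hU.ae_eq_zero_of_integral_contDiff_smul_eq_zero
    (LocallyIntegrableOn.mono_set (t := U) ?_ subset_rfl) fun φ hφ hc hs => ?_
  · exact (locallyIntegrableOn_of_locallyIntegrable_restrict
      (hg.locallyIntegrable (by norm_num)))
  · have hφ' : ContDiff ℝ ∞ fun x => (φ x : ℂ) := Complex.ofRealCLM.contDiff.comp hφ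
    have hts : tsupport (fun x => (φ x : ℂ)) ⊆ tsupport φ :=
      closure_mono fun x hx => by simpa using hx
    have hc' : HasCompactSupport fun x => (φ x : ℂ) := hc.comp_left (g := ((↑) : ℝ → ℂ)) rfl
    rw [← h _ hφ' hc' (hts.trans hs)]
    have e : ∫ x in U, φ x • g x = ∫ x, φ x • g x := by
      refine setIntegral_eq_integral_of_forall_compl_eq_zero fun x hx => ?_
      rw [image_eq_zero_of_notMem_tsupport fun h' => hx (hs h'), zero_smul]
    rw [← e]
    exact integral_congr_ae (Filter.Eventually.of_forall fun x => by simp [mul_comm])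

/-- **Du Bois-Reymond**: a function whose weak derivative vanishes is constant. -/
theorem ae_const_of_integral_deriv_test {a : ℝ} (ha : 0 < a) {w : ℝ → ℂ}
    (hw : MemLp w 2 (volume.restrict (J₂ a)))
    (h : ∀ φ : ℝ → ℂ, ContDiff ℝ ∞ φ → HasCompactSupport φ → tsupport φ ⊆ J₂ a →
      ∫ x in J₂ a, w x * fderiv ℝ φ x 1 = 0) :
    ∃ c, ∀ᵐ x ∂volume.restrict (J₂ a), w x = c := by
  have : IsFiniteMeasure (volume.restrict (J₂ a)) := ⟨by simp [J₂]⟩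
  -- A bump supported in `[-a / 2, a / 2]`, normalized to integral one; the constant sought is the
  -- mean of `w` against it.
  let f : ContDiffBump (0 : ℝ) := ⟨a / 4, a / 2, by linarith, by linarith⟩
  let ρ : ℝ → ℂ := fun x => (f.normed volume x : ℂ)
  have hρ : ContDiff ℝ ∞ ρ := Complex.ofRealCLM.contDiff.comp f.contDiff_normed
  have hρc : HasCompactSupport ρ := f.hasCompactSupport_normed.comp_left (g := ((↑) : ℝ → ℂ)) rfl
  have hρs : tsupport ρ ⊆ J₂ a := by
    have h1 : tsupport ρ ⊆ tsupport (f.normed volume) :=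
      closure_mono fun x hx => by simpa [ρ] using hx
    refine h1.trans ?_
    rw [f.tsupport_normed_eq, Real.closedBall_eq_Icc]
    intro x hx
    simp only [f, zero_sub, zero_add] at hx
    exact ⟨by linarith [hx.1], by linarith [hx.2]⟩
  have hρ1 : ∫ x in J₂ a, ρ x = 1 := by
    rw [setIntegral_eq_integral_of_forall_compl_eq_zero fun x hx =>
      image_eq_zero_of_notMem_tsupport fun h' => hx (hρs h'), integral_complex_ofReal,
      f.integral_normed, Complex.ofReal_one]
  refine ⟨∫ x in J₂ a, w x * ρ x, ?_⟩
  set c := ∫ x in J₂ a, w x * ρ x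
  have hwc : MemLp (fun x => w x - c) 2 (volume.restrict (J₂ a)) := hw.sub (memLp_const c)
  have key := ae_zero_of_integral_test (isOpen_Ioo (a := -a) (b := a)) hwc ?_
  · filter_upwards [key] with x hx using sub_eq_zero.1 hx
  intro η hη hc hs
  set I := ∫ x in J₂ a, η x
  have iη : IntegrableOn η (J₂ a) := (hη.continuous.integrable_of_hasCompactSupport hc).integrableOn
  have iρ : IntegrableOn ρ (J₂ a) :=
    (hρ.continuous.integrable_of_hasCompactSupport hρc).integrableOn
  -- Subtracting the multiple `I * ρ` makes the integral of `η` vanish, so the difference is the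
  -- derivative of a test function and is annihilated by `w`.
  obtain ⟨φ, hφ, hφc, hφs, hφd⟩ := exists_test_primitive (w := fun x => η x - I * ρ x) (a := a)
    (hη.sub (contDiff_const.mul hρ)) (hc.sub (hρc.mul_left (f := fun _ => I)))
    ((tsupport_sub η _).trans (union_subset hs ((closure_mono fun x hx => by
      simp only [Function.mem_support, ne_eq, mul_eq_zero, not_or] at hx ⊢; exact hx.2).trans hρs)))
    (by rw [integral_sub iη (iρ.const_mul I), integral_const_mul, hρ1]; simp [I]) ha
  have e := h φ hφ hφc hφs
  simp only [hφd] at e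
  have i1 := integrableOn_mul_test hw hη.continuous hc
  have i2 := integrableOn_mul_test hw hρ.continuous hρc
  have e1 : ∫ x in J₂ a, w x * (η x - I * ρ x) = (∫ x in J₂ a, w x * η x) - I * c := by
    rw [← integral_const_mul, ← integral_sub i1 (i2.const_mul I)]
    congr 1; funext x; ring
  have e2 : ∫ x in J₂ a, (w x - c) * η x = (∫ x in J₂ a, w x * η x) - c * I := by
    rw [← integral_const_mul, ← integral_sub i1 (iη.const_mul c)]
    congr 1; funext x; ring
  change ∫ x in J₂ a, (w x - c) * η x = 0
  rw [e2, mul_comm c I, ← e1, e]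

theorem isPrimitiveOn_add_integral {a : ℝ} {g : ℝ → ℂ} (c : ℂ)
    (ha : 0 < a) (hg : MemLp g 2 (volume.restrict (J₂ a))) :
    IsPrimitiveOn a (fun x => c + ∫ t in (-a)..x, g t) g := by
  have : IsFiniteMeasure (volume.restrict (J₂ a)) := ⟨by simp [J₂]⟩
  refine ⟨?_, by simp⟩
  rw [intervalIntegrable_iff_integrableOn_Ioc_of_le (by linarith), integrableOn_Ioc_iff_integrableOn_Ioo]
  exact hg.integrable (by norm_num)

/-- A function with a weak derivative has an absolutely continuous representative. -/
theorem HasWeakDeriv.exists_isPrimitiveOn {a : ℝ} (ha : 0 < a) {u g : ℝ → ℂ}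
    (h : HasWeakDeriv (J₂ a) 1 u g) :
    ∃ v, IsPrimitiveOn a v g ∧ u =ᵐ[volume.restrict (J₂ a)] v := by
  have hp := isPrimitiveOn_add_integral 0 ha h.memLp_deriv
  have hv := hp.hasWeakDeriv ha h.memLp_deriv
  obtain ⟨c, hc⟩ := ae_const_of_integral_deriv_test ha (h.memLp.sub hv.memLp) fun φ hφ hφc hφs => by
    obtain ⟨h1, h2⟩ := test_fderiv hφ hφc 1
    simp only [Pi.sub_apply, sub_mul]
    rw [integral_sub (integrableOn_mul_test h.memLp h1 h2) (integrableOn_mul_test hv.memLp h1 h2),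
      h.integral_eq φ hφ hφc hφs, hv.integral_eq φ hφ hφc hφs, sub_self]
  refine ⟨_, isPrimitiveOn_add_integral c ha h.memLp_deriv, ?_⟩
  filter_upwards [hc] with x hx
  simp only [Pi.sub_apply, zero_add] at hx
  linear_combination hx

/-- Continuous functions that agree almost everywhere on `[-a, a]` agree everywhere, endpoints
included; so the boundary values of the continuous representative are those of the absolutely
continuous one. -/
theorem HasWeakDeriv.isPrimitiveOn_of_continuousOn {a : ℝ} (ha : 0 < a) {u g : ℝ → ℂ}
    (h : HasWeakDeriv (J₂ a) 1 u g) (hu : ContinuousOn u (Icc (-a) a)) : IsPrimitiveOn a u g := by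
  obtain ⟨v, hv, e⟩ := h.exists_isPrimitiveOn ha
  have heq : EqOn u v (Icc (-a) a) := by
    refine Measure.eqOn_Icc_of_ae_eq volume (by linarith) ?_ hu (hv.continuousOn ha)
    rwa [← restrict_Ioo_eq_restrict_Icc]
  refine ⟨hv.intervalIntegrable, fun x hx => ?_⟩
  rw [heq hx, heq ⟨le_rfl, by linarith⟩, hv.eq x hx]

/-- Existence of a smooth compactly supported function with prescribed values at `±a`. -/
theorem exists_test_eq_one_eq_zero {a : ℝ} (ha : 0 < a) {p q : ℝ} (hpq : 2 * a = |q - p|) :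
    ∃ φ : ℝ → ℂ, ContDiff ℝ ∞ φ ∧ HasCompactSupport φ ∧ φ p = 1 ∧ φ q = 0 := by
  let f : ContDiffBump p := ⟨a / 4, a / 2, by linarith, by linarith⟩
  refine ⟨fun x => (f x : ℂ), Complex.ofRealCLM.contDiff.comp f.contDiff,
    f.hasCompactSupport.comp_left (g := ((↑) : ℝ → ℂ)) rfl, ?_, ?_⟩
  · simp [f.one_of_mem_closedBall (Metric.mem_closedBall_self f.rIn_pos.le)]
  · simp only [Complex.ofReal_eq_zero]
    refine f.zero_of_le_dist ?_
    rw [Real.dist_eq, ← hpq]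
    change a / 2 ≤ 2 * a
    linarith

/-- If the Gauss-Green formula holds with boundary values `T`, `T'`, then these are the boundary
values of the absolutely continuous representative. -/
theorem exists_isPrimitiveOn_of_green {a : ℝ} (ha : 0 < a) {u g : ℝ → ℂ} {T T' : ℂ}
    (hu : MemLp u 2 (volume.restrict (J₂ a))) (hg : MemLp g 2 (volume.restrict (J₂ a)))
    (h : ∀ φ : ℝ → ℂ, ContDiff ℝ ∞ φ → HasCompactSupport φ →
      ∫ x in J₂ a, (u x * fderiv ℝ φ x 1 + g x * φ x) = T' * φ a - T * φ (-a)) :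
    ∃ v, IsPrimitiveOn a v g ∧ u =ᵐ[volume.restrict (J₂ a)] v ∧ v (-a) = T ∧ v a = T' := by
  have hw : HasWeakDeriv (J₂ a) 1 u g := by
    refine ⟨hu, hg, fun φ hφ hc hs => ?_⟩
    have key := h φ hφ hc
    have h0 : ∀ y, y ∉ J₂ a → φ y = 0 := fun y hy =>
      image_eq_zero_of_notMem_tsupport fun h => hy (hs h)
    obtain ⟨h1, h2⟩ := test_fderiv hφ hc 1
    rw [h0 a (by simp [J₂]), h0 (-a) (by simp [J₂]),
      integral_add (integrableOn_mul_test hu h1 h2)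
        (integrableOn_mul_test hg hφ.continuous hc)] at key
    linear_combination key
  obtain ⟨v, hv, e⟩ := hw.exists_isPrimitiveOn ha
  -- Both pairs of boundary values give the same functional of `(φ a, φ (-a))`; test functions equal
  -- to one at one endpoint and zero at the other separate them.
  have key : ∀ φ : ℝ → ℂ, ContDiff ℝ ∞ φ → HasCompactSupport φ →
      v a * φ a - v (-a) * φ (-a) = T' * φ a - T * φ (-a) := fun φ hφ hc => by
    rw [← h φ hφ hc, ← hv.green ha hφ]
    refine integral_congr_ae ?_
    filter_upwards [e] with x hx
    rw [hx]
  refine ⟨v, hv, e, ?_, ?_⟩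
  · obtain ⟨φ, h1, h2, h3, h4⟩ := exists_test_eq_one_eq_zero ha (p := -a) (q := a) (by
      rw [abs_of_pos (by linarith)]; ring)
    have := key φ h1 h2
    rw [h3, h4] at this
    linear_combination -this
  · obtain ⟨φ, h1, h2, h3, h4⟩ := exists_test_eq_one_eq_zero ha (p := a) (q := -a) (by
      rw [abs_of_neg (by linarith)]; ring)
    have := key φ h1 h2
    rw [h3, h4] at this
    linear_combination this

/-! ### Square integrable functions on the transverse interval -/

/-- The norm of `L²(J₂)`. -/
def l2 (a : ℝ) (u : ℝ → ℂ) : ℝ := Real.sqrt (∫ x in J₂ a, ‖u x‖ ^ 2)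

theorem l2_nonneg (a : ℝ) (u : ℝ → ℂ) : 0 ≤ l2 a u := Real.sqrt_nonneg _

theorem l2_sq (a : ℝ) (u : ℝ → ℂ) : l2 a u ^ 2 = ∫ x in J₂ a, ‖u x‖ ^ 2 :=
  Real.sq_sqrt (integral_nonneg fun _ => by positivity)

theorem norm_sq_lp_eq_integral {α : Type*} [MeasurableSpace α] {μ : Measure α} (f : Lp ℂ 2 μ) :
    ‖f‖ ^ 2 = ∫ x, ‖f x‖ ^ 2 ∂μ := by
  have h := congrArg RCLike.re (L2.inner_def (𝕜 := ℂ) f f)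
  rw [← integral_re (L2.integrable_inner f f)] at h
  simpa only [← norm_sq_eq_re_inner] using h

theorem norm_eq_l2 {a : ℝ} (f : Lp ℂ 2 (volume.restrict (J₂ a))) : ‖f‖ = l2 a f := by
  rw [l2, ← norm_sq_lp_eq_integral, Real.sqrt_sq (norm_nonneg f)]

theorem l2_congr {a : ℝ} {u v : ℝ → ℂ} (h : u =ᵐ[volume.restrict (J₂ a)] v) : l2 a u = l2 a v := by
  rw [l2, l2]
  congr 1
  exact integral_congr_ae (h.mono fun x hx => by simp only [hx])

theorem norm_toLp_eq_l2 {a : ℝ} {u : ℝ → ℂ} (h : MemLp u 2 (volume.restrict (J₂ a))) :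
    ‖h.toLp u‖ = l2 a u := by
  rw [norm_eq_l2, l2_congr h.coeFn_toLp]

theorem l2_add_le {a : ℝ} {u v : ℝ → ℂ} (hu : MemLp u 2 (volume.restrict (J₂ a)))
    (hv : MemLp v 2 (volume.restrict (J₂ a))) : l2 a (fun x => u x + v x) ≤ l2 a u + l2 a v := by
  change l2 a (u + v) ≤ _
  rw [← norm_toLp_eq_l2 hu, ← norm_toLp_eq_l2 hv, ← norm_toLp_eq_l2 (hu.add hv), MemLp.toLp_add]
  exact norm_add_le _ _

theorem l2_mul_le {a C : ℝ} {q u : ℝ → ℂ} (hC : 0 ≤ C) (hq : ∀ x ∈ J₂ a, ‖q x‖ ≤ C)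
    (hu : MemLp u 2 (volume.restrict (J₂ a))) : l2 a (fun x => q x * u x) ≤ C * l2 a u := by
  refine Real.sqrt_le_iff.2 ⟨mul_nonneg hC (l2_nonneg _ _), ?_⟩
  rw [mul_pow, l2_sq, ← integral_const_mul]
  refine integral_mono_of_nonneg (Filter.Eventually.of_forall fun x => by positivity)
    (hu.integrable_norm_pow (by norm_num) |>.const_mul _) ?_
  filter_upwards [ae_restrict_mem measurableSet_Ioo] with x hx
  rw [norm_mul, mul_pow]
  gcongr
  exact hq x hx

theorem l2_const_mul (a : ℝ) (c : ℂ) (u : ℝ → ℂ) : l2 a (fun x => c * u x) = ‖c‖ * l2 a u := by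
  simp only [l2, norm_mul, mul_pow]
  rw [integral_const_mul, Real.sqrt_mul (by positivity), Real.sqrt_sq (norm_nonneg c)]

theorem memLp_mul {a C : ℝ} {q u : ℝ → ℂ} (hq : ∀ x ∈ J₂ a, ‖q x‖ ≤ C) (hm : Measurable q)
    (hu : MemLp u 2 (volume.restrict (J₂ a))) :
    MemLp (fun x => q x * u x) 2 (volume.restrict (J₂ a)) := by
  refine hu.of_le_mul (c := C) (hm.aestronglyMeasurable.mul hu.1) ?_
  filter_upwards [ae_restrict_mem measurableSet_Ioo] with x hx
  rw [norm_mul]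
  gcongr
  exact hq x hx

theorem integral_norm_mul_norm_le {a : ℝ} {u v : ℝ → ℂ} (hu : MemLp u 2 (volume.restrict (J₂ a)))
    (hv : MemLp v 2 (volume.restrict (J₂ a))) :
    ∫ x in J₂ a, ‖u x‖ * ‖v x‖ ≤ l2 a u * l2 a v := by
  have h := integral_mul_norm_le_Lp_mul_Lq (μ := volume.restrict (J₂ a)) (f := u) (g := v)
    (p := 2) (q := 2) ⟨by norm_num, by norm_num, by norm_num⟩ (by simpa using hu) (by simpa using hv)
  simpa [l2, Real.sqrt_eq_rpow] using h

theorem integrable_norm_mul_norm {a : ℝ} {u v : ℝ → ℂ} (hu : MemLp u 2 (volume.restrict (J₂ a)))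
    (hv : MemLp v 2 (volume.restrict (J₂ a))) :
    IntegrableOn (fun x => ‖u x‖ * ‖v x‖) (J₂ a) :=
  hu.norm.integrable_mul hv.norm

/-- Interpolated bound of the values of a function by the `L²` norms of it and its derivative. -/
theorem IsPrimitiveOn.norm_sq_le {a : ℝ} (ha : 0 < a) {u g : ℝ → ℂ} (hu : IsPrimitiveOn a u g)
    (hg : MemLp g 2 (volume.restrict (J₂ a))) {y : ℝ} (hy : y ∈ Icc (-a) a) :
    2 * a * ‖u y‖ ^ 2 ≤ l2 a u ^ 2 + 4 * a * (l2 a u * l2 a g) := by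
  have hul := hu.memLp ha
  have hi := integrable_norm_mul_norm hul hg
  set I := ∫ x in J₂ a, ‖u x‖ * ‖g x‖
  have hI : I ≤ l2 a u * l2 a g := integral_norm_mul_norm_le hul hg
  -- The derivative of `u * conj u` is bounded in norm by `2 ‖u‖ ‖g‖`. The resulting inequality is
  -- then averaged over `x`, in an interval of length `2 * a`.
  have key : ∀ x ∈ J₂ a, ‖u y‖ ^ 2 ≤ ‖u x‖ ^ 2 + 2 * I := by
    intro x hx
    have hp := (hu.mul ha hu.conj).sub_eq (Ioo_subset_Icc_self hx) hy
    have e : ∀ w : ℂ, w * starRingEnd ℂ w = ((‖w‖ ^ 2 : ℝ) : ℂ) := fun w => by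
      rw [Complex.mul_conj, Complex.normSq_eq_norm_sq]
    rw [e, e, ← Complex.ofReal_sub] at hp
    have hle : ‖u y‖ ^ 2 - ‖u x‖ ^ 2 ≤ 2 * I := by
      refine (le_abs_self _).trans ?_
      rw [← Real.norm_eq_abs, ← Complex.norm_real, hp]
      refine (intervalIntegral.norm_integral_le_integral_norm_uIoc).trans ?_
      have hsub : uIoc x y ⊆ Ioc (-a) a := by
        intro t ht
        have h1 : min x y < t := ht.1
        have h2 : t ≤ max x y := ht.2
        exact ⟨(le_min hx.1.le hy.1).trans_lt h1, h2.trans (max_le hx.2.le hy.2)⟩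
      have hi2 : IntegrableOn (fun t => 2 * (‖u t‖ * ‖g t‖)) (Ioc (-a) a) := by
        rw [integrableOn_Ioc_iff_integrableOn_Ioo]
        exact hi.const_mul 2
      calc ∫ t in uIoc x y, ‖g t * starRingEnd ℂ (u t) + u t * starRingEnd ℂ (g t)‖
          ≤ ∫ t in uIoc x y, 2 * (‖u t‖ * ‖g t‖) := by
            refine integral_mono_of_nonneg (Filter.Eventually.of_forall fun x => by positivity)
              (hi2.mono_set hsub) (Filter.Eventually.of_forall fun t => ?_)
            refine (norm_add_le _ _).trans (le_of_eq ?_)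
            simp only [norm_mul, RCLike.norm_conj]
            ring
        _ ≤ ∫ t in Ioc (-a) a, 2 * (‖u t‖ * ‖g t‖) :=
            setIntegral_mono_set hi2 (Filter.Eventually.of_forall fun x => by positivity)
              hsub.eventuallyLE
        _ = 2 * I := by rw [integral_Ioc_eq_integral_Ioo, integral_const_mul]; rfl
    linarith
  have hfin : IsFiniteMeasure (volume.restrict (J₂ a)) := ⟨by simp [J₂]⟩
  have hvol : volume.real (J₂ a) = 2 * a := by
    simp only [J₂, Real.volume_real_Ioo]
    rw [max_eq_left (by linarith)]; ring
  have hint : ∫ _ in J₂ a, ‖u y‖ ^ 2 ≤ ∫ x in J₂ a, (‖u x‖ ^ 2 + 2 * I) := by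
    refine integral_mono_ae (integrable_const _)
      ((hul.integrable_norm_pow (by norm_num)).add (integrable_const _)) ?_
    filter_upwards [ae_restrict_mem measurableSet_Ioo] with x hx using key x hx
  rw [integral_add (hul.integrable_norm_pow (by norm_num)) (integrable_const _), ← l2_sq a u] at hint
  simp only [integral_const, measureReal_restrict_apply_univ, smul_eq_mul, hvol] at hint
  have := mul_le_mul_of_nonneg_left hI (by linarith : 0 ≤ 4 * a)
  linarith

/-! ### The boundary conditions in solved form -/

/-- Admissible boundary conditions determine the derivatives by the values on the boundary. -/
theorem BC.Admissible.exists_solved {B : BC} (hB : B.Admissible) :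
    ∃ p q r s : ℂ, ∀ u d u' d', B.Holds u d u' d' ↔ d = p * u + q * u' ∧ d' = r * u + s * u' := by
  cases B with
  | separated α β =>
    refine ⟨β - Complex.I * α, 0, 0, -β - Complex.I * α, fun u d u' d' => ?_⟩
    constructor
    · rintro ⟨h1, h2⟩
      exact ⟨by linear_combination h2, by linear_combination h1⟩
    · rintro ⟨h1, h2⟩
      exact ⟨by linear_combination h2, by linear_combination h1⟩
  | connected b c φ =>
    -- Since `b > 0`, the first row can be solved for `d`, and substitution into the second gives
    -- `d'`. With `b = 0` the condition would constrain the values themselves.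
    have hb : (b : ℂ) ≠ 0 := by exact_mod_cast hB.1.ne'
    set E := (Real.sqrt (1 + b * c) : ℂ) * Complex.exp (Complex.I * φ)
    set E' := (Real.sqrt (1 + b * c) : ℂ) * Complex.exp (-(Complex.I * φ))
    refine ⟨-(E / b), 1 / b, c - E' * (E / b), E' / b, fun u d u' d' => ?_⟩
    change u' = E * u + b * d ∧ d' = c * u + E' * d ↔ _
    have key : u' = E * u + b * d ↔ d = -(E / b) * u + 1 / b * u' := by
      constructor
      · rintro rfl; field_simp; ring
      · rintro rfl; field_simp; ring
    rw [key]
    refine and_congr_right fun h => ?_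
    rw [h]
    have : c * u + E' * (-(E / b) * u + 1 / b * u') = (c - E' * (E / b)) * u + E' / b * u' := by ring
    rw [this]

/-- Used to bound the boundary terms of the energy identity by the squares of the boundary values of
`u₀` alone. -/
theorem BC.Admissible.exists_bound {B : BC} (hB : B.Admissible) :
    ∃ M : ℝ, 0 ≤ M ∧ ∀ u d u' d', B.Holds u d u' d' →
      ‖d‖ ≤ M * (‖u‖ + ‖u'‖) ∧ ‖d'‖ ≤ M * (‖u‖ + ‖u'‖) := by
  obtain ⟨p, q, r, s, h⟩ := hB.exists_solved
  have key : ∀ x y u v : ℂ, ‖x‖ ≤ ‖p‖ + ‖q‖ + ‖r‖ + ‖s‖ → ‖y‖ ≤ ‖p‖ + ‖q‖ + ‖r‖ + ‖s‖ →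
      ‖x * u + y * v‖ ≤ (‖p‖ + ‖q‖ + ‖r‖ + ‖s‖) * (‖u‖ + ‖v‖) := fun x y u v hx hy => by
    refine (norm_add_le _ _).trans ?_
    rw [norm_mul, norm_mul, mul_add]
    gcongr
  refine ⟨‖p‖ + ‖q‖ + ‖r‖ + ‖s‖, by positivity, fun u d u' d' hh => ?_⟩
  obtain ⟨rfl, rfl⟩ := (h u d u' d').1 hh
  have := norm_nonneg p
  have := norm_nonneg q
  have := norm_nonneg r
  have := norm_nonneg s
  exact ⟨key _ _ _ _ (by linarith) (by linarith), key _ _ _ _ (by linarith) (by linarith)⟩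

/-! ### Coercivity of the transverse operators -/

/-- `u₀ ∈ W^{2,2}(J₂)` represents `ψ`, with `u₁ = u₀'`, `u₂ = u₀''`, satisfies the boundary
conditions, and `F` is the image of `ψ` under the transverse operator. -/
structure TransverseData (K : SignType) (a : ℝ) (B : BC) (m : ℤ)
    (ψ F : Lp ℂ 2 (volume.restrict (J₂ a))) (u₀ u₁ u₂ : ℝ → ℂ) : Prop where
  ae_eq : ψ =ᵐ[volume.restrict (J₂ a)] u₀
  primitive₀ : IsPrimitiveOn a u₀ u₁
  primitive₁ : IsPrimitiveOn a u₁ u₂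
  memLp₂ : MemLp u₂ 2 (volume.restrict (J₂ a))
  bc : B.Holds (u₀ (-a)) (u₁ (-a)) (u₀ a) (u₁ a)
  image_ae_eq : F =ᵐ[volume.restrict (J₂ a)] transverseAction K m u₀ u₁ u₂

/-- Integrate the derivative of `conj u₀ * u₁`. -/
theorem integral_energy {a : ℝ} (ha : 0 < a) {u₀ u₁ u₂ : ℝ → ℂ} (h₀ : IsPrimitiveOn a u₀ u₁)
    (h₁ : IsPrimitiveOn a u₁ u₂) (h₂ : MemLp u₂ 2 (volume.restrict (J₂ a))) :
    ((l2 a u₁ ^ 2 : ℝ) : ℂ) + ∫ x in J₂ a, starRingEnd ℂ (u₀ x) * u₂ x =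
      starRingEnd ℂ (u₀ a) * u₁ a - starRingEnd ℂ (u₀ (-a)) * u₁ (-a) := by
  rw [← (h₀.conj.mul ha h₁).integral_J₂ ha, l2_sq, ← integral_complex_ofReal, ← integral_add]
  · congr 1
    funext x
    rw [mul_comm (starRingEnd ℂ (u₁ x)), Complex.mul_conj, Complex.normSq_eq_norm_sq]
  · exact ((h₁.memLp ha).integrable_norm_pow (by norm_num)).ofReal
  · exact (h₀.conj.memLp ha).integrable_mul h₂

theorem warp_inv_sq_bound {K : SignType} {a : ℝ} (hK : K = 1 → a < π / 2) :
    ∃ k C : ℝ, 0 < k ∧ 0 < C ∧ ∀ x ∈ J₂ a, k ≤ (warp K x ^ 2)⁻¹ ∧ (warp K x ^ 2)⁻¹ ≤ C := by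
  obtain ⟨k, C, hk, hC, h⟩ := exists_warp_bounds hK
  refine ⟨(C ^ 2)⁻¹, (k ^ 2)⁻¹, by positivity, by positivity, fun x hx => ?_⟩
  obtain ⟨h1, h2⟩ := h x (Ioo_subset_Icc_self hx)
  have : 0 < warp K x := hk.trans_le h1
  constructor <;> gcongr

/-- Pair the equation with `conj u₀` and integrate by parts. The boundary conditions bound the
boundary terms by values of `u₀`, and the interpolation inequality makes these of order `‖u₀‖ ‖u₁‖ +
‖u₀‖²`; the drift costs `‖u₀‖ ‖u₁‖`. Both are absorbed into `‖u₁‖²`, while `m² f⁻²` leaves a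
positive multiple of `m² ‖u₀‖²`. The bound for `u₂` is the equation itself, and the pointwise bound
is the interpolation inequality. The essential point is that `k` and `C` do not depend on `m`. -/
theorem exists_coercive {K : SignType} {a : ℝ} (ha : 0 < a) (hK : K = 1 → a < π / 2)
    {B : BC} (hB : B.Admissible) (z : ℂ) :
    ∃ k C : ℝ, 0 < k ∧ 0 ≤ C ∧ ∀ (m : ℤ) (ψ g : Lp ℂ 2 (volume.restrict (J₂ a)))
      (u₀ u₁ u₂ : ℝ → ℂ), TransverseData K a B m ψ (g + z • ψ) u₀ u₁ u₂ →
      l2 a u₁ ^ 2 + k * m ^ 2 * l2 a u₀ ^ 2 ≤ C * l2 a u₀ ^ 2 + 2 * (l2 a u₀ * ‖g‖) ∧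
      l2 a u₂ ≤ C * (l2 a u₁ + m ^ 2 * l2 a u₀ + l2 a u₀) + ‖g‖ ∧
      ∀ y ∈ Icc (-a) a, ‖u₀ y‖ ^ 2 ≤ C * (l2 a u₀ ^ 2 + l2 a u₁ ^ 2) := by
  obtain ⟨k, Q, hk, hQ, hw⟩ := warp_inv_sq_bound hK
  obtain ⟨D, hD, hd⟩ := exists_drift_bound hK
  obtain ⟨M, hM, hbd⟩ := hB.exists_bound
  set C₁ := ‖z‖ + 4 * M / (2 * a) with hC₁
  set C₂ := D + 8 * M with hC₂
  have hC₁0 : 0 ≤ C₁ := by positivity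
  have hC₂0 : 0 ≤ C₂ := by positivity
  -- One constant for three estimates: `2 * C₁ + C₂ ^ 2` for the energy, `D + Q + ‖z‖` for `u₂`, and
  -- `1 / (2 * a) + 1` for the pointwise bound.
  refine ⟨k, 2 * C₁ + C₂ ^ 2 + D + Q + ‖z‖ + (1 / (2 * a) + 1), hk, by positivity, ?_⟩
  intro m ψ g u₀ u₁ u₂ hdata
  have m₀ := hdata.primitive₀.memLp ha
  have m₁ := hdata.primitive₁.memLp ha
  have m₂ := hdata.memLp₂
  have hg : MemLp g 2 (volume.restrict (J₂ a)) := Lp.memLp g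
  set N₀ := l2 a u₀ with hN₀
  set N₁ := l2 a u₁ with hN₁
  have n₀ : 0 ≤ N₀ := l2_nonneg _ _
  have n₁ : 0 ≤ N₁ := l2_nonneg _ _
  have ng : 0 ≤ ‖g‖ := norm_nonneg _
  have hval : ∀ y ∈ Icc (-a) a, ‖u₀ y‖ ^ 2 ≤ 1 / (2 * a) * N₀ ^ 2 + 2 * (N₀ * N₁) := fun y hy => by
    have := hdata.primitive₀.norm_sq_le ha m₁ hy
    have e : 1 / (2 * a) * N₀ ^ 2 + 2 * (N₀ * N₁) = (N₀ ^ 2 + 4 * a * (N₀ * N₁)) / (2 * a) := by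
      field_simp; ring
    rw [e, le_div_iff₀ (by positivity)]
    linarith
  have hq : ∀ x ∈ J₂ a, ‖(((warp K x : ℝ) : ℂ) ^ 2)⁻¹‖ ≤ Q := fun x hx => by
    rw [norm_inv, norm_pow, Complex.norm_real, Real.norm_eq_abs, sq_abs]
    exact (hw x hx).2
  have hqm : Measurable fun x => (((warp K x : ℝ) : ℂ) ^ 2)⁻¹ :=
    ((Complex.measurable_ofReal.comp (continuous_warp K).measurable).pow_const 2).inv
  have hdr : ∀ x ∈ J₂ a, ‖(drift K x : ℂ)‖ ≤ D := fun x hx => by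
    rw [Complex.norm_real]; exact hd x (Ioo_subset_Icc_self hx)
  have hdm : Measurable fun x => (drift K x : ℂ) :=
    Complex.measurable_ofReal.comp (measurable_drift K)
  have mq := memLp_mul hq hqm m₀
  have md := memLp_mul hdr hdm m₁
  -- the equation
  have heq : ∀ᵐ x ∂volume.restrict (J₂ a), u₂ x - m ^ 2 * ((((warp K x : ℝ) : ℂ) ^ 2)⁻¹ * u₀ x) =
      -(g x + (drift K x : ℂ) * u₁ x + z * u₀ x) := by
    filter_upwards [hdata.ae_eq, hdata.image_ae_eq, Lp.coeFn_add g (z • ψ), Lp.coeFn_smul z ψ]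
      with x h1 h2 h3 h4
    rw [h3, Pi.add_apply, h4, Pi.smul_apply, h1, smul_eq_mul, transverseAction] at h2
    linear_combination h2
  have mh := ((hg.add md).add (m₀.const_mul z)).neg
  refine ⟨?_, ?_, ?_⟩
  · -- boundary terms
    have hb : ‖starRingEnd ℂ (u₀ a) * u₁ a - starRingEnd ℂ (u₀ (-a)) * u₁ (-a)‖ ≤
        4 * M * (1 / (2 * a) * N₀ ^ 2 + 2 * (N₀ * N₁)) := by
      obtain ⟨b1, b2⟩ := hbd _ _ _ _ hdata.bc
      have v1 := hval a ⟨by linarith, le_rfl⟩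
      have v2 := hval (-a) ⟨le_rfl, by linarith⟩
      refine (norm_sub_le _ _).trans ?_
      rw [norm_mul, norm_mul, RCLike.norm_conj, RCLike.norm_conj]
      have t1 := mul_le_mul_of_nonneg_left b2 (norm_nonneg (u₀ a))
      have t2 := mul_le_mul_of_nonneg_left b1 (norm_nonneg (u₀ (-a)))
      have t3 : (‖u₀ (-a)‖ + ‖u₀ a‖) ^ 2 ≤ 4 * (1 / (2 * a) * N₀ ^ 2 + 2 * (N₀ * N₁)) := by
        nlinarith [sq_nonneg (‖u₀ (-a)‖ - ‖u₀ a‖)]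
      nlinarith
    have hint : ∫ x in J₂ a, starRingEnd ℂ (u₀ x) * u₂ x =
        ((m ^ 2 * ∫ x in J₂ a, (warp K x ^ 2)⁻¹ * ‖u₀ x‖ ^ 2 : ℝ) : ℂ) +
        ∫ x in J₂ a, starRingEnd ℂ (u₀ x) * -(g x + (drift K x : ℂ) * u₁ x + z * u₀ x) := by
      have e : ((m ^ 2 * ∫ x in J₂ a, (warp K x ^ 2)⁻¹ * ‖u₀ x‖ ^ 2 : ℝ) : ℂ) =
          ∫ x in J₂ a, starRingEnd ℂ (u₀ x) * (m ^ 2 * ((((warp K x : ℝ) : ℂ) ^ 2)⁻¹ * u₀ x)) := by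
        rw [Complex.ofReal_mul, ← integral_complex_ofReal, ← integral_const_mul]
        congr 1
        funext x
        push_cast
        rw [← Complex.ofReal_pow ‖u₀ x‖, ← Complex.normSq_eq_norm_sq, ← Complex.mul_conj]
        ring
      have hcj := hdata.primitive₀.conj.memLp ha
      rw [e, ← integral_add]
      · refine integral_congr_ae ?_
        filter_upwards [heq] with x hx
        rw [← hx]; ring
      · exact hcj.integrable_mul (mq.const_mul _)
      · exact hcj.integrable_mul mh
    have hen := integral_energy ha hdata.primitive₀ hdata.primitive₁ m₂
    rw [hint] at hen
    have hh : ‖∫ x in J₂ a, starRingEnd ℂ (u₀ x) * -(g x + (drift K x : ℂ) * u₁ x + z * u₀ x)‖ ≤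
        N₀ * ‖g‖ + D * (N₀ * N₁) + ‖z‖ * (N₀ * N₀) := by
      refine (norm_integral_le_integral_norm _).trans ?_
      have i1 := integrable_norm_mul_norm m₀ hg
      have i2 := integrable_norm_mul_norm m₀ m₁
      have i3 := integrable_norm_mul_norm m₀ m₀
      have i12 : IntegrableOn (fun x => ‖u₀ x‖ * ‖g x‖ + D * (‖u₀ x‖ * ‖u₁ x‖)) (J₂ a) :=
        i1.add (i2.const_mul D)
      have c1 := integral_norm_mul_norm_le m₀ hg
      have c2 := mul_le_mul_of_nonneg_left (integral_norm_mul_norm_le m₀ m₁) hD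
      have c3 := mul_le_mul_of_nonneg_left (integral_norm_mul_norm_le m₀ m₀) (norm_nonneg z)
      rw [← norm_eq_l2] at c1
      refine le_trans (integral_mono_of_nonneg (g := fun x => ‖u₀ x‖ * ‖g x‖ +
        D * (‖u₀ x‖ * ‖u₁ x‖) + ‖z‖ * (‖u₀ x‖ * ‖u₀ x‖))
        (Filter.Eventually.of_forall fun x => norm_nonneg _)
        (i12.add (i3.const_mul ‖z‖)) ?_) ?_
      · filter_upwards [ae_restrict_mem measurableSet_Ioo] with x hx
        simp only [norm_mul, RCLike.norm_conj, norm_neg]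
        have s1 : ‖g x + (drift K x : ℂ) * u₁ x + z * u₀ x‖ ≤ ‖g x‖ + D * ‖u₁ x‖ + ‖z‖ * ‖u₀ x‖ := by
          refine (norm_add₃_le).trans ?_
          rw [norm_mul, norm_mul]
          gcongr
          exact hdr x hx
        have := mul_le_mul_of_nonneg_left s1 (norm_nonneg (u₀ x))
        linarith
      · rw [integral_add i12 (i3.const_mul ‖z‖),
          integral_add i1 (i2.const_mul D), integral_const_mul, integral_const_mul]
        linarith
    have hpot : k * N₀ ^ 2 ≤ ∫ x in J₂ a, (warp K x ^ 2)⁻¹ * ‖u₀ x‖ ^ 2 := by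
      have i0 : IntegrableOn (fun x => ‖u₀ x‖ ^ 2) (J₂ a) := m₀.integrable_norm_pow (by norm_num)
      rw [hN₀, l2_sq, ← integral_const_mul]
      refine integral_mono_ae (i0.const_mul k) ?_ ?_
      · have := (mq.norm.integrable_mul m₀.norm)
        refine this.congr (Filter.Eventually.of_forall fun x => ?_)
        simp only [Pi.mul_apply, norm_mul, norm_inv, norm_pow, Complex.norm_real, Real.norm_eq_abs,
          sq_abs]
        ring
      · filter_upwards [ae_restrict_mem measurableSet_Ioo] with x hx
        have := (hw x hx).1
        gcongr
    set I₁ := ∫ x in J₂ a, (warp K x ^ 2)⁻¹ * ‖u₀ x‖ ^ 2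
    have hmain : N₁ ^ 2 + m ^ 2 * I₁ ≤ 4 * M * (1 / (2 * a) * N₀ ^ 2 + 2 * (N₀ * N₁)) +
        (N₀ * ‖g‖ + D * (N₀ * N₁) + ‖z‖ * (N₀ * N₀)) := by
      refine le_trans (le_of_eq ?_) ((norm_sub_le _ _).trans (add_le_add hb hh))
      rw [← hen]
      have : ((N₁ ^ 2 : ℝ) : ℂ) + (((m ^ 2 * I₁ : ℝ) : ℂ) +
          ∫ x in J₂ a, starRingEnd ℂ (u₀ x) * -(g x + (drift K x : ℂ) * u₁ x + z * u₀ x)) -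
          (∫ x in J₂ a, starRingEnd ℂ (u₀ x) * -(g x + (drift K x : ℂ) * u₁ x + z * u₀ x)) =
          ((N₁ ^ 2 + m ^ 2 * I₁ : ℝ) : ℂ) := by push_cast; ring
      rw [this, Complex.norm_real, Real.norm_of_nonneg]
      have : 0 ≤ I₁ := (by positivity : 0 ≤ k * N₀ ^ 2).trans hpot
      positivity
    have hm := mul_le_mul_of_nonneg_left hpot (by positivity : (0 : ℝ) ≤ (m : ℝ) ^ 2)
    have e1 : 4 * M * (1 / (2 * a) * N₀ ^ 2 + 2 * (N₀ * N₁)) +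
        (N₀ * ‖g‖ + D * (N₀ * N₁) + ‖z‖ * (N₀ * N₀)) =
        C₁ * N₀ ^ 2 + C₂ * N₀ * N₁ + N₀ * ‖g‖ := by
      rw [hC₁, hC₂]; ring
    rw [e1] at hmain
    -- Young's inequality: half of `N₁ ^ 2` is absorbed on the left, and doubling what remains gives
    -- the stated form.
    have e2 : C₂ * N₀ * N₁ ≤ C₂ ^ 2 / 2 * N₀ ^ 2 + N₁ ^ 2 / 2 := by
      nlinarith [sq_nonneg (C₂ * N₀ - N₁)]
    have e3 : 0 ≤ (D + Q + ‖z‖ + (1 / (2 * a) + 1)) * N₀ ^ 2 := by positivity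
    have e4 : 0 ≤ (m : ℝ) ^ 2 * (k * N₀ ^ 2) := by positivity
    nlinarith
  · have hu₂ : u₂ =ᵐ[volume.restrict (J₂ a)] fun x =>
        (m ^ 2 * ((((warp K x : ℝ) : ℂ) ^ 2)⁻¹ * u₀ x) +
          -1 * ((drift K x : ℂ) * u₁ x)) + (-1 * g x + -z * u₀ x) := by
      filter_upwards [heq] with x hx
      linear_combination hx
    rw [l2_congr hu₂]
    refine (l2_add_le ((mq.const_mul _).add (md.const_mul _))
      ((hg.const_mul _).add (m₀.const_mul _))).trans ?_
    refine (add_le_add (l2_add_le (mq.const_mul _) (md.const_mul _))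
      (l2_add_le (hg.const_mul _) (m₀.const_mul _))).trans ?_
    simp only [l2_const_mul]
    rw [norm_neg, norm_neg, norm_one, one_mul, one_mul, ← norm_eq_l2, norm_pow,
      Complex.norm_intCast, sq_abs]
    have t1 := mul_le_mul_of_nonneg_left (l2_mul_le hQ.le hq m₀) (sq_nonneg (m : ℝ))
    have t2 := l2_mul_le hD hdr m₁
    rw [← hN₀] at t1 ⊢
    rw [← hN₁] at t2
    have hzn := norm_nonneg z
    have hr : (0 : ℝ) ≤ 2 * C₁ + C₂ ^ 2 + (1 / (2 * a) + 1) := by positivity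
    have p1 : 0 ≤ (2 * C₁ + C₂ ^ 2 + (1 / (2 * a) + 1) + Q + ‖z‖) * N₁ := by positivity
    have p2 : 0 ≤ (2 * C₁ + C₂ ^ 2 + (1 / (2 * a) + 1) + D + ‖z‖) * (m ^ 2 * N₀) := by positivity
    have p3 : 0 ≤ (2 * C₁ + C₂ ^ 2 + (1 / (2 * a) + 1) + D + Q) * N₀ := by positivity
    linarith
  · intro y hy
    refine (hval y hy).trans ?_
    have h1 : 2 * (N₀ * N₁) ≤ N₀ ^ 2 + N₁ ^ 2 := by nlinarith [sq_nonneg (N₀ - N₁)]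
    have h2 : 0 ≤ (2 * C₁ + C₂ ^ 2 + D + Q + ‖z‖) * (N₀ ^ 2 + N₁ ^ 2) := by positivity
    have h3 : 0 ≤ 1 / (2 * a) * N₁ ^ 2 := by positivity
    linarith

/-! ### Uniform resolvent bounds -/

/-- Two regimes: for `|m| ≤ n` the given resolvent norm `r` is used, and `S` bounds it with its
weight; for `|m| > n` the term `k * m ^ 2` exceeds `2 * C + k`, so `C * N ^ 2` is absorbed. The
constant `8 / k` is not sharp. -/
theorem sq_bound_step {k C r N G : ℝ} {m : ℤ} (hk : 0 < k) (hN : 0 ≤ N) (hG : 0 ≤ G)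
    (hr : N ≤ r * G) {n : ℕ} (hn : 2 * C + k ≤ k * n) {S : ℝ} (hS : 0 ≤ S)
    (hrS : m ∈ Finset.Icc (-(n : ℤ)) n → r * (1 + (m : ℝ) ^ 2) ≤ S)
    (h : k * m ^ 2 * N ^ 2 ≤ C * N ^ 2 + 2 * (N * G)) :
    (1 + (m : ℝ) ^ 2) * N ≤ (8 / k + S) * G := by
  have h8 : 0 ≤ 8 / k * G := by positivity
  by_cases hm : m ∈ Finset.Icc (-(n : ℤ)) n
  · have h1 := mul_le_mul_of_nonneg_left hr (by positivity : (0 : ℝ) ≤ 1 + (m : ℝ) ^ 2)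
    have h2 := mul_le_mul_of_nonneg_right (hrS hm) hG
    linarith
  · rcases hN.eq_or_lt with h0 | h0
    · rw [← h0, mul_zero]; positivity
    have h1 : (k * m ^ 2 - C) * N ≤ 2 * G := by
      refine le_of_mul_le_mul_right ?_ h0
      linarith
    have hmn : (n : ℝ) ≤ (m : ℝ) ^ 2 := by
      have : (n : ℤ) ≤ m ^ 2 := by
        rw [Finset.mem_Icc, not_and_or, not_le, not_le] at hm
        rcases hm with hm | hm <;> nlinarith
      exact_mod_cast this
    have h2 : 2 * C + k ≤ k * (m : ℝ) ^ 2 := hn.trans (mul_le_mul_of_nonneg_left hmn hk.le)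
    have h3 : k * (1 + (m : ℝ) ^ 2) * N ≤ 8 * G := by nlinarith
    have h4 : (1 + (m : ℝ) ^ 2) * N ≤ 8 / k * G := by
      rw [div_mul_eq_mul_div, le_div_iff₀ hk]; linarith
    have : 0 ≤ S * G := by positivity
    linarith

/-- In the energy bound for `N₁ ^ 2` the weight `1 + M ^ 2` is spent on a single factor `N₀` of each
term. Taking square roots leaves the weight `1 + |M|` for the derivative. -/
theorem one_add_abs_mul_le {k C A s N₀ N₁ N M : ℝ} (hk : 0 ≤ k) (hC : 0 ≤ C) (hA : 0 ≤ A)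
    (hs : 0 ≤ s) (n₀ : 0 ≤ N₀) (n₁ : 0 ≤ N₁) (ng : 0 ≤ N) (hs2 : s ^ 2 = 2 * C * A ^ 2 + 4 * A)
    (h1 : N₁ ^ 2 + k * M ^ 2 * N₀ ^ 2 ≤ C * N₀ ^ 2 + 2 * (N₀ * N))
    (b : (1 + M ^ 2) * N₀ ≤ A * N) : (1 + |M|) * N₁ ≤ s * N := by
  have hm0 : (0 : ℝ) ≤ M ^ 2 := sq_nonneg _
  have hAN : 0 ≤ A * N := mul_nonneg hA ng
  have b' : N₀ ≤ A * N := le_trans (le_mul_of_one_le_left n₀ (by linarith)) b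
  have hM : 0 ≤ |M| := abs_nonneg M
  refine (sq_le_sq₀ (by positivity) (by positivity)).1 ?_
  rw [mul_pow, mul_pow, hs2]
  have e : (1 + |M|) ^ 2 ≤ 2 * (1 + M ^ 2) := by
    nlinarith [sq_nonneg (1 - |M|), sq_abs M]
  have e1 : 0 ≤ k * M ^ 2 * N₀ ^ 2 := by positivity
  have e0 : N₁ ^ 2 ≤ C * N₀ ^ 2 + 2 * (N₀ * N) := by linarith
  calc (1 + |M|) ^ 2 * N₁ ^ 2 ≤ 2 * (1 + M ^ 2) * (C * N₀ ^ 2 + 2 * (N₀ * N)) := by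
        gcongr
    _ = 2 * C * (N₀ * ((1 + M ^ 2) * N₀)) + 4 * N * ((1 + M ^ 2) * N₀) := by ring
    _ ≤ 2 * C * ((A * N) * (A * N)) + 4 * N * (A * N) := by gcongr
    _ = (2 * C * A ^ 2 + 4 * A) * N ^ 2 := by ring

/-- No uniformity of the family `R` is assumed: its norms enter only for finitely many `m`, and
coercivity supplies the rest. The weights are those for which every second derivative of a sum of
separated functions is square integrable. -/
theorem exists_uniform_bound {K : SignType} {a : ℝ} (ha : 0 < a) (hK : K = 1 → a < π / 2)
    {B : BC} (hB : B.Admissible) (z : ℂ)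
    (R : ℤ → Lp ℂ 2 (volume.restrict (J₂ a)) →L[ℂ] Lp ℂ 2 (volume.restrict (J₂ a))) :
    ∃ C : ℝ, 0 ≤ C ∧ ∀ (m : ℤ) (g : Lp ℂ 2 (volume.restrict (J₂ a))) (u₀ u₁ u₂ : ℝ → ℂ),
      TransverseData K a B m (R m g) (g + z • R m g) u₀ u₁ u₂ →
      (1 + (m : ℝ) ^ 2) * l2 a u₀ ≤ C * ‖g‖ ∧ (1 + |(m : ℝ)|) * l2 a u₁ ≤ C * ‖g‖ ∧
      l2 a u₂ ≤ C * ‖g‖ ∧ ∀ y ∈ Icc (-a) a, ‖u₀ y‖ ≤ C * ‖g‖ := by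
  obtain ⟨k, C, hk, hC, hco⟩ := exists_coercive ha hK hB z
  -- The cutoff beyond which the coercive term dominates the constant of the energy estimate.
  obtain ⟨n, hn⟩ := exists_nat_ge ((2 * C + k) / k)
  rw [div_le_iff₀ hk] at hn
  obtain ⟨S, hS, hSm⟩ : ∃ S : ℝ, 0 ≤ S ∧ ∀ m ∈ Finset.Icc (-(n : ℤ)) n,
      ‖R m‖ * (1 + (m : ℝ) ^ 2) ≤ S :=
    ⟨∑ m ∈ Finset.Icc (-(n : ℤ)) n, ‖R m‖ * (1 + (m : ℝ) ^ 2),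
      Finset.sum_nonneg fun m _ => by positivity, fun m hm =>
      Finset.single_le_sum (f := fun m : ℤ => ‖R m‖ * (1 + (m : ℝ) ^ 2))
        (fun m _ => by positivity) hm⟩
  obtain ⟨A, hAe⟩ : ∃ A, A = 8 / k + S := ⟨_, rfl⟩
  have hA : 0 ≤ A := by rw [hAe]; positivity
  -- The estimates for the derivative and for the pointwise values are quadratic, hence the square
  -- roots `s` and `t`.
  obtain ⟨s, hs, hs2⟩ : ∃ s : ℝ, 0 ≤ s ∧ s ^ 2 = 2 * C * A ^ 2 + 4 * A :=
    ⟨_, Real.sqrt_nonneg _, Real.sq_sqrt (by positivity)⟩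
  obtain ⟨t, ht, ht2⟩ : ∃ t : ℝ, 0 ≤ t ∧ t ^ 2 = C * (A ^ 2 + s ^ 2) :=
    ⟨_, Real.sqrt_nonneg _, Real.sq_sqrt (by positivity)⟩
  obtain ⟨q, hq, hqe⟩ : ∃ q : ℝ, 0 ≤ q ∧ q = C * (s + A + A) + 1 := ⟨_, by positivity, rfl⟩
  refine ⟨A + s + q + t, by positivity, fun m g u₀ u₁ u₂ hd => ?_⟩
  obtain ⟨h1, h2, h3⟩ := hco m (R m g) g u₀ u₁ u₂ hd
  have n₀ : 0 ≤ l2 a u₀ := l2_nonneg _ _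
  have n₁ : 0 ≤ l2 a u₁ := l2_nonneg _ _
  have ng : 0 ≤ ‖g‖ := norm_nonneg _
  have hr : l2 a u₀ ≤ ‖R m‖ * ‖g‖ := by
    rw [← l2_congr hd.ae_eq, ← norm_eq_l2]
    exact (R m).le_opNorm g
  generalize l2 a u₀ = N₀ at *
  generalize l2 a u₁ = N₁ at *
  generalize ‖g‖ = N at *
  have b0 : (1 + (m : ℝ) ^ 2) * N₀ ≤ A * N := by
    rw [hAe]
    have : 0 ≤ N₁ ^ 2 := sq_nonneg _
    exact sq_bound_step (C := C) hk n₀ ng hr (by linarith) hS (hSm m) (by linarith)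
  have b1 := one_add_abs_mul_le hk.le hC hA hs n₀ n₁ ng hs2 h1 b0
  have hm0 : (0 : ℝ) ≤ (m : ℝ) ^ 2 := sq_nonneg _
  have hm1 : (0 : ℝ) ≤ |(m : ℝ)| := abs_nonneg _
  have b0' : N₀ ≤ A * N := le_trans (le_mul_of_one_le_left n₀ (by linarith)) b0
  have b1' : N₁ ≤ s * N := le_trans (le_mul_of_one_le_left n₁ (by linarith)) b1
  have b0'' : (m : ℝ) ^ 2 * N₀ ≤ A * N := by linarith
  have b2 : l2 a u₂ ≤ q * N := by
    have : C * (N₁ + m ^ 2 * N₀ + N₀) ≤ C * (s * N + A * N + A * N) := by gcongr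
    calc _ ≤ C * (s * N + A * N + A * N) + N := by linarith
      _ = q * N := by rw [hqe]; ring
  have t1 : 0 ≤ A * N := by positivity
  have t2 : 0 ≤ s * N := by positivity
  have t3 : 0 ≤ q * N := by positivity
  have t4 : 0 ≤ t * N := by positivity
  refine ⟨by linarith, by linarith, by linarith, fun y hy => ?_⟩
  have b3 : ‖u₀ y‖ ≤ t * N := by
    refine (sq_le_sq₀ (norm_nonneg _) t4).1 ?_
    rw [mul_pow, ht2]
    refine (h3 y hy).trans ?_
    calc C * (N₀ ^ 2 + N₁ ^ 2) ≤ C * ((A * N) ^ 2 + (s * N) ^ 2) := by gcongr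
      _ = C * (A ^ 2 + s ^ 2) * N ^ 2 := by ring
  linarith

/-! ### The transverse graph in the unweighted space -/

/-- The identity map from `L²(J₂, dν)` to `L²(J₂)`. -/
def equivJ {K : SignType} {a : ℝ} (hK : K = 1 → a < π / 2) :
    L2J K a ≃L[ℂ] Lp ℂ 2 (volume.restrict (J₂ a)) :=
  (exists_equiv_L2J hK).choose

theorem equivJ_ae_eq {K : SignType} {a : ℝ} (hK : K = 1 → a < π / 2) (f : L2J K a) :
    equivJ hK f =ᵐ[volume.restrict (J₂ a)] f :=
  (exists_equiv_L2J hK).choose_spec f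

/-- The identity map from `L²(Ω₀, G)` to `L²(Ω₀)`. -/
def equivΩ {K : SignType} {a : ℝ} (hK : K = 1 → a < π / 2) :
    L2Ω K a ≃L[ℂ] Lp ℂ 2 (volume.restrict (Ω₀ a)) :=
  (exists_equiv_L2Ω hK).choose

theorem equivΩ_ae_eq {K : SignType} {a : ℝ} (hK : K = 1 → a < π / 2) (f : L2Ω K a) :
    equivΩ hK f =ᵐ[volume.restrict (Ω₀ a)] f :=
  (exists_equiv_L2Ω hK).choose_spec f

/-- The transverse operator as a subspace of `L²(J₂) × L²(J₂)`. -/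
def transverseGraph' {K : SignType} {a : ℝ} (hK : K = 1 → a < π / 2) (B : BC) (m : ℤ) :
    Submodule ℂ (Lp ℂ 2 (volume.restrict (J₂ a)) × Lp ℂ 2 (volume.restrict (J₂ a))) :=
  (transverseGraph K a B m).comap
    ((equivJ hK).symm.toLinearEquiv.toLinearMap.prodMap (equivJ hK).symm.toLinearEquiv.toLinearMap)

/-- The Hamiltonian as a subspace of `L²(Ω₀) × L²(Ω₀)`. -/
def hamiltonianGraph' {K : SignType} {a : ℝ} (hK : K = 1 → a < π / 2) (B : BC) :
    Submodule ℂ (Lp ℂ 2 (volume.restrict (Ω₀ a)) × Lp ℂ 2 (volume.restrict (Ω₀ a))) :=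
  (hamiltonianGraph K a B).comap
    ((equivΩ hK).symm.toLinearEquiv.toLinearMap.prodMap (equivΩ hK).symm.toLinearEquiv.toLinearMap)

theorem mem_resolventSet_transverse {K : SignType} {a : ℝ} (hK : K = 1 → a < π / 2) (B : BC) (m : ℤ)
    (z : ℂ) :
    z ∈ resolventSet (transverse K a B m) ↔ IsResolventPoint (transverseGraph' hK B m) z := by
  rw [transverse, mem_resolventSet_toLinearPMap (transverseGraph_single_valued hK B m)]
  refine isResolventPoint_congr_equiv (equivJ hK) fun x y => ?_
  simp [transverseGraph']

theorem mem_resolventSet_hamiltonian {K : SignType} {a : ℝ} (hK : K = 1 → a < π / 2) (B : BC)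
    (z : ℂ) :
    z ∈ resolventSet (hamiltonian K a B) ↔ IsResolventPoint (hamiltonianGraph' hK B) z := by
  rw [hamiltonian, mem_resolventSet_toLinearPMap (hamiltonianGraph_single_valued hK B)]
  refine isResolventPoint_congr_equiv (equivΩ hK) fun x y => ?_
  simp [hamiltonianGraph']

theorem ae_congr_left {α β : Type*} {l : Filter α} {f g h : α → β} (hfg : f =ᶠ[l] g) :
    f =ᶠ[l] h ↔ g =ᶠ[l] h := ⟨hfg.symm.trans, hfg.trans⟩

theorem equivJ_symm_ae_eq_iff {K : SignType} {a : ℝ} (hK : K = 1 → a < π / 2)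
    (ψ : Lp ℂ 2 (volume.restrict (J₂ a))) (u : ℝ → ℂ) :
    (equivJ hK).symm ψ =ᵐ[measJ K a] u ↔ ψ =ᵐ[volume.restrict (J₂ a)] u := by
  have h := equivJ_ae_eq hK ((equivJ hK).symm ψ)
  rw [ContinuousLinearEquiv.apply_symm_apply] at h
  rw [ae_congr_left h]
  exact measJ_ae_iff hK _

theorem equivΩ_symm_ae_eq_iff {K : SignType} {a : ℝ} (hK : K = 1 → a < π / 2)
    (ψ : Lp ℂ 2 (volume.restrict (Ω₀ a))) (u : ℝ × ℝ → ℂ) :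
    (equivΩ hK).symm ψ =ᵐ[measΩ K a] u ↔ ψ =ᵐ[volume.restrict (Ω₀ a)] u := by
  have h := equivΩ_ae_eq hK ((equivΩ hK).symm ψ)
  rw [ContinuousLinearEquiv.apply_symm_apply] at h
  rw [ae_congr_left h]
  exact measΩ_ae_iff hK _

/-- Weak derivatives with continuous representatives are traded for primitives, for which boundary
values and integration by parts are immediate. -/
theorem mem_transverseGraph'_iff {K : SignType} {a : ℝ} (ha : 0 < a) (hK : K = 1 → a < π / 2)
    (B : BC) (m : ℤ) (ψ F : Lp ℂ 2 (volume.restrict (J₂ a))) :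
    (ψ, F) ∈ transverseGraph' hK B m ↔ ∃ u₀ u₁ u₂, TransverseData K a B m ψ F u₀ u₁ u₂ := by
  change IsTransversePair K a B m ((equivJ hK).symm ψ) ((equivJ hK).symm F) ↔ _
  refine exists_congr fun u₀ => exists_congr fun u₁ => exists_congr fun u₂ => ?_
  rw [equivJ_symm_ae_eq_iff, equivJ_symm_ae_eq_iff]
  constructor
  · rintro ⟨h1, h2, h3, h4, h5, h6, h7⟩
    exact ⟨h1, h2.isPrimitiveOn_of_continuousOn ha h4, h3.isPrimitiveOn_of_continuousOn ha h5,
      h3.memLp_deriv, h6, h7⟩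
  · rintro ⟨h1, h2, h3, h4, h5, h6⟩
    exact ⟨h1, h2.hasWeakDeriv ha (h3.memLp ha), h3.hasWeakDeriv ha h4, h2.continuousOn ha,
      h3.continuousOn ha, h5, h6⟩

/-- Membership in the graph: some `u ∈ W^{2,2}(Ω₀)` represents `ψ` and satisfies all boundary
conditions, and `F` is its image under the Hamiltonian. -/
theorem mem_hamiltonianGraph'_iff {K : SignType} {a : ℝ} (hK : K = 1 → a < π / 2)
    (B : BC) (ψ F : Lp ℂ 2 (volume.restrict (Ω₀ a))) :
    (ψ, F) ∈ hamiltonianGraph' hK B ↔ ∃ u d₁ d₂ d₁₁ d₁₂ d₂₂ : ℝ × ℝ → ℂ,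
      ψ =ᵐ[volume.restrict (Ω₀ a)] u ∧ IsW22 a u d₁ d₂ d₁₁ d₁₂ d₂₂ ∧
      IsPeriodic a u d₁ d₁₁ ∧ SatisfiesBC a B u d₂ d₂₂ ∧
      F =ᵐ[volume.restrict (Ω₀ a)] laplaceBeltrami K d₂ d₁₁ d₂₂ := by
  change IsHamiltonianPair K a B ((equivΩ hK).symm ψ) ((equivΩ hK).symm F) ↔ _
  simp only [IsHamiltonianPair, equivΩ_symm_ae_eq_iff]

/-! ### Fourier modes -/

/-- The normalized Fourier mode `(2π)^{-1/2} e^{imx}`. -/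
def mode (m : ℤ) (x : ℝ) : ℂ := ((Real.sqrt (2 * π))⁻¹ : ℝ) * Complex.exp (Complex.I * m * x)

theorem hasDerivAt_mode (m : ℤ) (x : ℝ) :
    HasDerivAt (mode m) (Complex.I * m * mode m x) x := by
  have h1 : HasDerivAt (fun x : ℝ => Complex.I * m * (x : ℂ)) (Complex.I * m) x := by
    simpa using (Complex.ofRealCLM.hasDerivAt (x := x)).const_mul (Complex.I * m)
  have h2 : HasDerivAt (mode m) _ x := (h1.cexp).const_mul (((Real.sqrt (2 * π))⁻¹ : ℝ) : ℂ)
  refine h2.congr_deriv ?_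
  simp only [mode]; ring

theorem contDiff_mode (m : ℤ) : ContDiff ℝ ∞ (mode m) := by
  unfold mode
  exact contDiff_const.mul
    (Complex.contDiff_exp.comp (contDiff_const.mul Complex.ofRealCLM.contDiff))

theorem continuous_mode (m : ℤ) : Continuous (mode m) := (contDiff_mode m).continuous

theorem conj_mode (m : ℤ) (x : ℝ) : starRingEnd ℂ (mode m x) = mode (-m) x := by
  simp [mode, ← Complex.exp_conj]

theorem norm_mode (m : ℤ) (x : ℝ) : ‖mode m x‖ = (Real.sqrt (2 * π))⁻¹ := by
  rw [mode, norm_mul, Complex.norm_real, Real.norm_of_nonneg (by positivity)]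
  have : Complex.I * m * x = ((m * x : ℝ) : ℂ) * Complex.I := by push_cast; ring
  rw [this, Complex.norm_exp_ofReal_mul_I, mul_one]

theorem mode_pi (m : ℤ) : mode m π = mode m (-π) := by
  rw [mode, mode]
  congr 1
  rw [Complex.exp_eq_exp_iff_exists_int]
  exact ⟨m, by push_cast; ring⟩

theorem mode_mul_mode (m n : ℤ) (x : ℝ) :
    mode m x * mode n x = ((Real.sqrt (2 * π))⁻¹ : ℝ) * mode (m + n) x := by
  simp only [mode]
  have : Complex.I * ((m + n : ℤ) : ℂ) * x = Complex.I * m * x + Complex.I * n * x := by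
    push_cast; ring
  rw [this, Complex.exp_add]; ring

theorem integral_mode_of_ne {m : ℤ} (hm : m ≠ 0) : ∫ x in J₁, mode m x = 0 := by
  have h := intervalIntegral.integral_eq_sub_of_hasDerivAt (a := -π) (b := π)
    (fun x _ => hasDerivAt_mode m x)
    ((continuous_const.mul (continuous_mode m)).intervalIntegrable _ _)
  rw [intervalIntegral.integral_const_mul, mode_pi, sub_self,
    intervalIntegral.integral_of_le (by linarith [Real.pi_pos]), integral_Ioc_eq_integral_Ioo] at h
  refine (mul_eq_zero.1 h).resolve_left ?_
  simp [hm]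

theorem integral_mode_mul (m n : ℤ) :
    ∫ x in J₁, mode (-m) x * mode n x = if m = n then 1 else 0 := by
  simp only [mode_mul_mode]
  rw [integral_const_mul]
  split_ifs with h
  · subst h
    have h2 : (0 : ℝ) < 2 * π := by positivity
    have hv : volume.real J₁ = 2 * π := by
      simp only [J₁, Real.volume_real_Ioo]
      rw [max_eq_left (by linarith [Real.pi_pos])]; ring
    simp only [neg_add_cancel, mode, Int.cast_zero, mul_zero, zero_mul, Complex.exp_zero, mul_one]
    rw [integral_const, measureReal_restrict_apply_univ, hv, Complex.real_smul,
      ← Complex.ofReal_mul, ← Complex.ofReal_mul]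
    norm_cast
    have := Real.mul_self_sqrt h2.le
    field_simp
    rw [sq, this]
  · rw [integral_mode_of_ne (fun h' => h (by omega)), mul_zero]

instance : IsFiniteMeasure (volume.restrict J₁) := ⟨by simp [J₁]⟩

instance (a : ℝ) : IsFiniteMeasure (volume.restrict (J₂ a)) := ⟨by simp [J₂]⟩

theorem memLp_mode (m : ℤ) : MemLp (mode m) 2 (volume.restrict J₁) :=
  MemLp.of_bound (continuous_mode m).aestronglyMeasurable _
    (Filter.Eventually.of_forall fun x => (norm_mode m x).le)

theorem restrict_Ω₀ (a : ℝ) :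
    (volume.restrict (Ω₀ a) : Measure (ℝ × ℝ)) =
      (volume.restrict J₁).prod (volume.restrict (J₂ a)) := by
  rw [Measure.prod_restrict]; rfl

theorem integral_Ω₀ {E : Type*} [NormedAddCommGroup E] [NormedSpace ℝ E] (a : ℝ) (f : ℝ × ℝ → E) :
    ∫ x in Ω₀ a, f x = ∫ x, f x ∂(volume.restrict J₁).prod (volume.restrict (J₂ a)) := by
  rw [restrict_Ω₀]

theorem memLp_tensor {a : ℝ} {h g : ℝ → ℂ} (hh : MemLp h 2 (volume.restrict J₁))
    (hg : MemLp g 2 (volume.restrict (J₂ a))) :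
    MemLp (fun x : ℝ × ℝ => h x.1 * g x.2) 2 (volume.restrict (Ω₀ a)) := by
  rw [restrict_Ω₀]
  have hm : AEStronglyMeasurable (fun x : ℝ × ℝ => h x.1 * g x.2)
      ((volume.restrict J₁).prod (volume.restrict (J₂ a))) :=
    hh.1.comp_fst.mul hg.1.comp_snd
  rw [memLp_two_iff_integrable_sq_norm hm]
  simp only [norm_mul, mul_pow]
  exact Integrable.mul_prod (f := fun x => ‖h x‖ ^ 2) (g := fun x => ‖g x‖ ^ 2)
    (hh.integrable_norm_pow (by norm_num)) (hg.integrable_norm_pow (by norm_num))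

theorem memLp_mode_mul (m : ℤ) {a : ℝ} {g : ℝ → ℂ} (hg : MemLp g 2 (volume.restrict (J₂ a))) :
    MemLp (fun x : ℝ × ℝ => mode m x.1 * g x.2) 2 (volume.restrict (Ω₀ a)) :=
  memLp_tensor (memLp_mode m) hg

theorem ae_restrict_Ω₀_snd {a : ℝ} {p : ℝ → Prop} (h : ∀ᵐ y ∂volume.restrict (J₂ a), p y) :
    ∀ᵐ x ∂volume.restrict (Ω₀ a), p x.2 := by
  rw [restrict_Ω₀]
  exact Measure.quasiMeasurePreserving_snd.ae h

/-! ### Embedding of, and projection onto, a single Fourier mode -/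

/-- The embedding `g ↦ mode m ⊗ g` as a linear map. -/
def modeEmbₗ (a : ℝ) (m : ℤ) :
    Lp ℂ 2 (volume.restrict (J₂ a)) →ₗ[ℂ] Lp ℂ 2 (volume.restrict (Ω₀ a)) where
  toFun g := (memLp_mode_mul m (Lp.memLp g)).toLp _
  map_add' f g := by
    ext1
    filter_upwards [(memLp_mode_mul m (Lp.memLp (f + g))).coeFn_toLp,
      (memLp_mode_mul m (Lp.memLp f)).coeFn_toLp, (memLp_mode_mul m (Lp.memLp g)).coeFn_toLp,
      Lp.coeFn_add ((memLp_mode_mul m (Lp.memLp f)).toLp _)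
        ((memLp_mode_mul m (Lp.memLp g)).toLp _),
      ae_restrict_Ω₀_snd (Lp.coeFn_add f g)] with x h1 h2 h3 h4 h5
    rw [h1, h4, Pi.add_apply, h2, h3, h5, Pi.add_apply, mul_add]
  map_smul' c f := by
    ext1
    filter_upwards [(memLp_mode_mul m (Lp.memLp (c • f))).coeFn_toLp,
      (memLp_mode_mul m (Lp.memLp f)).coeFn_toLp,
      Lp.coeFn_smul c ((memLp_mode_mul m (Lp.memLp f)).toLp _),
      ae_restrict_Ω₀_snd (Lp.coeFn_smul c f)] with x h1 h2 h4 h5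
    rw [h1, RingHom.id_apply, h4, Pi.smul_apply, h2, h5, Pi.smul_apply, smul_eq_mul, smul_eq_mul]
    ring

theorem modeEmbₗ_ae_eq {a : ℝ} (m : ℤ) (g : Lp ℂ 2 (volume.restrict (J₂ a))) :
    modeEmbₗ a m g =ᵐ[volume.restrict (Ω₀ a)] fun x => mode m x.1 * g x.2 :=
  (memLp_mode_mul m (Lp.memLp g)).coeFn_toLp

theorem inner_modeEmbₗ {a : ℝ} (m n : ℤ) (f g : Lp ℂ 2 (volume.restrict (J₂ a))) :
    inner ℂ (modeEmbₗ a m f) (modeEmbₗ a n g) = if m = n then inner ℂ f g else 0 := by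
  rw [L2.inner_def, L2.inner_def]
  have h : ∫ x in Ω₀ a, inner ℂ (modeEmbₗ a m f x) (modeEmbₗ a n g x) =
      ∫ x in Ω₀ a, (mode (-m) x.1 * mode n x.1) * inner ℂ (f x.2) (g x.2) := by
    refine integral_congr_ae ?_
    filter_upwards [modeEmbₗ_ae_eq m f, modeEmbₗ_ae_eq n g] with x h1 h2
    rw [h1, h2, RCLike.inner_apply, RCLike.inner_apply, map_mul, conj_mode]
    ring
  rw [h, restrict_Ω₀, integral_prod_mul (fun x => mode (-m) x * mode n x)
    (fun y => inner ℂ (f y) (g y)), integral_mode_mul]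
  split_ifs <;> simp

/-- The isometric embedding `g ↦ mode m ⊗ g`. -/
def modeEmb (a : ℝ) (m : ℤ) :
    Lp ℂ 2 (volume.restrict (J₂ a)) →ₗᵢ[ℂ] Lp ℂ 2 (volume.restrict (Ω₀ a)) :=
  (modeEmbₗ a m).isometryOfInner fun f g => by rw [inner_modeEmbₗ, if_pos rfl]

theorem modeEmb_ae_eq {a : ℝ} (m : ℤ) (g : Lp ℂ 2 (volume.restrict (J₂ a))) :
    modeEmb a m g =ᵐ[volume.restrict (Ω₀ a)] fun x => mode m x.1 * g x.2 :=
  modeEmbₗ_ae_eq m g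

theorem inner_modeEmb {a : ℝ} (m n : ℤ) (f g : Lp ℂ 2 (volume.restrict (J₂ a))) :
    inner ℂ (modeEmb a m f) (modeEmb a n g) = if m = n then inner ℂ f g else 0 :=
  inner_modeEmbₗ m n f g

/-- The `m`-th transverse Fourier coefficient. -/
def modeProj (a : ℝ) (m : ℤ) :
    Lp ℂ 2 (volume.restrict (Ω₀ a)) →L[ℂ] Lp ℂ 2 (volume.restrict (J₂ a)) :=
  ContinuousLinearMap.adjoint (modeEmb a m).toContinuousLinearMap

theorem inner_modeProj {a : ℝ} (m : ℤ) (f : Lp ℂ 2 (volume.restrict (J₂ a)))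
    (F : Lp ℂ 2 (volume.restrict (Ω₀ a))) :
    inner ℂ f (modeProj a m F) = inner ℂ (modeEmb a m f) F :=
  ContinuousLinearMap.adjoint_inner_right _ _ _

theorem modeProj_modeEmb {a : ℝ} (m n : ℤ) (f : Lp ℂ 2 (volume.restrict (J₂ a))) :
    modeProj a m (modeEmb a n f) = if m = n then f else 0 := by
  refine ext_inner_left ℂ fun g => ?_
  rw [inner_modeProj, inner_modeEmb]
  split_ifs <;> simp

/-- The adjoint relation paired with `conj η`. This weak form of the Fourier coefficient lets every
identity for coefficients be tested against functions on the strip, without a pointwise formula for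
`modeProj`. -/
theorem integral_modeProj_mul {a : ℝ} (m : ℤ) (F : Lp ℂ 2 (volume.restrict (Ω₀ a))) {η : ℝ → ℂ}
    (hη : MemLp η 2 (volume.restrict (J₂ a))) :
    ∫ x in J₂ a, modeProj a m F x * η x = ∫ x in Ω₀ a, F x * (mode (-m) x.1 * η x.2) := by
  have hs : MemLp (fun x => starRingEnd ℂ (η x)) 2 (volume.restrict (J₂ a)) := hη.star
  have h := inner_modeProj m (hs.toLp _) F
  rw [L2.inner_def, L2.inner_def] at h
  have e1 : ∫ x in J₂ a, inner ℂ (hs.toLp _ x) (modeProj a m F x) =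
      ∫ x in J₂ a, modeProj a m F x * η x := by
    refine integral_congr_ae ?_
    filter_upwards [hs.coeFn_toLp] with x hx
    rw [hx, RCLike.inner_apply, Complex.conj_conj]
  have e2 : ∫ x in Ω₀ a, inner ℂ (modeEmb a m (hs.toLp _) x) (F x) =
      ∫ x in Ω₀ a, F x * (mode (-m) x.1 * η x.2) := by
    refine integral_congr_ae ?_
    filter_upwards [modeEmb_ae_eq m (hs.toLp _), ae_restrict_Ω₀_snd hs.coeFn_toLp] with x hx hx'
    rw [hx, hx', RCLike.inner_apply, map_mul, Complex.conj_conj, conj_mode]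
  rw [← e1, ← e2, h]

/-! ### Completeness of the Fourier modes -/

/-- Parseval's identity on an interval of length `2π`. -/
theorem ae_zero_of_integral_mode {w : ℝ → ℂ} (hw : MemLp w 2 (volume.restrict J₁))
    (h : ∀ m : ℤ, ∫ x in J₁, w x * mode m x = 0) : ∫ x in J₁, ‖w x‖ ^ 2 = 0 := by
  have hlt : -π < π := by linarith [Real.pi_pos]
  have hw' : MemLp w 2 (volume.restrict (Ioc (-π) π)) := by
    rwa [← restrict_Ioo_eq_restrict_Ioc]
  have hs := hasSum_sq_fourierCoeffOn hlt hw'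
  have h0 : ∀ m, fourierCoeffOn hlt w m = 0 := fun m => by
    rw [fourierCoeffOn_eq_integral, intervalIntegral.integral_of_le hlt.le,
      integral_Ioc_eq_integral_Ioo]
    have e : ∀ x : ℝ, fourier (-m) (x : AddCircle (π - -π)) • w x =
        (Real.sqrt (2 * π) : ℂ) * (w x * mode (-m) x) := fun x => by
      have hp : (π : ℂ) ≠ 0 := by exact_mod_cast Real.pi_pos.ne'
      have hsq : ((Real.sqrt (2 * π) : ℝ) : ℂ) ≠ 0 := by
        exact_mod_cast (Real.sqrt_pos.2 (by positivity)).ne'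
      rw [fourier_coe_apply, mode, smul_eq_mul]
      have : 2 * (π : ℂ) * Complex.I * ((-m : ℤ) : ℂ) * x / ((π - -π : ℝ) : ℂ) =
          Complex.I * ((-m : ℤ) : ℂ) * x := by
        push_cast; field_simp; ring
      rw [this, Complex.ofReal_inv]
      field_simp
    simp only [e]
    rw [integral_const_mul]
    have := h (-m)
    rw [J₁] at this
    rw [this]; simp
  simp only [h0, norm_zero, ne_eq, OfNat.ofNat_ne_zero, not_false_eq_true, zero_pow] at hs
  have := hs.unique hasSum_zero
  rw [intervalIntegral.integral_of_le hlt.le, integral_Ioc_eq_integral_Ioo] at this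
  refine (smul_eq_zero.1 this).resolve_left ?_
  exact (inv_pos.2 (by linarith)).ne'

/-- The Fourier coefficients determine a function. -/
theorem eq_zero_of_modeProj {a : ℝ} {F : Lp ℂ 2 (volume.restrict (Ω₀ a))}
    (h : ∀ m, modeProj a m F = 0) : F = 0 := by
  have hF : MemLp F 2 ((volume.restrict J₁).prod (volume.restrict (J₂ a))) := by
    rw [← restrict_Ω₀]; exact Lp.memLp F
  have hFi : Integrable F ((volume.restrict J₁).prod (volume.restrict (J₂ a))) :=
    hF.integrable (by norm_num)
  have hF2 : Integrable (fun x => ‖F x‖ ^ 2) ((volume.restrict J₁).prod (volume.restrict (J₂ a))) :=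
    hF.integrable_norm_pow (by norm_num)
  -- By Fubini, the integral of the slice coefficient against `φ` is the pairing of `F` with `mode m
  -- ⊗ φ`, that is, of `modeProj a (-m) F` with `φ`. As there are countably many `m`, almost every
  -- slice then has all its coefficients zero.
  have hcoef : ∀ m : ℤ, ∀ᵐ y ∂volume.restrict (J₂ a), ∫ x in J₁, F (x, y) * mode m x = 0 := by
    intro m
    have hbd : Integrable (fun x : ℝ × ℝ => F x * mode m x.1)
        ((volume.restrict J₁).prod (volume.restrict (J₂ a))) :=
      hFi.mul_bdd (c := (Real.sqrt (2 * π))⁻¹)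
        ((continuous_mode m).comp continuous_fst).aestronglyMeasurable
        (Filter.Eventually.of_forall fun x => (norm_mode m x.1).le)
    have hint := hbd.integral_prod_right
    change ∀ᵐ y ∂volume.restrict (Ioo (-a) a), ∫ x in J₁, F (x, y) * mode m x = 0
    rw [ae_restrict_iff' (isOpen_Ioo (a := -a) (b := a)).measurableSet]
    refine (isOpen_Ioo (a := -a) (b := a)).ae_eq_zero_of_integral_contDiff_smul_eq_zero
      (LocallyIntegrableOn.mono_set (t := J₂ a)
        (locallyIntegrableOn_of_locallyIntegrable_restrict hint.locallyIntegrable) subset_rfl)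
      fun φ hφ hc hs => ?_
    have hφ' : Continuous fun x => (φ x : ℂ) := Complex.continuous_ofReal.comp hφ.continuous
    have hc' : HasCompactSupport fun x => (φ x : ℂ) := hc.comp_left (g := ((↑) : ℝ → ℂ)) rfl
    have hm : MemLp (fun x => (φ x : ℂ)) 2 (volume.restrict (J₂ a)) :=
      (hφ'.memLp_of_hasCompactSupport hc').restrict _
    have key := integral_modeProj_mul (-m) F hm
    rw [h (-m), neg_neg] at key
    rw [integral_congr_ae (g := fun _ => (0 : ℂ)) ((Lp.coeFn_zero ℂ 2 _).mono fun x hx => by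
      rw [hx]; simp), integral_zero, integral_Ω₀] at key
    have e : ∫ y, φ y • ∫ x in J₁, F (x, y) * mode m x =
        ∫ y in J₂ a, φ y • ∫ x in J₁, F (x, y) * mode m x := by
      refine (setIntegral_eq_integral_of_forall_compl_eq_zero fun x hx => ?_).symm
      rw [image_eq_zero_of_notMem_tsupport fun h' => hx (hs h'), zero_smul]
    rw [e]
    have hbd2 : Integrable (fun x : ℝ × ℝ => F x * (mode m x.1 * (φ x.2 : ℂ)))
        ((volume.restrict J₁).prod (volume.restrict (J₂ a))) := by
      obtain ⟨C, hC⟩ := hc'.exists_bound_of_continuous hφ'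
      refine (hbd.mul_bdd (g := fun x : ℝ × ℝ => (φ x.2 : ℂ)) (c := C)
        (hφ'.comp continuous_snd).aestronglyMeasurable
        (Filter.Eventually.of_forall fun x => hC x.2)).congr
        (Filter.Eventually.of_forall fun x => ?_)
      simp only; ring
    rw [integral_prod_symm _ hbd2] at key
    rw [key]
    congr 1
    funext y
    rw [Complex.real_smul, ← integral_const_mul]
    congr 1
    funext x
    simp only; ring
  have hsl : ∀ᵐ y ∂volume.restrict (J₂ a), ∫ x in J₁, ‖F (x, y)‖ ^ 2 = 0 := by
    filter_upwards [ae_all_iff.2 hcoef, hF2.prod_left_ae, hFi.prod_left_ae] with y h1 h2 h3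
    exact ae_zero_of_integral_mode ((memLp_two_iff_integrable_sq_norm h3.1).2 h2) h1
  have hn : ‖F‖ ^ 2 = 0 := by
    rw [norm_sq_lp_eq_integral, integral_Ω₀, integral_prod_symm _ hF2,
      integral_congr_ae (g := fun _ => (0 : ℝ)) hsl, integral_zero]
  exact norm_eq_zero.1 (pow_eq_zero_iff two_ne_zero |>.1 hn)

/-! ### Orthogonal decomposition of `L²(Ω₀)` and diagonal operators -/

theorem orthogonalFamily_modeEmb (a : ℝ) :
    OrthogonalFamily ℂ (fun _ : ℤ => Lp ℂ 2 (volume.restrict (J₂ a))) (modeEmb a) :=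
  fun m n hmn f g => by rw [inner_modeEmb, if_neg hmn]

/-- A function orthogonal to every embedded mode has all its Fourier coefficients zero, so the modes
span a dense subspace. -/
theorem isHilbertSum_modeEmb (a : ℝ) :
    IsHilbertSum ℂ (fun _ : ℤ => Lp ℂ 2 (volume.restrict (J₂ a))) (modeEmb a) := by
  refine IsHilbertSum.mk (orthogonalFamily_modeEmb a) (top_le_iff.2 ?_)
  rw [Submodule.topologicalClosure_eq_top_iff, Submodule.eq_bot_iff]
  intro F hF
  refine eq_zero_of_modeProj fun m => ext_inner_left ℂ fun g => ?_
  rw [inner_modeProj, inner_zero_right]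
  exact (Submodule.mem_orthogonal _ _).1 hF _
    (Submodule.mem_iSup_of_mem m (LinearMap.mem_range_self _ g))

theorem linearIsometryEquiv_apply_eq_modeProj (a : ℝ) (F : Lp ℂ 2 (volume.restrict (Ω₀ a))) (m : ℤ) :
    (isHilbertSum_modeEmb a).linearIsometryEquiv F m = modeProj a m F := by
  have h := (isHilbertSum_modeEmb a).hasSum_linearIsometryEquiv_symm
    ((isHilbertSum_modeEmb a).linearIsometryEquiv F)
  rw [LinearIsometryEquiv.symm_apply_apply] at h
  have h2 := h.mapL (modeProj a m)
  rw [h2.unique (hasSum_single m fun n hn => by rw [modeProj_modeEmb, if_neg hn.symm]),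
    modeProj_modeEmb, if_pos rfl]

theorem summable_norm_sq_modeProj {a : ℝ} (F : Lp ℂ 2 (volume.restrict (Ω₀ a))) :
    Summable fun m => ‖modeProj a m F‖ ^ 2 := by
  have h := (lp.memℓp ((isHilbertSum_modeEmb a).linearIsometryEquiv F)).summable (by norm_num)
  simpa [linearIsometryEquiv_apply_eq_modeProj] using h

/-- A uniformly bounded family of operators on the Fourier coefficients defines an operator. -/
theorem exists_diagonal {a : ℝ}
    (T : ℤ → Lp ℂ 2 (volume.restrict (J₂ a)) →L[ℂ] Lp ℂ 2 (volume.restrict (J₂ a))) {C : ℝ}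
    (hC : 0 ≤ C) (hT : ∀ m, ‖T m‖ ≤ C) :
    ∃ R : Lp ℂ 2 (volume.restrict (Ω₀ a)) →L[ℂ] Lp ℂ 2 (volume.restrict (Ω₀ a)),
      ∀ F, HasSum (fun m => modeEmb a m (T m (modeProj a m F))) (R F) := by
  let U := (isHilbertSum_modeEmb a).linearIsometryEquiv
  refine ⟨(U.symm.toContinuousLinearEquiv : _ →L[ℂ] _) ∘L lp.mapCLM 2 T hC hT ∘L
    (U.toContinuousLinearEquiv : _ →L[ℂ] _), fun F => ?_⟩
  have h := (isHilbertSum_modeEmb a).hasSum_linearIsometryEquiv_symm (lp.mapCLM 2 T hC hT (U F))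
  convert h using 2 with m
  simp only [lp.mapCLM_apply_coe, U, linearIsometryEquiv_apply_eq_modeProj]
  rfl

/-! ### Fourier coefficients of functions in the domain of the Hamiltonian -/

theorem _root_.MeasureTheory.MemLp.integrable_fun_mul {α : Type*} [MeasurableSpace α]
    {μ : Measure α} {f g : α → ℂ} (hf : MemLp f 2 μ) (hg : MemLp g 2 μ) :
    Integrable (fun x => f x * g x) μ := hf.integrable_mul hg

theorem fderiv_tensor {h k : ℝ → ℂ} {h' k' : ℂ} {x : ℝ × ℝ} (hh : HasDerivAt h h' x.1)
    (hk : HasDerivAt k k' x.2) :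
    fderiv ℝ (fun x : ℝ × ℝ => h x.1 * k x.2) x (1, 0) = h' * k x.2 ∧
    fderiv ℝ (fun x : ℝ × ℝ => h x.1 * k x.2) x (0, 1) = h x.1 * k' := by
  have h1 := hh.hasFDerivAt.comp x (hasFDerivAt_fst (𝕜 := ℝ) (p := x))
  have h2 := hk.hasFDerivAt.comp x (hasFDerivAt_snd (𝕜 := ℝ) (p := x))
  have h3 : HasFDerivAt (fun x : ℝ × ℝ => h x.1 * k x.2) _ x := h1.mul h2
  rw [h3.fderiv]
  constructor <;> simp [mul_comm]

/-- A compactly supported test function which equals `mode m ⊗ φ` near the closed strip. -/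
theorem exists_test_mode (m : ℤ) {φ : ℝ → ℂ} (hφ : ContDiff ℝ ∞ φ) (hc : HasCompactSupport φ) :
    ∃ Φ : ℝ × ℝ → ℂ, ContDiff ℝ ∞ Φ ∧ HasCompactSupport Φ ∧ ∀ x : ℝ × ℝ, x.1 ∈ Icc (-π) π →
      Φ x = mode m x.1 * φ x.2 ∧
      fderiv ℝ Φ x (1, 0) = Complex.I * m * mode m x.1 * φ x.2 ∧
      fderiv ℝ Φ x (0, 1) = mode m x.1 * fderiv ℝ φ x.2 1 := by
  -- As `π < 4`, the cutoff is one in a neighbourhood of each point of `[-π, π]`, so derivatives are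
  -- unaffected there.
  let f : ContDiffBump (0 : ℝ) := ⟨4, 5, by norm_num, by norm_num⟩
  have hf : ContDiff ℝ ∞ fun x => (f x : ℂ) := Complex.ofRealCLM.contDiff.comp f.contDiff
  have hfc : HasCompactSupport fun x => (f x : ℂ) :=
    f.hasCompactSupport.comp_left (g := ((↑) : ℝ → ℂ)) rfl
  let g : ℝ → ℂ := fun x => (f x : ℂ) * mode m x
  have hg : ContDiff ℝ ∞ g := hf.mul (contDiff_mode m)
  have hgc : HasCompactSupport g := hfc.mul_right
  refine ⟨fun x => g x.1 * φ x.2, (hg.comp contDiff_fst).mul (hφ.comp contDiff_snd), ?_, ?_⟩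
  · refine HasCompactSupport.of_support_subset_isCompact (hgc.isCompact.prod hc.isCompact) ?_
    intro x hx
    simp only [Function.mem_support, ne_eq, mul_eq_zero, not_or] at hx
    exact ⟨subset_tsupport _ hx.1, subset_tsupport _ hx.2⟩
  · intro x hx
    have hlt : |x.1| < 4 := by
      rw [abs_lt]; constructor <;> linarith [hx.1, hx.2, Real.pi_lt_four]
    have hnear : ∀ᶠ y in nhds x.1, g y = mode m y := by
      have : Metric.ball (0 : ℝ) 4 ∈ nhds x.1 :=
        Metric.isOpen_ball.mem_nhds (by simpa [Real.dist_eq] using hlt)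
      filter_upwards [this] with y hy
      simp [g, f.one_of_mem_closedBall (Metric.ball_subset_closedBall hy)]
    have hd : HasDerivAt g (Complex.I * m * mode m x.1) x.1 :=
      (hasDerivAt_mode m x.1).congr_of_eventuallyEq hnear
    have hk : HasDerivAt φ (fderiv ℝ φ x.2 1) x.2 := by
      rw [fderiv_apply_one_eq_deriv]
      exact ((hφ.differentiable (by simp)).differentiableAt).hasDerivAt
    obtain ⟨h1, h2⟩ := fderiv_tensor hd hk
    exact ⟨by simp only [hnear.self_of_nhds], h1, by rw [h2, hnear.self_of_nhds]⟩

theorem memLp_test {a : ℝ} {φ : ℝ → ℂ} (hφ : Continuous φ) (hc : HasCompactSupport φ) :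
    MemLp φ 2 (volume.restrict (J₂ a)) :=
  (hφ.memLp_of_hasCompactSupport hc).restrict _

theorem ae_restrict_Ω₀_mem (a : ℝ) : ∀ᵐ x ∂volume.restrict (Ω₀ a), x ∈ Ω₀ a :=
  ae_restrict_mem (measurableSet_Ioo.prod measurableSet_Ioo)

/-- The Gauss-Green formula tested with `mode (-m) ⊗ φ`. It becomes the one-dimensional formula for
the Fourier coefficients, whose boundary values are the Fourier coefficients of the traces. -/
theorem HasTraces₂.integral_modeProj {a : ℝ} {u g : ℝ × ℝ → ℂ} {t t' : ℝ → ℂ}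
    (h : HasTraces₂ a u g t t') (m : ℤ) {U G : Lp ℂ 2 (volume.restrict (Ω₀ a))}
    (hU : U =ᵐ[volume.restrict (Ω₀ a)] u) (hG : G =ᵐ[volume.restrict (Ω₀ a)] g)
    {φ : ℝ → ℂ} (hφ : ContDiff ℝ ∞ φ) (hc : HasCompactSupport φ) :
    ∫ x in J₂ a, (modeProj a m U x * fderiv ℝ φ x 1 + modeProj a m G x * φ x) =
      (∫ x in J₁, t' x * mode (-m) x) * φ a - (∫ x in J₁, t x * mode (-m) x) * φ (-a) := by
  obtain ⟨h1, h2⟩ := test_fderiv hφ hc 1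
  have mφ := memLp_test (a := a) hφ.continuous hc
  have mφ' := memLp_test (a := a) h1 h2
  obtain ⟨Φ, hΦ, hΦc, hΦe⟩ := exists_test_mode (-m) hφ hc
  have key := h.green Φ hΦ hΦc
  rw [integral_add ((Lp.memLp (modeProj a m U)).integrable_fun_mul mφ')
    ((Lp.memLp (modeProj a m G)).integrable_fun_mul mφ), integral_modeProj_mul m U mφ',
    integral_modeProj_mul m G mφ,
    ← integral_add ((Lp.memLp U).integrable_fun_mul (memLp_mode_mul (-m) mφ'))
      ((Lp.memLp G).integrable_fun_mul (memLp_mode_mul (-m) mφ))]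
  have e : ∫ x in Ω₀ a, (U x * (mode (-m) x.1 * fderiv ℝ φ x.2 1) + G x * (mode (-m) x.1 * φ x.2)) =
      ∫ x in Ω₀ a, (u x * fderiv ℝ Φ x (0, 1) + g x * Φ x) := by
    refine integral_congr_ae ?_
    filter_upwards [hU, hG, ae_restrict_Ω₀_mem a] with x h1 h2 hx
    obtain ⟨e1, -, e3⟩ := hΦe x (Ioo_subset_Icc_self hx.1)
    rw [h1, h2, e1, e3]
  rw [e, key, ← integral_mul_const, ← integral_mul_const, ← integral_sub]
  · refine setIntegral_congr_fun measurableSet_Ioo fun x hx => ?_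
    simp only [(hΦe (x, a) (Ioo_subset_Icc_self hx)).1, (hΦe (x, -a) (Ioo_subset_Icc_self hx)).1]
    ring
  · exact (h.memLp_right.integrable_fun_mul (memLp_mode (-m))).mul_const _
  · exact (h.memLp_left.integrable_fun_mul (memLp_mode (-m))).mul_const _

/-- The same test function in the other direction: periodicity of the traces and of the mode cancels
the boundary terms, so `∂₁` acts on the coefficient as multiplication by `im`. -/
theorem HasTraces₁.modeProj_ae_eq {a : ℝ} {u g : ℝ × ℝ → ℂ} {t t' : ℝ → ℂ}
    (h : HasTraces₁ a u g t t') (ht : ∀ᵐ y ∂volume.restrict (J₂ a), t y = t' y)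
    (m : ℤ) {U G : Lp ℂ 2 (volume.restrict (Ω₀ a))}
    (hU : U =ᵐ[volume.restrict (Ω₀ a)] u) (hG : G =ᵐ[volume.restrict (Ω₀ a)] g) :
    ∀ᵐ y ∂volume.restrict (J₂ a), modeProj a m G y = Complex.I * m * modeProj a m U y := by
  have key := ae_zero_of_integral_test (isOpen_Ioo (a := -a) (b := a))
    ((Lp.memLp (modeProj a m G)).sub ((Lp.memLp (modeProj a m U)).const_mul (Complex.I * m))) ?_
  · filter_upwards [key] with y hy using sub_eq_zero.1 hy
  intro φ hφ hc hs
  have mφ := memLp_test (a := a) hφ.continuous hc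
  obtain ⟨Φ, hΦ, hΦc, hΦe⟩ := exists_test_mode (-m) hφ hc
  have key := h.green Φ hΦ hΦc
  have hr : ∫ y in J₂ a, (t' y * Φ (π, y) - t y * Φ (-π, y)) = 0 := by
    refine integral_eq_zero_of_ae (ht.mono fun y hy => ?_)
    have hpi := Real.pi_pos
    change t' y * Φ (π, y) - t y * Φ (-π, y) = 0
    rw [(hΦe (π, y) ⟨by simp only; linarith, le_rfl⟩).1,
      (hΦe (-π, y) ⟨le_rfl, by simp only; linarith⟩).1, hy]
    simp only [mode_pi, sub_self]
  rw [hr] at key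
  have e : ∫ x in Ω₀ a, (u x * fderiv ℝ Φ x (1, 0) + g x * Φ x) =
      ∫ x in Ω₀ a, (Complex.I * (-m : ℤ) * (U x * (mode (-m) x.1 * φ x.2)) +
        G x * (mode (-m) x.1 * φ x.2)) := by
    refine integral_congr_ae ?_
    filter_upwards [hU, hG, ae_restrict_Ω₀_mem a] with x h1 h2 hx
    obtain ⟨e1, e2, -⟩ := hΦe x (Ioo_subset_Icc_self hx.1)
    rw [h1, h2, e1, e2]
    ring
  rw [e, integral_add (((Lp.memLp U).integrable_fun_mul (memLp_mode_mul (-m) mφ)).const_mul _)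
    ((Lp.memLp G).integrable_fun_mul (memLp_mode_mul (-m) mφ)), integral_const_mul,
    ← integral_modeProj_mul m U mφ, ← integral_modeProj_mul m G mφ] at key
  have e2 : ∀ y, (⇑(modeProj a m G) - fun x => Complex.I * m * modeProj a m U x) y * φ y =
      modeProj a m G y * φ y - Complex.I * m * (modeProj a m U y * φ y) := fun y => by
    simp only [Pi.sub_apply]; ring
  change ∫ y in J₂ a, _ = 0
  simp only [e2]
  rw [integral_sub ((Lp.memLp (modeProj a m G)).integrable_fun_mul mφ)
    (((Lp.memLp (modeProj a m U)).integrable_fun_mul mφ).const_mul _), integral_const_mul]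
  push_cast at key
  linear_combination key

/-- The conditions are linear with constant coefficients, so they pass to Fourier coefficients. In
solved form `s` and `s'` are combinations of `t` and `t'`, and only the latter need be square
integrable. -/
theorem BC.Admissible.holds_integral_mode {B : BC} (hB : B.Admissible) (m : ℤ) {t s t' s' : ℝ → ℂ}
    (mt : MemLp t 2 (volume.restrict J₁)) (mt' : MemLp t' 2 (volume.restrict J₁))
    (h : ∀ᵐ x ∂volume.restrict J₁, B.Holds (t x) (s x) (t' x) (s' x)) :
    B.Holds (∫ x in J₁, t x * mode m x) (∫ x in J₁, s x * mode m x)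
      (∫ x in J₁, t' x * mode m x) (∫ x in J₁, s' x * mode m x) := by
  obtain ⟨p, q, r, w, hs⟩ := hB.exists_solved
  have it : Integrable (fun x => t x * mode m x) (volume.restrict J₁) :=
    mt.integrable_fun_mul (memLp_mode m)
  have it' : Integrable (fun x => t' x * mode m x) (volume.restrict J₁) :=
    mt'.integrable_fun_mul (memLp_mode m)
  have key : ∀ (c d : ℂ) (f : ℝ → ℂ), (∀ᵐ x ∂volume.restrict J₁, f x = c * t x + d * t' x) →
      ∫ x in J₁, f x * mode m x =
        c * (∫ x in J₁, t x * mode m x) + d * ∫ x in J₁, t' x * mode m x := fun c d f hf => by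
    rw [← integral_const_mul, ← integral_const_mul,
      ← integral_add (it.const_mul c) (it'.const_mul d)]
    refine integral_congr_ae (hf.mono fun x hx => ?_)
    simp only [hx]
    ring
  rw [hs]
  exact ⟨key _ _ _ (h.mono fun x hx => ((hs _ _ _ _).1 hx).1),
    key _ _ _ (h.mono fun x hx => ((hs _ _ _ _).1 hx).2)⟩

theorem norm_warp_inv_sq_bound {K : SignType} {a : ℝ} (hK : K = 1 → a < π / 2) :
    ∃ C : ℝ, ∀ x ∈ J₂ a, ‖(((warp K x : ℝ) : ℂ) ^ 2)⁻¹‖ ≤ C := by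
  obtain ⟨_, Q, _, _, hw⟩ := warp_inv_sq_bound hK
  refine ⟨Q, fun x hx => ?_⟩
  rw [norm_inv, norm_pow, Complex.norm_real, Real.norm_eq_abs, sq_abs]
  exact (hw x hx).2

theorem norm_drift_bound {K : SignType} {a : ℝ} (hK : K = 1 → a < π / 2) :
    ∃ C : ℝ, ∀ x ∈ J₂ a, ‖(drift K x : ℂ)‖ ≤ C := by
  obtain ⟨D, -, hd⟩ := exists_drift_bound hK
  exact ⟨D, fun x hx => by rw [Complex.norm_real]; exact hd x (Ioo_subset_Icc_self hx)⟩

theorem measurable_warp_inv_sq (K : SignType) : Measurable fun x => (((warp K x : ℝ) : ℂ) ^ 2)⁻¹ :=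
  ((Complex.measurable_ofReal.comp (continuous_warp K).measurable).pow_const 2).inv

theorem measurable_drift_complex (K : SignType) : Measurable fun x => (drift K x : ℂ) :=
  Complex.measurable_ofReal.comp (measurable_drift K)

/-- The coefficients of the operator depend on `x₂` only, so they can be moved onto the test
function and commute with taking Fourier coefficients in `x₁`. -/
theorem modeProj_laplaceBeltrami {K : SignType} {a : ℝ} (hK : K = 1 → a < π / 2) (m : ℤ)
    {F D₂ D₁₁ D₂₂ : Lp ℂ 2 (volume.restrict (Ω₀ a))}
    (hF : F =ᵐ[volume.restrict (Ω₀ a)] laplaceBeltrami K D₂ D₁₁ D₂₂) :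
    ∀ᵐ y ∂volume.restrict (J₂ a), modeProj a m F y =
      -((((warp K y : ℝ) : ℂ) ^ 2)⁻¹ * modeProj a m D₁₁ y) - modeProj a m D₂₂ y -
        (drift K y : ℂ) * modeProj a m D₂ y := by
  obtain ⟨Q, hq⟩ := norm_warp_inv_sq_bound hK
  obtain ⟨D, hd⟩ := norm_drift_bound hK
  have mq : ∀ {u : ℝ → ℂ}, MemLp u 2 (volume.restrict (J₂ a)) → _ :=
    fun h => memLp_mul hq (measurable_warp_inv_sq K) h
  have md : ∀ {u : ℝ → ℂ}, MemLp u 2 (volume.restrict (J₂ a)) → _ :=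
    fun h => memLp_mul hd (measurable_drift_complex K) h
  have key := ae_zero_of_integral_test (isOpen_Ioo (a := -a) (b := a))
    ((Lp.memLp (modeProj a m F)).sub (((mq (Lp.memLp (modeProj a m D₁₁))).neg.sub
      (Lp.memLp (modeProj a m D₂₂))).sub (md (Lp.memLp (modeProj a m D₂))))) ?_
  · filter_upwards [key] with y hy using sub_eq_zero.1 hy
  intro φ hφ hc hs
  have mφ := memLp_test (a := a) hφ.continuous hc
  have e2 : ∀ y, (⇑(modeProj a m F) - (((-fun x => (((warp K x : ℝ) : ℂ) ^ 2)⁻¹ *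
      modeProj a m D₁₁ x) - ⇑(modeProj a m D₂₂)) - fun x => (drift K x : ℂ) * modeProj a m D₂ x)) y *
        φ y = modeProj a m F y * φ y + modeProj a m D₁₁ y * ((((warp K y : ℝ) : ℂ) ^ 2)⁻¹ * φ y) +
        modeProj a m D₂₂ y * φ y + modeProj a m D₂ y * ((drift K y : ℂ) * φ y) := fun y => by
    simp only [Pi.sub_apply, Pi.neg_apply]; ring
  change ∫ y in J₂ a, _ = 0
  simp only [e2]
  have i1 : IntegrableOn (fun y => modeProj a m F y * φ y) (J₂ a) :=
    (Lp.memLp (modeProj a m F)).integrable_fun_mul mφ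
  have i2 : IntegrableOn (fun y => modeProj a m D₁₁ y * ((((warp K y : ℝ) : ℂ) ^ 2)⁻¹ * φ y))
    (J₂ a) := (Lp.memLp (modeProj a m D₁₁)).integrable_fun_mul (mq mφ)
  have i3 : IntegrableOn (fun y => modeProj a m D₂₂ y * φ y) (J₂ a) :=
    (Lp.memLp (modeProj a m D₂₂)).integrable_fun_mul mφ
  have i4 : IntegrableOn (fun y => modeProj a m D₂ y * ((drift K y : ℂ) * φ y)) (J₂ a) :=
    (Lp.memLp (modeProj a m D₂)).integrable_fun_mul (md mφ)
  have i12 : IntegrableOn (fun y => modeProj a m F y * φ y +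
    modeProj a m D₁₁ y * ((((warp K y : ℝ) : ℂ) ^ 2)⁻¹ * φ y)) (J₂ a) := i1.add i2
  have i123 : IntegrableOn (fun y => modeProj a m F y * φ y +
    modeProj a m D₁₁ y * ((((warp K y : ℝ) : ℂ) ^ 2)⁻¹ * φ y) + modeProj a m D₂₂ y * φ y) (J₂ a) :=
      i12.add i3
  rw [integral_add i123 i4, integral_add i12 i3, integral_add i1 i2,
    integral_modeProj_mul m F mφ, integral_modeProj_mul m D₁₁ (mq mφ),
    integral_modeProj_mul m D₂₂ mφ, integral_modeProj_mul m D₂ (md mφ)]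
  have j2 : IntegrableOn (fun x => D₁₁ x * (mode (-m) x.1 *
      ((((warp K x.2 : ℝ) : ℂ) ^ 2)⁻¹ * φ x.2))) (Ω₀ a) :=
    (Lp.memLp D₁₁).integrable_fun_mul (memLp_mode_mul (-m) (mq mφ))
  have j3 : IntegrableOn (fun x => D₂₂ x * (mode (-m) x.1 * φ x.2)) (Ω₀ a) :=
    (Lp.memLp D₂₂).integrable_fun_mul (memLp_mode_mul (-m) mφ)
  have j4 : IntegrableOn (fun x => D₂ x * (mode (-m) x.1 * ((drift K x.2 : ℂ) * φ x.2))) (Ω₀ a) :=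
    (Lp.memLp D₂).integrable_fun_mul (memLp_mode_mul (-m) (md mφ))
  have e : ∫ x in Ω₀ a, F x * (mode (-m) x.1 * φ x.2) =
      ∫ x in Ω₀ a, -(D₁₁ x * (mode (-m) x.1 * ((((warp K x.2 : ℝ) : ℂ) ^ 2)⁻¹ * φ x.2)) +
        D₂₂ x * (mode (-m) x.1 * φ x.2) +
        D₂ x * (mode (-m) x.1 * ((drift K x.2 : ℂ) * φ x.2))) := by
    refine integral_congr_ae (hF.mono fun x hx => ?_)
    simp only [hx, laplaceBeltrami]
    ring
  have j23 : IntegrableOn (fun x => D₁₁ x * (mode (-m) x.1 *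
      ((((warp K x.2 : ℝ) : ℂ) ^ 2)⁻¹ * φ x.2)) + D₂₂ x * (mode (-m) x.1 * φ x.2)) (Ω₀ a) :=
    j2.add j3
  rw [e, integral_neg, integral_add j23 j4, integral_add j2 j3]
  ring

/-- Fourier projection maps the graph of the Hamiltonian to the graph of a transverse operator. -/
theorem modeProj_mem_graph {K : SignType} {a : ℝ} (ha : 0 < a) (hK : K = 1 → a < π / 2)
    {B : BC} (hB : B.Admissible) (m : ℤ) (ψ F : Lp ℂ 2 (volume.restrict (Ω₀ a)))
    (h : (ψ, F) ∈ hamiltonianGraph' hK B) :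
    (modeProj a m ψ, modeProj a m F) ∈ transverseGraph' hK B m := by
  rw [mem_hamiltonianGraph'_iff] at h
  obtain ⟨u, d₁, d₂, d₁₁, d₁₂, d₂₂, hψ, W, ⟨p, p', q, q', hp, hq, hpq⟩, ⟨t, t', s, s', ht, hs, hts⟩,
    hF⟩ := h
  have E₁ := W.h₁.memLp_deriv.coeFn_toLp
  have E₂ := W.h₂.memLp_deriv.coeFn_toLp
  have E₁₁ := W.h₁₁.memLp_deriv.coeFn_toLp
  have E₂₂ := W.h₂₂.memLp_deriv.coeFn_toLp
  set D₁ := W.h₁.memLp_deriv.toLp d₁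
  set D₂ := W.h₂.memLp_deriv.toLp d₂
  set D₁₁ := W.h₁₁.memLp_deriv.toLp d₁₁
  set D₂₂ := W.h₂₂.memLp_deriv.toLp d₂₂
  have P₁ := hp.modeProj_ae_eq (hpq.mono fun y hy => hy.1) m hψ E₁
  have P₁₁ := hq.modeProj_ae_eq (hpq.mono fun y hy => hy.2) m E₁ E₁₁
  obtain ⟨v₁, hv₁, e₁, b₁, b₁'⟩ := exists_isPrimitiveOn_of_green ha (Lp.memLp (modeProj a m D₂))
    (Lp.memLp (modeProj a m D₂₂)) fun φ hφ hc => hs.integral_modeProj m E₂ E₂₂ hφ hc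
  -- The derivative is taken to be the representative `v₁` just found, so that `v₀` and `v₁` are
  -- linked as in `TransverseData` and both have the Fourier coefficients of the traces as boundary
  -- values.
  obtain ⟨v₀, hv₀, e₀, b₀, b₀'⟩ := exists_isPrimitiveOn_of_green ha (Lp.memLp (modeProj a m ψ))
    ((Lp.memLp (modeProj a m D₂)).ae_eq e₁) fun φ hφ hc => by
      rw [← ht.integral_modeProj m hψ E₂ hφ hc]
      refine integral_congr_ae (e₁.mono fun x hx => ?_)
      simp only [hx]
  rw [mem_transverseGraph'_iff ha]
  refine ⟨v₀, v₁, modeProj a m D₂₂, e₀, hv₀, hv₁, Lp.memLp _, ?_, ?_⟩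
  · rw [b₀, b₀', b₁, b₁']
    exact hB.holds_integral_mode (-m) ht.memLp_left ht.memLp_right hts
  · have hF' : F =ᵐ[volume.restrict (Ω₀ a)] laplaceBeltrami K D₂ D₁₁ D₂₂ := by
      filter_upwards [hF, E₂, E₁₁, E₂₂] with x h1 h2 h3 h4
      rw [h1]
      simp only [laplaceBeltrami, h2, h3, h4]
    filter_upwards [modeProj_laplaceBeltrami hK m hF', P₁, P₁₁, e₀, e₁] with y h1 h2 h3 h4 h5
    rw [h1, h3, h2, transverseAction, ← h4, ← h5]
    linear_combination -((((warp K y : ℝ) : ℂ) ^ 2)⁻¹ * (m : ℂ) ^ 2 * modeProj a m ψ y) * Complex.I_sq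

/-! ### Traces of separated functions -/

theorem memLp_test_Ω₀ {a : ℝ} {φ : ℝ × ℝ → ℂ} (hφ : Continuous φ) (hc : HasCompactSupport φ) :
    MemLp φ 2 (volume.restrict (Ω₀ a)) :=
  (hφ.memLp_of_hasCompactSupport hc).restrict _

theorem hasDerivAt_slice_fst {φ : ℝ × ℝ → ℂ} (hφ : ContDiff ℝ ∞ φ) (x y : ℝ) :
    HasDerivAt (fun x => φ (x, y)) (fderiv ℝ φ (x, y) (1, 0)) x :=
  ((hφ.differentiable (by simp)).differentiableAt.hasFDerivAt).comp_hasDerivAt x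
    ((hasDerivAt_id x).prodMk (hasDerivAt_const x y))

theorem hasDerivAt_slice_snd {φ : ℝ × ℝ → ℂ} (hφ : ContDiff ℝ ∞ φ) (x y : ℝ) :
    HasDerivAt (fun y => φ (x, y)) (fderiv ℝ φ (x, y) (0, 1)) y :=
  ((hφ.differentiable (by simp)).differentiableAt.hasFDerivAt).comp_hasDerivAt y
    ((hasDerivAt_const y x).prodMk (hasDerivAt_id y))

theorem memLp_slice_fst {φ : ℝ × ℝ → ℂ} (hφ : Continuous φ) (hc : HasCompactSupport φ) (y : ℝ) :
    MemLp (fun x => φ (x, y)) 2 (volume.restrict J₁) := by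
  obtain ⟨C, hC⟩ := hc.exists_bound_of_continuous hφ
  exact MemLp.of_bound (hφ.comp (by fun_prop : Continuous fun x : ℝ => (x, y))).aestronglyMeasurable
    C (Filter.Eventually.of_forall fun x => hC _)

theorem memLp_slice_snd {a : ℝ} {φ : ℝ × ℝ → ℂ} (hφ : Continuous φ) (hc : HasCompactSupport φ)
    (x : ℝ) : MemLp (fun y => φ (x, y)) 2 (volume.restrict (J₂ a)) := by
  obtain ⟨C, hC⟩ := hc.exists_bound_of_continuous hφ
  exact MemLp.of_bound (hφ.comp (by fun_prop : Continuous fun y : ℝ => (x, y))).aestronglyMeasurable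
    C (Filter.Eventually.of_forall fun x => hC _)

/-- Fubini and the fundamental theorem of calculus in `x₁`; no regularity of `u` is needed. Both
traces carry the factor `mode m π`, which makes periodicity hold by definition. -/
theorem HasTraces₁.mode {a : ℝ} (m : ℤ) {u : ℝ → ℂ} (hu : MemLp u 2 (volume.restrict (J₂ a))) :
    HasTraces₁ a (fun x => mode m x.1 * u x.2) (fun x => mode m x.1 * (Complex.I * m * u x.2))
      (fun y => PTStrip.mode m π * u y) (fun y => PTStrip.mode m π * u y) := by
  refine ⟨hu.const_mul _, hu.const_mul _, fun φ hφ hc => ?_⟩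
  obtain ⟨h1, h2⟩ := test_fderiv hφ hc (1, 0)
  have hi : Integrable (fun x : ℝ × ℝ => PTStrip.mode m x.1 * u x.2 * fderiv ℝ φ x (1, 0) +
      PTStrip.mode m x.1 * (Complex.I * m * u x.2) * φ x)
      ((volume.restrict J₁).prod (volume.restrict (J₂ a))) := by
    rw [← restrict_Ω₀]
    exact ((memLp_mode_mul m hu).integrable_fun_mul (memLp_test_Ω₀ h1 h2)).add
      ((memLp_mode_mul m (hu.const_mul _)).integrable_fun_mul (memLp_test_Ω₀ hφ.continuous hc))
  rw [integral_Ω₀, integral_prod_symm _ hi]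
  congr 1
  funext y
  have hd : ∀ x, HasDerivAt (fun x => PTStrip.mode m x * φ (x, y))
      (Complex.I * m * PTStrip.mode m x * φ (x, y) +
        PTStrip.mode m x * fderiv ℝ φ (x, y) (1, 0)) x := fun x =>
    (hasDerivAt_mode m x).mul (hasDerivAt_slice_fst hφ x y)
  have hcont : Continuous fun x => Complex.I * m * PTStrip.mode m x * φ (x, y) +
      PTStrip.mode m x * fderiv ℝ φ (x, y) (1, 0) :=
    ((continuous_const.mul (continuous_mode m)).mul (hφ.continuous.comp (by fun_prop))).add
      ((continuous_mode m).mul (h1.comp (by fun_prop : Continuous fun x : ℝ => (x, y))))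
  have key := intervalIntegral.integral_eq_sub_of_hasDerivAt (a := -π) (b := π)
    (fun x _ => hd x) (hcont.intervalIntegrable _ _)
  rw [intervalIntegral.integral_of_le (by linarith [Real.pi_pos]), integral_Ioc_eq_integral_Ioo,
    ← mode_pi] at key
  calc _ = u y * ∫ x in J₁, (Complex.I * m * PTStrip.mode m x * φ (x, y) +
        PTStrip.mode m x * fderiv ℝ φ (x, y) (1, 0)) := by
        rw [← integral_const_mul]; congr 1; funext x; ring
    _ = _ := by rw [J₁, key]; ring

theorem IsPrimitiveOn.const_mul {a : ℝ} {u g : ℝ → ℂ} (hu : IsPrimitiveOn a u g) (c : ℂ) :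
    IsPrimitiveOn a (fun x => c * u x) (fun x => c * g x) := by
  refine ⟨hu.intervalIntegrable.const_mul c, fun x hx => ?_⟩
  rw [intervalIntegral.integral_const_mul, hu.eq x hx, mul_add]

theorem HasTraces₂.mode {a : ℝ} (ha : 0 < a) (m : ℤ) {u g : ℝ → ℂ} (hu : IsPrimitiveOn a u g)
    (hg : MemLp g 2 (volume.restrict (J₂ a))) :
    HasTraces₂ a (fun x => mode m x.1 * u x.2) (fun x => mode m x.1 * g x.2)
      (fun x => u (-a) * PTStrip.mode m x) (fun x => u a * PTStrip.mode m x) := by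
  refine ⟨(memLp_mode m).const_mul _, (memLp_mode m).const_mul _, fun φ hφ hc => ?_⟩
  obtain ⟨h1, h2⟩ := test_fderiv hφ hc (0, 1)
  have hi : Integrable (fun x : ℝ × ℝ => PTStrip.mode m x.1 * u x.2 * fderiv ℝ φ x (0, 1) +
      PTStrip.mode m x.1 * g x.2 * φ x)
      ((volume.restrict J₁).prod (volume.restrict (J₂ a))) := by
    rw [← restrict_Ω₀]
    exact ((memLp_mode_mul m (hu.memLp ha)).integrable_fun_mul (memLp_test_Ω₀ h1 h2)).add
      ((memLp_mode_mul m hg).integrable_fun_mul (memLp_test_Ω₀ hφ.continuous hc))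
  rw [integral_Ω₀, integral_prod _ hi]
  congr 1
  funext x
  have hs : ContDiff ℝ ∞ fun y => φ (x, y) := hφ.comp (by fun_prop)
  have key := hu.green ha hs
  simp only [fderiv_apply_one_eq_deriv, (hasDerivAt_slice_snd hφ x _).deriv] at key
  calc _ = PTStrip.mode m x * ∫ y in J₂ a, (u y * fderiv ℝ φ (x, y) (0, 1) + g y * φ (x, y)) := by
        rw [← integral_const_mul]; congr 1; funext y; ring
    _ = _ := by rw [key]; ring

/-- Test functions supported in the open rectangle kill the boundary terms, so the trace formula
contains the weak derivative. -/
theorem HasTraces₁.hasWeakDeriv {a : ℝ} {u g : ℝ × ℝ → ℂ} {t t' : ℝ → ℂ}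
    (h : HasTraces₁ a u g t t') (hu : MemLp u 2 (volume.restrict (Ω₀ a)))
    (hg : MemLp g 2 (volume.restrict (Ω₀ a))) : HasWeakDeriv (Ω₀ a) (1, 0) u g := by
  refine ⟨hu, hg, fun φ hφ hc hs => ?_⟩
  obtain ⟨h1, h2⟩ := test_fderiv hφ hc (1, 0)
  have key := h.green φ hφ hc
  have h0 : ∀ x, x ∉ Ω₀ a → φ x = 0 := fun x hx =>
    image_eq_zero_of_notMem_tsupport fun h => hx (hs h)
  have e : ∀ y, t' y * φ (π, y) - t y * φ (-π, y) = 0 := fun y => by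
    rw [h0 (π, y) (by simp [Ω₀, J₁]), h0 (-π, y) (by simp [Ω₀, J₁])]; ring
  simp only [e, integral_zero] at key
  rw [integral_add (integrableOn_mul_test hu h1 h2)
    (integrableOn_mul_test hg hφ.continuous hc)] at key
  linear_combination key

theorem HasTraces₂.hasWeakDeriv {a : ℝ} {u g : ℝ × ℝ → ℂ} {t t' : ℝ → ℂ}
    (h : HasTraces₂ a u g t t') (hu : MemLp u 2 (volume.restrict (Ω₀ a)))
    (hg : MemLp g 2 (volume.restrict (Ω₀ a))) : HasWeakDeriv (Ω₀ a) (0, 1) u g := by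
  refine ⟨hu, hg, fun φ hφ hc hs => ?_⟩
  obtain ⟨h1, h2⟩ := test_fderiv hφ hc (0, 1)
  have key := h.green φ hφ hc
  have h0 : ∀ x, x ∉ Ω₀ a → φ x = 0 := fun x hx =>
    image_eq_zero_of_notMem_tsupport fun h => hx (hs h)
  have e : ∀ x, t' x * φ (x, a) - t x * φ (x, -a) = 0 := fun x => by
    rw [h0 (x, a) (by simp [Ω₀, J₂]), h0 (x, -a) (by simp [Ω₀, J₂])]; ring
  simp only [e, integral_zero] at key
  rw [integral_add (integrableOn_mul_test hu h1 h2)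
    (integrableOn_mul_test hg hφ.continuous hc)] at key
  linear_combination key

/-! ### Stability under almost everywhere equality and under sums -/

theorem HasWeakDeriv.congr_ae {a : ℝ} {v : ℝ × ℝ} {u g u' g' : ℝ × ℝ → ℂ}
    (h : HasWeakDeriv (Ω₀ a) v u g) (hu : u' =ᵐ[volume.restrict (Ω₀ a)] u)
    (hg : g' =ᵐ[volume.restrict (Ω₀ a)] g) : HasWeakDeriv (Ω₀ a) v u' g' := by
  refine ⟨h.memLp.ae_eq hu.symm, h.memLp_deriv.ae_eq hg.symm, fun φ hφ hc hs => ?_⟩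
  have h1 : ∫ x in Ω₀ a, u' x * fderiv ℝ φ x v = ∫ x in Ω₀ a, u x * fderiv ℝ φ x v :=
    integral_congr_ae (hu.mono fun x hx => by simp only [hx])
  have h2 : ∫ x in Ω₀ a, g' x * φ x = ∫ x in Ω₀ a, g x * φ x :=
    integral_congr_ae (hg.mono fun x hx => by simp only [hx])
  rw [h1, h2]
  exact h.integral_eq φ hφ hc hs

theorem HasTraces₁.congr_ae {a : ℝ} {u g u' g' : ℝ × ℝ → ℂ} {t s t' s' : ℝ → ℂ}
    (h : HasTraces₁ a u g t s) (hu : u' =ᵐ[volume.restrict (Ω₀ a)] u)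
    (hg : g' =ᵐ[volume.restrict (Ω₀ a)] g) (ht : t' =ᵐ[volume.restrict (J₂ a)] t)
    (hs : s' =ᵐ[volume.restrict (J₂ a)] s) : HasTraces₁ a u' g' t' s' := by
  refine ⟨h.memLp_left.ae_eq ht.symm, h.memLp_right.ae_eq hs.symm, fun φ hφ hc => ?_⟩
  have h1 : ∫ x in Ω₀ a, (u' x * fderiv ℝ φ x (1, 0) + g' x * φ x) =
      ∫ x in Ω₀ a, (u x * fderiv ℝ φ x (1, 0) + g x * φ x) :=
    integral_congr_ae (by filter_upwards [hu, hg] with x e1 e2; simp only [e1, e2])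
  have h2 : ∫ y in J₂ a, (s' y * φ (π, y) - t' y * φ (-π, y)) =
      ∫ y in J₂ a, (s y * φ (π, y) - t y * φ (-π, y)) :=
    integral_congr_ae (by filter_upwards [ht, hs] with x e1 e2; simp only [e1, e2])
  rw [h1, h2]
  exact h.green φ hφ hc

theorem HasTraces₂.congr_ae {a : ℝ} {u g u' g' : ℝ × ℝ → ℂ} {t s t' s' : ℝ → ℂ}
    (h : HasTraces₂ a u g t s) (hu : u' =ᵐ[volume.restrict (Ω₀ a)] u)
    (hg : g' =ᵐ[volume.restrict (Ω₀ a)] g) (ht : t' =ᵐ[volume.restrict J₁] t)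
    (hs : s' =ᵐ[volume.restrict J₁] s) : HasTraces₂ a u' g' t' s' := by
  refine ⟨h.memLp_left.ae_eq ht.symm, h.memLp_right.ae_eq hs.symm, fun φ hφ hc => ?_⟩
  have h1 : ∫ x in Ω₀ a, (u' x * fderiv ℝ φ x (0, 1) + g' x * φ x) =
      ∫ x in Ω₀ a, (u x * fderiv ℝ φ x (0, 1) + g x * φ x) :=
    integral_congr_ae (by filter_upwards [hu, hg] with x e1 e2; simp only [e1, e2])
  have h2 : ∫ x in J₁, (s' x * φ (x, a) - t' x * φ (x, -a)) =
      ∫ x in J₁, (s x * φ (x, a) - t x * φ (x, -a)) :=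
    integral_congr_ae (by filter_upwards [ht, hs] with x e1 e2; simp only [e1, e2])
  rw [h1, h2]
  exact h.green φ hφ hc

/-- Integration against `w` is the inner product with `conj w`, a continuous functional. Weak
derivatives and traces are defined by such integrals, hence they are closed under `L²`-convergent
sums. -/
theorem _root_.HasSum.integral_mul_memLp {α ι : Type*} [MeasurableSpace α] {μ : Measure α}
    {f : ι → Lp ℂ 2 μ} {F : Lp ℂ 2 μ} (h : HasSum f F) {w : α → ℂ} (hw : MemLp w 2 μ) :
    HasSum (fun i => ∫ x, f i x * w x ∂μ) (∫ x, F x * w x ∂μ) := by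
  have hs : MemLp (fun x => starRingEnd ℂ (w x)) 2 μ := hw.star
  have e : ∀ g : Lp ℂ 2 μ, ∫ x, g x * w x ∂μ = innerSL ℂ (hs.toLp _) g := fun g => by
    rw [innerSL_apply_apply, L2.inner_def]
    refine integral_congr_ae (hs.coeFn_toLp.mono fun x hx => ?_)
    simp only [hx, RCLike.inner_apply, Complex.conj_conj]
  simp only [e]
  exact h.mapL _

theorem HasWeakDeriv.hasSum {a : ℝ} {v : ℝ × ℝ} {ι : Type*}
    {U G : ι → Lp ℂ 2 (volume.restrict (Ω₀ a))} {u g : Lp ℂ 2 (volume.restrict (Ω₀ a))}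
    (h : ∀ i, HasWeakDeriv (Ω₀ a) v (U i) (G i)) (hu : HasSum U u) (hg : HasSum G g) :
    HasWeakDeriv (Ω₀ a) v u g := by
  refine ⟨Lp.memLp u, Lp.memLp g, fun φ hφ hc hs => ?_⟩
  obtain ⟨h1, h2⟩ := test_fderiv hφ hc v
  have k1 := hu.integral_mul_memLp (memLp_test_Ω₀ h1 h2)
  have k2 := (hg.integral_mul_memLp (memLp_test_Ω₀ hφ.continuous hc)).neg
  refine k1.unique (k2.congr_fun fun i => ?_)
  exact (h i).integral_eq φ hφ hc hs

theorem HasTraces₁.hasSum {a : ℝ} {ι : Type*}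
    {U G : ι → Lp ℂ 2 (volume.restrict (Ω₀ a))} {u g : Lp ℂ 2 (volume.restrict (Ω₀ a))}
    {T S : ι → Lp ℂ 2 (volume.restrict (J₂ a))} {t s : Lp ℂ 2 (volume.restrict (J₂ a))}
    (h : ∀ i, HasTraces₁ a (U i) (G i) (T i) (S i)) (hu : HasSum U u) (hg : HasSum G g)
    (ht : HasSum T t) (hs : HasSum S s) : HasTraces₁ a u g t s := by
  refine ⟨Lp.memLp t, Lp.memLp s, fun φ hφ hc => ?_⟩
  obtain ⟨h1, h2⟩ := test_fderiv hφ hc (1, 0)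
  have m1 := memLp_test_Ω₀ (a := a) h1 h2
  have m2 := memLp_test_Ω₀ (a := a) hφ.continuous hc
  have m3 := memLp_slice_snd (a := a) hφ.continuous hc π
  have m4 := memLp_slice_snd (a := a) hφ.continuous hc (-π)
  have k1 := (hu.integral_mul_memLp m1).add (hg.integral_mul_memLp m2)
  have k2 := (hs.integral_mul_memLp m3).sub (ht.integral_mul_memLp m4)
  rw [integral_add ((Lp.memLp u).integrable_fun_mul m1) ((Lp.memLp g).integrable_fun_mul m2),
    integral_sub ((Lp.memLp s).integrable_fun_mul m3) ((Lp.memLp t).integrable_fun_mul m4)]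
  refine k1.unique (k2.congr_fun fun i => ?_)
  rw [← integral_add ((Lp.memLp _).integrable_fun_mul m1) ((Lp.memLp _).integrable_fun_mul m2),
    ← integral_sub ((Lp.memLp _).integrable_fun_mul m3) ((Lp.memLp _).integrable_fun_mul m4)]
  exact (h i).green φ hφ hc

theorem HasTraces₂.hasSum {a : ℝ} {ι : Type*}
    {U G : ι → Lp ℂ 2 (volume.restrict (Ω₀ a))} {u g : Lp ℂ 2 (volume.restrict (Ω₀ a))}
    {T S : ι → Lp ℂ 2 (volume.restrict J₁)} {t s : Lp ℂ 2 (volume.restrict J₁)}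
    (h : ∀ i, HasTraces₂ a (U i) (G i) (T i) (S i)) (hu : HasSum U u) (hg : HasSum G g)
    (ht : HasSum T t) (hs : HasSum S s) : HasTraces₂ a u g t s := by
  refine ⟨Lp.memLp t, Lp.memLp s, fun φ hφ hc => ?_⟩
  obtain ⟨h1, h2⟩ := test_fderiv hφ hc (0, 1)
  have m1 := memLp_test_Ω₀ (a := a) h1 h2
  have m2 := memLp_test_Ω₀ (a := a) hφ.continuous hc
  have m3 := memLp_slice_fst hφ.continuous hc a
  have m4 := memLp_slice_fst hφ.continuous hc (-a)
  have k1 := (hu.integral_mul_memLp m1).add (hg.integral_mul_memLp m2)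
  have k2 := (hs.integral_mul_memLp m3).sub (ht.integral_mul_memLp m4)
  rw [integral_add ((Lp.memLp u).integrable_fun_mul m1) ((Lp.memLp g).integrable_fun_mul m2),
    integral_sub ((Lp.memLp s).integrable_fun_mul m3) ((Lp.memLp t).integrable_fun_mul m4)]
  refine k1.unique (k2.congr_fun fun i => ?_)
  rw [← integral_add ((Lp.memLp _).integrable_fun_mul m1) ((Lp.memLp _).integrable_fun_mul m2),
    ← integral_sub ((Lp.memLp _).integrable_fun_mul m3) ((Lp.memLp _).integrable_fun_mul m4)]
  exact (h i).green φ hφ hc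

/-! ### Separated functions in the domain of the Hamiltonian -/

theorem TransverseData.isW22_mode {K : SignType} {a : ℝ} (ha : 0 < a) {B : BC} {m : ℤ}
    {ψ F : Lp ℂ 2 (volume.restrict (J₂ a))} {u₀ u₁ u₂ : ℝ → ℂ}
    (h : TransverseData K a B m ψ F u₀ u₁ u₂) :
    IsW22 a (fun x => mode m x.1 * u₀ x.2) (fun x => mode m x.1 * (Complex.I * m * u₀ x.2))
      (fun x => mode m x.1 * u₁ x.2)
      (fun x => mode m x.1 * (Complex.I * m * (Complex.I * m * u₀ x.2)))
      (fun x => mode m x.1 * (Complex.I * m * u₁ x.2)) (fun x => mode m x.1 * u₂ x.2) := by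
  have m₀ := h.primitive₀.memLp ha
  have m₁ := h.primitive₁.memLp ha
  have m₂ := h.memLp₂
  have p₀ := h.primitive₀.const_mul (Complex.I * m)
  exact ⟨(HasTraces₁.mode m m₀).hasWeakDeriv (memLp_mode_mul m m₀) (memLp_mode_mul m (m₀.const_mul _)),
    (HasTraces₂.mode ha m h.primitive₀ m₁).hasWeakDeriv (memLp_mode_mul m m₀) (memLp_mode_mul m m₁),
    (HasTraces₁.mode m (m₀.const_mul _)).hasWeakDeriv (memLp_mode_mul m (m₀.const_mul _))
      (memLp_mode_mul m ((m₀.const_mul _).const_mul _)),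
    (HasTraces₁.mode m m₁).hasWeakDeriv (memLp_mode_mul m m₁) (memLp_mode_mul m (m₁.const_mul _)),
    (HasTraces₂.mode ha m p₀ (m₁.const_mul _)).hasWeakDeriv (memLp_mode_mul m (m₀.const_mul _))
      (memLp_mode_mul m (m₁.const_mul _)),
    (HasTraces₂.mode ha m h.primitive₁ m₂).hasWeakDeriv (memLp_mode_mul m m₁) (memLp_mode_mul m m₂)⟩

theorem BC.Holds.mul_right {B : BC} {u d u' d' : ℂ} (h : B.Holds u d u' d') (c : ℂ) :
    B.Holds (u * c) (d * c) (u' * c) (d' * c) := by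
  have := h.comb c (BC.Holds.zero B)
  simpa [mul_comm] using this

/-- Separated functions map the graph of a transverse operator to the graph of the Hamiltonian. -/
theorem modeEmb_mem_graph {K : SignType} {a : ℝ} (ha : 0 < a) (hK : K = 1 → a < π / 2)
    {B : BC} (m : ℤ) (ψ F : Lp ℂ 2 (volume.restrict (J₂ a)))
    (h : (ψ, F) ∈ transverseGraph' hK B m) :
    (modeEmb a m ψ, modeEmb a m F) ∈ hamiltonianGraph' hK B := by
  rw [mem_transverseGraph'_iff ha] at h
  obtain ⟨u₀, u₁, u₂, h⟩ := h
  rw [mem_hamiltonianGraph'_iff]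
  have m₀ := h.primitive₀.memLp ha
  refine ⟨_, _, _, _, _, _, ?_, h.isW22_mode ha, ⟨_, _, _, _, HasTraces₁.mode m m₀,
    HasTraces₁.mode m (m₀.const_mul _), Filter.Eventually.of_forall fun _ => ⟨rfl, rfl⟩⟩,
    ⟨_, _, _, _, HasTraces₂.mode ha m h.primitive₀ (h.primitive₁.memLp ha),
    HasTraces₂.mode ha m h.primitive₁ h.memLp₂, Filter.Eventually.of_forall fun x =>
      h.bc.mul_right _⟩, ?_⟩
  · filter_upwards [modeEmb_ae_eq m ψ, ae_restrict_Ω₀_snd h.ae_eq] with x h1 h2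
    rw [h1, h2]
  · filter_upwards [modeEmb_ae_eq m F, ae_restrict_Ω₀_snd h.image_ae_eq] with x h1 h2
    rw [h1, h2]
    simp only [laplaceBeltrami, transverseAction]
    linear_combination (((warp K x.2 : ℝ) : ℂ) ^ 2)⁻¹ * (m : ℂ) ^ 2 * u₀ x.2 * mode m x.1 *
      Complex.I_sq

theorem transverseGraph'_single_valued {K : SignType} {a : ℝ} (hK : K = 1 → a < π / 2) {B : BC}
    {m : ℤ} {ψ F F' : Lp ℂ 2 (volume.restrict (J₂ a))} (h : (ψ, F) ∈ transverseGraph' hK B m)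
    (h' : (ψ, F') ∈ transverseGraph' hK B m) : F = F' := by
  have := Submodule.sub_mem _ h h'
  rw [Prod.mk_sub_mk, sub_self] at this
  have h0 := transverseGraph_single_valued hK B m _ (Submodule.mem_comap.1 this) (by simp)
  simp only [LinearMap.prodMap_apply] at h0
  exact sub_eq_zero.1 ((equivJ hK).symm.map_eq_zero_iff.1 h0)

/-! ### Summability -/

/-- The modes are orthogonal, so square summability of the norms suffices. -/
theorem summable_modeEmb {a : ℝ} (F : Lp ℂ 2 (volume.restrict (Ω₀ a))) {C : ℝ}
    {v : ℤ → Lp ℂ 2 (volume.restrict (J₂ a))} (hv : ∀ m, ‖v m‖ ≤ C * ‖modeProj a m F‖) :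
    Summable fun m => modeEmb a m (v m) := by
  rw [(orthogonalFamily_modeEmb a).summable_iff_norm_sq_summable]
  refine Summable.of_nonneg_of_le (fun m => by positivity) (fun m => ?_)
    ((summable_norm_sq_modeProj F).mul_left (C ^ 2))
  rw [← mul_pow]
  exact pow_le_pow_left₀ (norm_nonneg _) (hv m) 2

/-- For traces on `x₁ = ±π`: the modes are evaluated at a point and orthogonality is lost, so
absolute convergence is needed. The extra weight gives `‖v m‖ ≤ C (1 / |m|) ‖modeProj a m F‖` for `m
≠ 0`, a product of two square summable sequences. -/
theorem summable_of_weighted_bound {a : ℝ} (F : Lp ℂ 2 (volume.restrict (Ω₀ a))) {C : ℝ}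
    (hC : 0 ≤ C) {v : ℤ → Lp ℂ 2 (volume.restrict (J₂ a))}
    (hv : ∀ m : ℤ, (1 + |(m : ℝ)|) * ‖v m‖ ≤ C * ‖modeProj a m F‖) : Summable v := by
  have h1 : Summable fun m : ℤ => 1 / (m : ℝ) ^ 2 := Real.summable_one_div_int_pow.2 one_lt_two
  refine Summable.of_norm_bounded_eventually ((h1.add (summable_norm_sq_modeProj F)).mul_left C) ?_
  have h0 : ∀ᶠ m : ℤ in Filter.cofinite, m ≠ 0 :=
    (Set.finite_singleton (0 : ℤ)).compl_mem_cofinite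
  filter_upwards [h0] with m hm
  have hm' : 0 < |(m : ℝ)| := by simpa using hm
  have hN : 0 ≤ ‖modeProj a m F‖ := norm_nonneg _
  have h2 : ‖v m‖ ≤ C * (1 / |(m : ℝ)| * ‖modeProj a m F‖) := by
    have := (hv m)
    have h3 : |(m : ℝ)| * ‖v m‖ ≤ C * ‖modeProj a m F‖ := by
      have := norm_nonneg (v m)
      linarith
    rw [mul_comm, ← le_div_iff₀ hm'] at h3
    refine h3.trans (le_of_eq ?_)
    ring
  refine h2.trans (mul_le_mul_of_nonneg_left ?_ hC)
  have h4 : 1 / (m : ℝ) ^ 2 = (1 / |(m : ℝ)|) ^ 2 := by rw [div_pow, sq_abs, one_pow]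
  rw [h4]
  nlinarith [sq_nonneg (1 / |(m : ℝ)| - ‖modeProj a m F‖), sq_nonneg (1 / |(m : ℝ)|),
    sq_nonneg ‖modeProj a m F‖]

/-- The Fourier modes as elements of `L²(J₁)`. -/
def modeLp (m : ℤ) : Lp ℂ 2 (volume.restrict J₁) := (memLp_mode m).toLp _

theorem modeLp_ae_eq (m : ℤ) : modeLp m =ᵐ[volume.restrict J₁] mode m := (memLp_mode m).coeFn_toLp

theorem orthonormal_modeLp : Orthonormal ℂ modeLp := by
  rw [orthonormal_iff_ite]
  intro m n
  rw [L2.inner_def, ← integral_mode_mul]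
  refine integral_congr_ae ?_
  filter_upwards [modeLp_ae_eq m, modeLp_ae_eq n] with x h1 h2
  rw [h1, h2, RCLike.inner_apply, conj_mode]
  ring

/-- For traces on `x₂ = ±a`: these are Fourier series in `x₁`, so orthonormality makes unweighted
bounds enough. -/
theorem summable_smul_modeLp {a : ℝ} (F : Lp ℂ 2 (volume.restrict (Ω₀ a))) {C : ℝ}
    {c : ℤ → ℂ} (hv : ∀ m, ‖c m‖ ≤ C * ‖modeProj a m F‖) :
    Summable fun m => c m • modeLp m := by
  have h : Summable fun m => ‖c m‖ ^ 2 := by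
    refine Summable.of_nonneg_of_le (fun m => by positivity) (fun m => ?_)
      ((summable_norm_sq_modeProj F).mul_left (C ^ 2))
    rw [← mul_pow]
    exact pow_le_pow_left₀ (norm_nonneg _) (hv m) 2
  have := (orthonormal_modeLp.orthogonalFamily.summable_iff_norm_sq_summable c).2 h
  simpa using this

theorem memLp_mul_snd {a C : ℝ} {q : ℝ → ℂ} {u : ℝ × ℝ → ℂ} (hq : ∀ x ∈ J₂ a, ‖q x‖ ≤ C)
    (hm : Measurable q) (hu : MemLp u 2 (volume.restrict (Ω₀ a))) :
    MemLp (fun x => q x.2 * u x) 2 (volume.restrict (Ω₀ a)) := by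
  refine hu.of_le_mul (c := C) ((hm.comp measurable_snd).aestronglyMeasurable.mul hu.1) ?_
  filter_upwards [ae_restrict_Ω₀_mem a] with x hx
  rw [norm_mul]
  gcongr
  exact hq _ hx.2

theorem memLp_laplaceBeltrami {K : SignType} {a : ℝ} (hK : K = 1 → a < π / 2)
    {d₂ d₁₁ d₂₂ : ℝ × ℝ → ℂ} (h₂ : MemLp d₂ 2 (volume.restrict (Ω₀ a)))
    (h₁₁ : MemLp d₁₁ 2 (volume.restrict (Ω₀ a))) (h₂₂ : MemLp d₂₂ 2 (volume.restrict (Ω₀ a))) :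
    MemLp (laplaceBeltrami K d₂ d₁₁ d₂₂) 2 (volume.restrict (Ω₀ a)) := by
  obtain ⟨Q, hq⟩ := norm_warp_inv_sq_bound hK
  obtain ⟨D, hd⟩ := norm_drift_bound hK
  have h := ((memLp_mul_snd hq (measurable_warp_inv_sq K) h₁₁).neg.sub h₂₂).sub
    (memLp_mul_snd hd (measurable_drift_complex K) h₂)
  refine h.ae_eq (Filter.Eventually.of_forall fun x => ?_)
  simp [laplaceBeltrami]

/-! ### Synthesis -/

theorem modeEmb_ae_eq_of_ae_eq {a : ℝ} (m : ℤ) {f : Lp ℂ 2 (volume.restrict (J₂ a))} {u : ℝ → ℂ}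
    (h : f =ᵐ[volume.restrict (J₂ a)] u) :
    modeEmb a m f =ᵐ[volume.restrict (Ω₀ a)] fun x => mode m x.1 * u x.2 := by
  filter_upwards [modeEmb_ae_eq m f, ae_restrict_Ω₀_snd h] with x h1 h2
  rw [h1, h2]

theorem smul_ae_eq_of_ae_eq {α : Type*} [MeasurableSpace α] {μ : Measure α} (c : ℂ) {f : Lp ℂ 2 μ}
    {u : α → ℂ} (h : f =ᵐ[μ] u) : ⇑(c • f) =ᵐ[μ] fun x => c * u x := by
  filter_upwards [Lp.coeFn_smul c f, h] with x h1 h2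
  rw [h1, Pi.smul_apply, h2, smul_eq_mul]

/-- A sum of separated functions whose components satisfy the resolvent bounds lies in the domain
of the Hamiltonian. -/
theorem exists_mem_hamiltonianGraph' {K : SignType} {a : ℝ} (ha : 0 < a) (hK : K = 1 → a < π / 2)
    {B : BC} (hB : B.Admissible) (F : Lp ℂ 2 (volume.restrict (Ω₀ a))) {C : ℝ} (hC : 0 ≤ C)
    {f g : ℤ → Lp ℂ 2 (volume.restrict (J₂ a))} {u₀ u₁ u₂ : ℤ → ℝ → ℂ}
    (hd : ∀ m, TransverseData K a B m (f m) (g m) (u₀ m) (u₁ m) (u₂ m))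
    (b₀ : ∀ m : ℤ, (1 + (m : ℝ) ^ 2) * l2 a (u₀ m) ≤ C * ‖modeProj a m F‖)
    (b₁ : ∀ m : ℤ, (1 + |(m : ℝ)|) * l2 a (u₁ m) ≤ C * ‖modeProj a m F‖)
    (b₂ : ∀ m : ℤ, l2 a (u₂ m) ≤ C * ‖modeProj a m F‖)
    (bv : ∀ m : ℤ, ∀ y ∈ Icc (-a) a, ‖u₀ m y‖ ≤ C * ‖modeProj a m F‖)
    {ψ : Lp ℂ 2 (volume.restrict (Ω₀ a))} (hψ : HasSum (fun m => modeEmb a m (f m)) ψ) :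
    ∃ F', (ψ, F') ∈ hamiltonianGraph' hK B := by
  have m₁ : ∀ m, MemLp (u₁ m) 2 (volume.restrict (J₂ a)) := fun m => (hd m).primitive₁.memLp ha
  have m₂ : ∀ m, MemLp (u₂ m) 2 (volume.restrict (J₂ a)) := fun m => (hd m).memLp₂
  let v₁ : ℤ → Lp ℂ 2 (volume.restrict (J₂ a)) := fun m => (m₁ m).toLp _
  let v₂ : ℤ → Lp ℂ 2 (volume.restrict (J₂ a)) := fun m => (m₂ m).toLp _
  have e₀ : ∀ m, f m =ᵐ[volume.restrict (J₂ a)] u₀ m := fun m => (hd m).ae_eq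
  have e₁ : ∀ m, v₁ m =ᵐ[volume.restrict (J₂ a)] u₁ m := fun m => (m₁ m).coeFn_toLp
  have e₂ : ∀ m, v₂ m =ᵐ[volume.restrict (J₂ a)] u₂ m := fun m => (m₂ m).coeFn_toLp
  let c : ℤ → ℂ := fun m => Complex.I * m
  have hc : ∀ m : ℤ, ‖c m‖ = |(m : ℝ)| := fun m => by simp [c]
  have n₀ : ∀ m, ‖f m‖ = l2 a (u₀ m) := fun m => by rw [norm_eq_l2, l2_congr (e₀ m)]
  have n₁ : ∀ m, ‖v₁ m‖ = l2 a (u₁ m) := fun m => norm_toLp_eq_l2 _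
  have n₂ : ∀ m, ‖v₂ m‖ = l2 a (u₂ m) := fun m => norm_toLp_eq_l2 _
  have abs_le : ∀ m : ℤ, |(m : ℝ)| ≤ 1 + (m : ℝ) ^ 2 := fun m => by
    nlinarith [sq_nonneg (|(m : ℝ)| - 1), sq_abs (m : ℝ), abs_nonneg (m : ℝ)]
  have weighted : ∀ m : ℤ, (1 + |(m : ℝ)|) * (|(m : ℝ)| * l2 a (u₀ m)) ≤
      2 * C * ‖modeProj a m F‖ := fun m => by
    have h := b₀ m
    have hl := l2_nonneg a (u₀ m)
    have : (1 + |(m : ℝ)|) * |(m : ℝ)| ≤ 2 * (1 + (m : ℝ) ^ 2) := by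
      nlinarith [abs_le m, sq_abs (m : ℝ), sq_nonneg (m : ℝ)]
    nlinarith [mul_le_mul_of_nonneg_right this hl]
  have weighted₀ : ∀ m : ℤ, (1 + |(m : ℝ)|) * l2 a (u₀ m) ≤ 2 * C * ‖modeProj a m F‖ := fun m => by
    have h := b₀ m
    have hl := l2_nonneg a (u₀ m)
    have : 1 + |(m : ℝ)| ≤ 2 * (1 + (m : ℝ) ^ 2) := by nlinarith [abs_le m, sq_nonneg (m : ℝ)]
    nlinarith [mul_le_mul_of_nonneg_right this hl]
  -- the sums of the derivatives
  obtain ⟨d₁, h₁⟩ : Summable fun m => modeEmb a m (c m • f m) :=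
    summable_modeEmb F (C := C) fun m => by
      rw [norm_smul, hc, n₀]
      exact (mul_le_mul_of_nonneg_right (abs_le m) (l2_nonneg _ _)).trans (b₀ m)
  obtain ⟨d₂, h₂⟩ : Summable fun m => modeEmb a m (v₁ m) :=
    summable_modeEmb F (C := C) fun m => by
      rw [n₁]
      exact (le_mul_of_one_le_left (l2_nonneg _ _) (by simp)).trans (b₁ m)
  obtain ⟨d₁₁, h₁₁⟩ : Summable fun m => modeEmb a m (c m • c m • f m) :=
    summable_modeEmb F (C := C) fun m => by
      rw [norm_smul, norm_smul, hc, n₀, ← mul_assoc, abs_mul_abs_self]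
      exact (mul_le_mul_of_nonneg_right (by nlinarith) (l2_nonneg _ _)).trans (b₀ m)
  obtain ⟨d₁₂, h₁₂⟩ : Summable fun m => modeEmb a m (c m • v₁ m) :=
    summable_modeEmb F (C := C) fun m => by
      rw [norm_smul, hc, n₁]
      exact (mul_le_mul_of_nonneg_right (by linarith) (l2_nonneg _ _)).trans (b₁ m)
  obtain ⟨d₂₂, h₂₂⟩ : Summable fun m => modeEmb a m (v₂ m) :=
    summable_modeEmb F (C := C) fun m => by rw [n₂]; exact b₂ m
  -- the sums of the traces
  have hmode : ∀ m, ‖mode m π‖ ≤ 1 := fun m => by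
    rw [norm_mode]
    refine inv_le_one_of_one_le₀ (Real.one_le_sqrt.2 ?_)
    linarith [Real.pi_gt_three]
  obtain ⟨t, ht⟩ : Summable fun m => mode m π • f m :=
    summable_of_weighted_bound F (C := 2 * C) (by positivity) fun m => by
      rw [norm_smul, n₀]
      refine le_trans ?_ (weighted₀ m)
      gcongr
      exact mul_le_of_le_one_left (l2_nonneg _ _) (hmode m)
  obtain ⟨s, hs⟩ : Summable fun m => mode m π • c m • f m :=
    summable_of_weighted_bound F (C := 2 * C) (by positivity) fun m => by
      rw [norm_smul, norm_smul, hc, n₀]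
      exact (mul_le_mul_of_nonneg_left (mul_le_of_le_one_left
        (mul_nonneg (abs_nonneg _) (l2_nonneg _ _)) (hmode m)) (by positivity)).trans (weighted m)
  obtain ⟨w, hw⟩ : Summable fun m => u₀ m (-a) • modeLp m :=
    summable_smul_modeLp F fun m => bv m (-a) ⟨le_rfl, by linarith⟩
  obtain ⟨w', hw'⟩ : Summable fun m => u₀ m a • modeLp m :=
    summable_smul_modeLp F fun m => bv m a ⟨by linarith, le_rfl⟩
  -- The values `u₁ m (±a)` are fixed combinations of `u₀ m (±a)`, so the traces of `∂₂ψ` converge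
  -- along with those of `ψ` and the boundary condition is built into their sums.
  obtain ⟨p, q, r, l, hpq⟩ := hB.exists_solved
  have hbc : ∀ m, u₁ m (-a) = p * u₀ m (-a) + q * u₀ m a ∧ u₁ m a = r * u₀ m (-a) + l * u₀ m a :=
    fun m => (hpq _ _ _ _).1 (hd m).bc
  have hx : HasSum (fun m => u₁ m (-a) • modeLp m) (p • w + q • w') := by
    refine ((hw.const_smul p).add (hw'.const_smul q)).congr_fun fun m => ?_
    rw [(hbc m).1, add_smul, smul_smul, smul_smul]
  have hx' : HasSum (fun m => u₁ m a • modeLp m) (r • w + l • w') := by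
    refine ((hw.const_smul r).add (hw'.const_smul l)).congr_fun fun m => ?_
    rw [(hbc m).2, add_smul, smul_smul, smul_smul]
  have E₀ := fun m => modeEmb_ae_eq_of_ae_eq m (e₀ m)
  have E₁ := fun m => modeEmb_ae_eq_of_ae_eq m (smul_ae_eq_of_ae_eq (c m) (e₀ m))
  have E₂ := fun m => modeEmb_ae_eq_of_ae_eq m (e₁ m)
  have E₁₁ := fun m => modeEmb_ae_eq_of_ae_eq m
    (smul_ae_eq_of_ae_eq (c m) (smul_ae_eq_of_ae_eq (c m) (e₀ m)))
  have E₁₂ := fun m => modeEmb_ae_eq_of_ae_eq m (smul_ae_eq_of_ae_eq (c m) (e₁ m))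
  have E₂₂ := fun m => modeEmb_ae_eq_of_ae_eq m (e₂ m)
  have hL := memLp_laplaceBeltrami hK (Lp.memLp d₂) (Lp.memLp d₁₁) (Lp.memLp d₂₂)
  have W := fun m => (hd m).isW22_mode ha
  have m₀ : ∀ m, MemLp (u₀ m) 2 (volume.restrict (J₂ a)) := fun m => (hd m).primitive₀.memLp ha
  refine ⟨hL.toLp _, (mem_hamiltonianGraph'_iff hK B _ _).2 ⟨ψ, d₁, d₂, d₁₁, d₁₂, d₂₂,
    Filter.EventuallyEq.rfl, ⟨?_, ?_, ?_, ?_, ?_, ?_⟩, ⟨t, t, s, s, ?_, ?_, ?_⟩,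
    ⟨w, w', _, _, ?_, HasTraces₂.hasSum (fun m => ?_) h₂ h₂₂ hx hx', ?_⟩, hL.coeFn_toLp⟩⟩
  · exact HasWeakDeriv.hasSum (fun m => (W m).h₁.congr_ae (E₀ m) (E₁ m)) hψ h₁
  · exact HasWeakDeriv.hasSum (fun m => (W m).h₂.congr_ae (E₀ m) (E₂ m)) hψ h₂
  · exact HasWeakDeriv.hasSum (fun m => (W m).h₁₁.congr_ae (E₁ m) (E₁₁ m)) h₁ h₁₁
  · exact HasWeakDeriv.hasSum (fun m => (W m).h₁₂.congr_ae (E₂ m) (E₁₂ m)) h₂ h₁₂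
  · exact HasWeakDeriv.hasSum (fun m => (W m).h₂₁.congr_ae (E₁ m) (E₁₂ m)) h₁ h₁₂
  · exact HasWeakDeriv.hasSum (fun m => (W m).h₂₂.congr_ae (E₂ m) (E₂₂ m)) h₂ h₂₂
  · refine HasTraces₁.hasSum (fun m => ?_) hψ h₁ ht ht
    have e := smul_ae_eq_of_ae_eq (mode m π) (e₀ m)
    exact (HasTraces₁.mode m (m₀ m)).congr_ae (E₀ m) (E₁ m) e e
  · refine HasTraces₁.hasSum (fun m => ?_) h₁ h₁₁ hs hs
    have e := smul_ae_eq_of_ae_eq (mode m π) (smul_ae_eq_of_ae_eq (c m) (e₀ m))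
    exact (HasTraces₁.mode m ((m₀ m).const_mul (c m))).congr_ae (E₁ m) (E₁₁ m) e e
  · exact Filter.Eventually.of_forall fun _ => ⟨rfl, rfl⟩
  · refine HasTraces₂.hasSum (fun m => ?_) hψ h₂ hw hw'
    exact (HasTraces₂.mode ha m (hd m).primitive₀ (m₁ m)).congr_ae (E₀ m) (E₂ m)
      (smul_ae_eq_of_ae_eq _ (modeLp_ae_eq m)) (smul_ae_eq_of_ae_eq _ (modeLp_ae_eq m))
  · exact (HasTraces₂.mode ha m (hd m).primitive₁ (m₂ m)).congr_ae (E₂ m) (E₂₂ m)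
      (smul_ae_eq_of_ae_eq _ (modeLp_ae_eq m)) (smul_ae_eq_of_ae_eq _ (modeLp_ae_eq m))
  · filter_upwards [Lp.coeFn_add (p • w) (q • w'), Lp.coeFn_smul p w, Lp.coeFn_smul q w',
      Lp.coeFn_add (r • w) (l • w'), Lp.coeFn_smul r w, Lp.coeFn_smul l w'] with x k1 k2 k3 k4 k5 k6
    rw [hpq, k1, k4, Pi.add_apply, Pi.add_apply, k2, k3, k5, k6]
    exact ⟨rfl, rfl⟩

/-! ### The resolvent set of the Hamiltonian -/

/-- The resolvent is the orthogonal sum of the `R m`, bounded because they are uniformly bounded. -/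
theorem isResolventPoint_hamiltonianGraph' {K : SignType} {a : ℝ} (ha : 0 < a)
    (hK : K = 1 → a < π / 2) {B : BC} (hB : B.Admissible) {z : ℂ}
    (hz : ∀ m, IsResolventPoint (transverseGraph' hK B m) z) :
    IsResolventPoint (hamiltonianGraph' hK B) z := by
  choose R hR₁ hR₂ using hz
  obtain ⟨C, hC, hbound⟩ := exists_uniform_bound ha hK hB z R
  have hdata : ∀ m g, ∃ u₀ u₁ u₂, TransverseData K a B m (R m g) (g + z • R m g) u₀ u₁ u₂ :=
    fun m g => (mem_transverseGraph'_iff ha hK B m _ _).1 (hR₁ m g)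
  have hnorm : ∀ m, ‖R m‖ ≤ C := fun m => by
    refine ContinuousLinearMap.opNorm_le_bound _ hC fun g => ?_
    obtain ⟨u₀, u₁, u₂, hd⟩ := hdata m g
    rw [norm_eq_l2, l2_congr hd.ae_eq]
    exact (le_mul_of_one_le_left (l2_nonneg _ _) (by nlinarith)).trans (hbound m g _ _ _ hd).1
  obtain ⟨S, hS⟩ := exists_diagonal R hC hnorm
  have hproj : ∀ F m, modeProj a m (S F) = R m (modeProj a m F) := fun F m => by
    have h := (hS F).mapL (modeProj a m)
    rw [h.unique (hasSum_single m fun n hn => by rw [modeProj_modeEmb, if_neg hn.symm]),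
      modeProj_modeEmb, if_pos rfl]
  have hinj : ∀ F G : Lp ℂ 2 (volume.restrict (Ω₀ a)),
      (∀ m, modeProj a m F = modeProj a m G) → F = G := fun F G h =>
    sub_eq_zero.1 (eq_zero_of_modeProj fun m => by rw [map_sub, h m, sub_self])
  refine ⟨S, fun F => ?_, ?_⟩
  · choose u₀ u₁ u₂ hd using fun m => hdata m (modeProj a m F)
    have hb := fun m => hbound m _ _ _ _ (hd m)
    obtain ⟨F', hF'⟩ := exists_mem_hamiltonianGraph' ha hK hB F hC hd (fun m => (hb m).1)
      (fun m => (hb m).2.1) (fun m => (hb m).2.2.1) (fun m => (hb m).2.2.2) (hS F)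
    -- The image `F'` need not be computed: its `m`-th coefficient is an image of `R m (modeProj a m
    -- F)` under the transverse operator, which is single-valued.
    have : F' = F + z • S F := hinj _ _ fun m => by
      have h1 := modeProj_mem_graph ha hK hB m _ _ hF'
      rw [hproj] at h1
      rw [transverseGraph'_single_valued hK h1 (hR₁ m _), map_add, map_smul, hproj]
    rwa [← this]
  · rintro ⟨ψ, F⟩ h
    refine hinj _ _ fun m => ?_
    rw [hproj, map_sub, map_smul]
    exact hR₂ m _ (modeProj_mem_graph ha hK hB m _ _ h)

theorem mem_resolventSet_hamiltonian_iff {K : SignType} {a : ℝ} (ha : 0 < a)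
    (hK : K = 1 → a < π / 2) {B : BC} (hB : B.Admissible) (z : ℂ) :
    z ∈ resolventSet (hamiltonian K a B) ↔ ∀ m : ℤ, z ∈ resolventSet (transverse K a B m) := by
  simp only [mem_resolventSet_hamiltonian hK, mem_resolventSet_transverse hK]
  refine ⟨fun h m => ?_, isResolventPoint_hamiltonianGraph' ha hK hB⟩
  refine h.of_retract (modeEmb a m).toContinuousLinearMap (modeProj a m) (fun y => ?_)
    (modeEmb_mem_graph ha hK m) (modeProj_mem_graph ha hK hB m)
  exact (modeProj_modeEmb m m y).trans (if_pos rfl)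

end PTStrip
end

theorem corollary4p1 (K : SignType) (a : ℝ) (ha : 0 < a) (hK : K = 1 → a < π / 2)
    (B : PTStrip.BC) (hB : B.Admissible) :
    PTStrip.spectrum (PTStrip.hamiltonian K a B) =
      ⋃ m : ℤ, PTStrip.spectrum (PTStrip.transverse K a B m) := by
  ext z
  simp only [PTStrip.spectrum, Set.mem_compl_iff, Set.mem_iUnion,
    PTStrip.mem_resolventSet_hamiltonian_iff ha hK hB, not_forall]
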